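/- Let $(\mathsf B,\mathcal F)$ be a display map category: $\mathsf B$ is a category and $\mathcal F$ is a class of maps of $\mathsf B$ (written $\twoheadrightarrow$) such that pullbacks of maps of $\mathcal F$ along arbitrary maps of $\mathsf B$ exist and lie in $\mathcal F$. Assume that $\mathcal F$ contains all isomorphisms and is closed under composition. Let $\mathsf p:\mathsf E\to\mathsf B$ be a Grothendieck fibration with $\mathcal F$-products, i.e. for each $v\in\mathcal F$ the reindexing functor $v^*$ between fibres has a right adjoint $\prod_v$, and for every pullback square $vg=fu$ with $u,v\in\mathcal F$ the canonical transformation $f^*\prod_v\Rightarrow\prod_u g^*$ is an isomorphism (Beck--Chevalley). Definitions. (1) An object $\alpha\in\mathsf E_A$ is *$(\mathcal F,\prod)$-quantifier splitting* if for every $u:C\twoheadrightarrow A$ in $\mathcal F$, every $\beta\in\mathsf E_C$ and every vertical map $h:\prod_u\beta\to\alpha$ there is a unique pair consisting of a section $g:A\to C$ of $u$ and a vertical map $\overline h:g^*\beta\to\alpha$ such that $h$ equals the composite $\prod_u\beta\cong g^*u^*\prod_u\beta\xrightarrow{\,g^*\varepsilon_\beta\,}g^*\beta\xrightarrow{\ \overline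 h\ }\alpha$, where $\varepsilon$ is the counit of $u^*\dashv\prod_u$. It is *$(\mathcal F,\prod)$-quantifier-free* if $f^*\alpha$ is quantifier splitting for every map $f:I\to A$ of $\mathsf B$. The fibration $\mathsf p$ *has enough $(\mathcal F,\prod)$-quantifier-free objects* if for all $I\in\mathsf B$ and $\alpha\in\mathsf E_I$ there are a map $f:A\twoheadrightarrow I$ in $\mathcal F$ and a quantifier-free $\beta\in\mathsf E_A$ with $\alpha\cong\prod_f\beta$ in $\mathsf E_I$. (2) For a fibration $\mathsf q:\mathsf E'\to\mathsf B$, the *product completion* $\Pi_{\mathcal F}(\mathsf q):\Pi_{\mathcal F}(\mathsf E')\to\mathsf B$ is defined as follows. Objects of $\Pi_{\mathcal F}(\mathsf E')$ are pairs $(g:X\twoheadrightarrow I,\ \alpha\in\mathsf E'_X)$ with $g\in\mathcal F$. A morphism $(g:X\twoheadrightarrow I,\alpha)\to(h:Y\twoheadrightarrow J,\beta)$ is a triple $(f_0,f_1,\phi)$ of a map $f_0:I\to J$, a map $f_1:I\times_J Y\to X$ over $I$, and a vertical map $\phi:f_1^*\alpha\to \mathrm{pr}_2^*\beta$ in $\mathsf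 E'_{I\times_J Y}$, where $\mathrm{pr}_2:I\times_JY\to Y$ is the projection; composition is by substitution. The functor $\Pi_{\mathcal F}(\mathsf q)$ sends $(g:X\twoheadrightarrow I,\alpha)$ to $I$ and $(f_0,f_1,\phi)$ to $f_0$. Theorem. There exist a fibration $\mathsf q:\mathsf E'\to\mathsf B$ and a fibred equivalence over $\mathsf B$ between $\mathsf p$ and $\Pi_{\mathcal F}(\mathsf q)$ if and only if $\mathsf p$ has enough $(\mathcal F,\prod)$-quantifier-free objects. (A fibred equivalence over $\mathsf B$ is an equivalence of total categories whose two functors commute with the functors to $\mathsf B$ and preserve cartesian arrows, and whose unit and counit are vertical.) -/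

import Mathlib

open CategoryTheory CategoryTheory.Limits

universe v₁ v₂ v₃ u₁ u₂ u₃

noncomputable section

namespace FibredProducts

variable {B : Type u₁} [Category.{v₁} B]

/-- `F` is a class of display maps: the pullback of a member of `F` along an arbitrary map exists,
and every pullback of a member of `F` is again in `F`. -/
class IsDisplayMapClass (F : MorphismProperty B) : Prop extends F.IsStableUnderBaseChange where
  hasPullback {I J Y : B} (f : I ⟶ J) (h : Y ⟶ J) (hh : F h) : HasPullback f h

/-- The display map category `(B, F)` has units: all isomorphisms are display maps. -/
def HasUnits (F : MorphismProperty B) : Prop :=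
  MorphismProperty.isomorphisms B ≤ F

/-! ### Reindexing in a fibration -/

section Fibre

variable {E : Type u₂} [Category.{v₂} E] {p : E ⥤ B}

/-- The underlying object of the total category of an object of a fibre. -/
abbrev tot {S : B} (X : p.Fiber S) : E := Functor.Fiber.fiberInclusion.obj X

/-- The underlying arrow of the total category of a vertical arrow. -/
abbrev totMap {S : B} {X Y : p.Fiber S} (φ : X ⟶ Y) : tot X ⟶ tot Y :=
  Functor.Fiber.fiberInclusion.map φ

lemma tot_proj {S : B} (X : p.Fiber S) : p.obj (tot X) = S := X.2

/-- An arrow over the identity, as an arrow of the fibre. -/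
def vertMk {S : B} {X Y : p.Fiber S} (φ : tot X ⟶ tot Y) (hφ : p.IsHomLift (𝟙 S) φ) : X ⟶ Y :=
  ⟨φ, hφ⟩

@[simp] lemma totMap_vertMk {S : B} {X Y : p.Fiber S} (φ : tot X ⟶ tot Y)
    (hφ : p.IsHomLift (𝟙 S) φ) : totMap (vertMk φ hφ) = φ := rfl

end Fibre

section Reindexing

variable {E : Type u₂} [Category.{v₂} E] (p : E ⥤ B) [p.IsFibered]

/-- The object `u^* Y` for a choice of cartesian liftings. -/
def liftObj {I J : B} (u : I ⟶ J) (Y : p.Fiber J) : p.Fiber I :=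
  Functor.Fiber.mk (Functor.IsPreFibered.pullbackObj_proj (tot_proj Y) u)

/-- The chosen cartesian lifting of `u` with codomain `Y`. -/
def liftMap {I J : B} (u : I ⟶ J) (Y : p.Fiber J) : tot (liftObj p u Y) ⟶ tot Y :=
  Functor.IsPreFibered.pullbackMap (tot_proj Y) u

instance liftMap_isCartesian {I J : B} (u : I ⟶ J) (Y : p.Fiber J) :
    p.IsCartesian u (liftMap p u Y) :=
  inferInstanceAs (p.IsCartesian u (Functor.IsPreFibered.pullbackMap (tot_proj Y) u))

/-- The reindexing (substitution) functor `u^* : E_J ⥤ E_I`. -/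
def reindex {I J : B} (u : I ⟶ J) : p.Fiber J ⥤ p.Fiber I where
  obj Y := liftObj p u Y
  map {X Y} φ := vertMk
    (Functor.IsCartesian.map p u (liftMap p u Y) (liftMap p u X ≫ totMap φ)) inferInstance
  map_id X := Functor.Fiber.hom_ext <|
    Functor.IsCartesian.ext p u (liftMap p u X) _ _ (by simp)
  map_comp {X Y Z} φ ψ := Functor.Fiber.hom_ext <|
    Functor.IsCartesian.ext p u (liftMap p u Z) _ _ (by simp)

/-- The chosen cartesian lifting `u^* Y ⟶ Y` of `u`. -/
def cart {I J : B} (u : I ⟶ J) (Y : p.Fiber J) : tot ((reindex p u).obj Y) ⟶ tot Y :=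
  liftMap p u Y

instance cart_isCartesian {I J : B} (u : I ⟶ J) (Y : p.Fiber J) :
    p.IsCartesian u (cart p u Y) :=
  liftMap_isCartesian p u Y

@[simp]
lemma reindex_map_cart {I J : B} (u : I ⟶ J) {X Y : p.Fiber J} (φ : X ⟶ Y) :
    totMap ((reindex p u).map φ) ≫ cart p u Y = cart p u X ≫ totMap φ :=
  Functor.IsCartesian.fac p u (cart p u Y) (cart p u X ≫ totMap φ)

@[simp]
lemma reindex_map_cart_assoc {I J : B} (u : I ⟶ J) {X Y : p.Fiber J} (φ : X ⟶ Y) {Z : E}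
    (k : tot Y ⟶ Z) : totMap ((reindex p u).map φ) ≫ cart p u Y ≫ k =
      cart p u X ≫ totMap φ ≫ k := by
  rw [← Category.assoc, reindex_map_cart, Category.assoc]

/-- The vertical arrow `X ⟶ u^* Y` induced by an arrow `φ : X ⟶ Y` lying over `u`. -/
def toReindex {I J : B} (u : I ⟶ J) {X : p.Fiber I} {Y : p.Fiber J} (φ : tot X ⟶ tot Y)
    (hφ : p.IsHomLift u φ) : X ⟶ (reindex p u).obj Y :=
  vertMk (Functor.IsCartesian.map p u (cart p u Y) φ) inferInstance

@[simp]
lemma toReindex_cart {I J : B} (u : I ⟶ J) {X : p.Fiber I} {Y : p.Fiber J} (φ : tot X ⟶ tot Y)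
    (hφ : p.IsHomLift u φ) : totMap (toReindex p u φ hφ) ≫ cart p u Y = φ :=
  Functor.IsCartesian.fac p u (cart p u Y) φ

variable {p} in
lemma reindex_hom_ext {I J : B} (u : I ⟶ J) {X : p.Fiber I} {Y : p.Fiber J}
    {φ ψ : X ⟶ (reindex p u).obj Y}
    (h : totMap φ ≫ cart p u Y = totMap ψ ≫ cart p u Y) : φ = ψ :=
  Functor.Fiber.hom_ext (Functor.IsCartesian.ext p u (cart p u Y) _ _ h)

/-- The arrow `c ⟶ u^* Y` over `m` induced by an arrow `θ : c ⟶ Y` lying over `m ≫ u`. -/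
def factor {T I J : B} (m : T ⟶ I) (u : I ⟶ J) {n : T ⟶ J} (hn : n = m ≫ u) {Y : p.Fiber J}
    {c : E} (θ : c ⟶ tot Y) (hθ : p.IsHomLift n θ) : c ⟶ tot ((reindex p u).obj Y) :=
  Functor.IsStronglyCartesian.map p u (cart p u Y) hn θ

lemma factor_isHomLift {T I J : B} (m : T ⟶ I) (u : I ⟶ J) {n : T ⟶ J} (hn : n = m ≫ u)
    {Y : p.Fiber J} {c : E} (θ : c ⟶ tot Y) (hθ : p.IsHomLift n θ) :
    p.IsHomLift m (factor p m u hn θ hθ) :=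
  Functor.IsStronglyCartesian.map_isHomLift p u (cart p u Y) hn θ

@[simp]
lemma factor_cart {T I J : B} (m : T ⟶ I) (u : I ⟶ J) {n : T ⟶ J} (hn : n = m ≫ u)
    {Y : p.Fiber J} {c : E} (θ : c ⟶ tot Y) (hθ : p.IsHomLift n θ) :
    factor p m u hn θ hθ ≫ cart p u Y = θ :=
  Functor.IsStronglyCartesian.fac p u (cart p u Y) hn θ

lemma eq_factor {T I J : B} (m : T ⟶ I) (u : I ⟶ J) {n : T ⟶ J} (hn : n = m ≫ u)
    {Y : p.Fiber J} {c : E} (θ : c ⟶ tot Y) (hθ : p.IsHomLift n θ)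
    (χ : c ⟶ tot ((reindex p u).obj Y)) (hχ : p.IsHomLift m χ) (e : χ ≫ cart p u Y = θ) :
    χ = factor p m u hn θ hθ :=
  Functor.IsStronglyCartesian.map_uniq p u (cart p u Y) hn θ χ e

variable {p} in
lemma reindex_hom_ext₂ {K L J : B} (g : K ⟶ L) (v : L ⟶ J) {X : p.Fiber K} {Y : p.Fiber J}
    {φ ψ : X ⟶ (reindex p g).obj ((reindex p v).obj Y)}
    (h : totMap φ ≫ cart p g _ ≫ cart p v Y = totMap ψ ≫ cart p g _ ≫ cart p v Y) : φ = ψ :=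
  Functor.Fiber.hom_ext (Functor.IsCartesian.ext p (g ≫ v)
    (cart p g ((reindex p v).obj Y) ≫ cart p v Y) _ _ h)

/-- The vertical arrow `X ⟶ g^* v^* Y` induced by an arrow `φ : X ⟶ Y` lying over `g ≫ v`. -/
def toReindex₂ {K L J : B} (g : K ⟶ L) (v : L ⟶ J) {X : p.Fiber K} {Y : p.Fiber J}
    (φ : tot X ⟶ tot Y) (hφ : p.IsHomLift (g ≫ v) φ) :
    X ⟶ (reindex p g).obj ((reindex p v).obj Y) :=
  vertMk (Functor.IsCartesian.map p (g ≫ v) (cart p g ((reindex p v).obj Y) ≫ cart p v Y) φ)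
    inferInstance

@[simp]
lemma toReindex₂_cart {K L J : B} (g : K ⟶ L) (v : L ⟶ J) {X : p.Fiber K} {Y : p.Fiber J}
    (φ : tot X ⟶ tot Y) (hφ : p.IsHomLift (g ≫ v) φ) :
    totMap (toReindex₂ p g v φ hφ) ≫ cart p g _ ≫ cart p v Y = φ :=
  Functor.IsCartesian.fac p (g ≫ v) (cart p g ((reindex p v).obj Y) ≫ cart p v Y) φ

/-- For `u ≫ f = g ≫ v`, the canonical vertical comparison `u^* f^* X ⟶ g^* v^* X`. -/
def squareApp {K I L J : B} {u : K ⟶ I} {g : K ⟶ L} {f : I ⟶ J} {v : L ⟶ J}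
    (w : u ≫ f = g ≫ v) (X : p.Fiber J) :
    (reindex p u).obj ((reindex p f).obj X) ⟶ (reindex p g).obj ((reindex p v).obj X) :=
  toReindex₂ p g v (cart p u _ ≫ cart p f X) (w ▸ inferInstance)

@[simp]
lemma squareApp_cart {K I L J : B} {u : K ⟶ I} {g : K ⟶ L} {f : I ⟶ J} {v : L ⟶ J}
    (w : u ≫ f = g ≫ v) (X : p.Fiber J) :
    totMap (squareApp p w X) ≫ cart p g _ ≫ cart p v X = cart p u _ ≫ cart p f X :=
  toReindex₂_cart p g v _ _

@[simp]
lemma squareApp_cart_assoc {K I L J : B} {u : K ⟶ I} {g : K ⟶ L} {f : I ⟶ J} {v : L ⟶ J}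
    (w : u ≫ f = g ≫ v) (X : p.Fiber J) {Z : E} (k : tot X ⟶ Z) :
    totMap (squareApp p w X) ≫ cart p g _ ≫ cart p v X ≫ k =
      cart p u _ ≫ cart p f X ≫ k := by
  simp only [← Category.assoc]
  exact congrArg (· ≫ k) (by simp only [Category.assoc]; exact squareApp_cart p w X)

lemma squareApp_squareApp {K I L J : B} {u : K ⟶ I} {g : K ⟶ L} {f : I ⟶ J} {v : L ⟶ J}
    (w : u ≫ f = g ≫ v) (X : p.Fiber J) :
    squareApp p w X ≫ squareApp p w.symm X = 𝟙 _ := by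
  apply reindex_hom_ext₂
  simp

/-- The canonical natural isomorphism `u^* f^* ≅ g^* v^*` of a commutative square
`u ≫ f = g ≫ v`. -/
def squareIso {K I L J : B} {u : K ⟶ I} {g : K ⟶ L} {f : I ⟶ J} {v : L ⟶ J}
    (w : u ≫ f = g ≫ v) : reindex p f ⋙ reindex p u ≅ reindex p v ⋙ reindex p g :=
  NatIso.ofComponents
    (fun X =>
      { hom := squareApp p w X
        inv := squareApp p w.symm X
        hom_inv_id := squareApp_squareApp p w X
        inv_hom_id := squareApp_squareApp p w.symm X })
    (fun φ => by
      apply reindex_hom_ext₂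
      simp)

/-- For a section `g` of `u`, the canonical vertical isomorphism `Y ≅ g^* u^* Y`. -/
def sectionIso {A C : B} (u : C ⟶ A) (g : A ⟶ C) (hg : g ≫ u = 𝟙 A) (Y : p.Fiber A) :
    Y ≅ (reindex p g).obj ((reindex p u).obj Y) where
  hom := toReindex₂ p g u (𝟙 (tot Y)) (hg ▸ IsHomLift.id (tot_proj Y))
  inv := vertMk (cart p g _ ≫ cart p u Y)
    (hg ▸ (inferInstance : p.IsHomLift (g ≫ u) (cart p g _ ≫ cart p u Y)))
  hom_inv_id := Functor.Fiber.hom_ext (by simp)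
  inv_hom_id := by
    apply reindex_hom_ext₂
    simp

end Reindexing

/-! ### Fibred products -/

section Products

variable {E : Type u₂} [Category.{v₂} E] (F : MorphismProperty B) (p : E ⥤ B) [p.IsFibered]

/-- Reindexing along every display map has a right adjoint. -/
class HasRightAdjoints : Prop where
  isLeftAdjoint {A J : B} (v : A ⟶ J) (hv : F v) : (reindex p v).IsLeftAdjoint

variable {F}

/-- The product functor `∏_v : E_A ⥤ E_J` along a display map `v : A ⟶ J`. -/
def prod [HasRightAdjoints F p] {A J : B} (v : A ⟶ J) (hv : F v) : p.Fiber A ⥤ p.Fiber J :=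
  have := HasRightAdjoints.isLeftAdjoint (p := p) v hv
  (reindex p v).rightAdjoint

/-- The adjunction `v^* ⊣ ∏_v`. -/
def prodAdj [HasRightAdjoints F p] {A J : B} (v : A ⟶ J) (hv : F v) :
    reindex p v ⊣ prod p v hv :=
  have := HasRightAdjoints.isLeftAdjoint (p := p) v hv
  Adjunction.ofIsLeftAdjoint (reindex p v)

/-- The canonical transformation `f^* ∏_v ⟶ ∏_u g^*` attached to a commutative square
```
K --u--> I
|g       |f
L --v--> J
```
with `u`, `v` display maps: the mate of the canonical isomorphism `u^* f^* ≅ g^* v^*`. -/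
def beckChevalley [HasRightAdjoints F p] {K I L J : B} {u : K ⟶ I} {g : K ⟶ L} {f : I ⟶ J}
    {v : L ⟶ J} (w : u ≫ f = g ≫ v) (hu : F u) (hv : F v) :
    prod p v hv ⋙ reindex p f ⟶ reindex p g ⋙ prod p u hu :=
  (mateEquiv (prodAdj p v hv) (prodAdj p u hu)
    (TwoSquare.mk _ _ _ _ (squareIso p w).hom)).natTrans

variable (F)

/-- The fibration `p` has (fibred) products along `F`: reindexing along display maps has right
adjoints and the Beck--Chevalley condition holds for every pullback square. -/
class HasFibredProducts : Prop extends HasRightAdjoints F p where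
  isIso_beckChevalley {K I L J : B} {u : K ⟶ I} {g : K ⟶ L} {f : I ⟶ J} {v : L ⟶ J}
    (sq : IsPullback u g f v) (hu : F u) (hv : F v) : IsIso (beckChevalley p sq.w hu hv)

variable [HasFibredProducts F p]

/-- `α` over `A` is `(F, ∏)`-quantifier splitting: each vertical `h : ∏_u β ⟶ α`, with
`u : C ⟶ A` a display map and `β` over `C`, factors through `g^* ε_β` (precomposed with
`∏_u β ≅ g^* u^* ∏_u β`) by a unique pair of a section `g` of `u` and a vertical
`h' : g^* β ⟶ α`. -/
def IsQuantifierSplitting {A : B} (α : p.Fiber A) : Prop :=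
  ∀ ⦃C : B⦄ (u : C ⟶ A) (hu : F u) (β : p.Fiber C) (h : (prod p u hu).obj β ⟶ α),
    ∃! s : (Σ g : { g : A ⟶ C // g ≫ u = 𝟙 A }, ((reindex p g.1).obj β ⟶ α)),
      h = (sectionIso p u s.1.1 s.1.2 ((prod p u hu).obj β)).hom ≫
        (reindex p s.1.1).map ((prodAdj p u hu).counit.app β) ≫ s.2

/-- `α` is `(F, ∏)`-quantifier-free: all its reindexings are quantifier splitting. -/
def IsQuantifierFree {A : B} (α : p.Fiber A) : Prop :=
  ∀ ⦃I : B⦄ (f : I ⟶ A), IsQuantifierSplitting F p ((reindex p f).obj α)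

/-- The fibration `p`, with `F`-products, has enough `(F, ∏)`-quantifier-free objects. -/
def HasEnoughQuantifierFree : Prop :=
  ∀ ⦃I : B⦄ (α : p.Fiber I), ∃ (A : B) (f : A ⟶ I) (hf : F f) (β : p.Fiber A),
    IsQuantifierFree F p β ∧ Nonempty (α ≅ (prod p f hf).obj β)

end Products

/-! ### The product completion -/

section Completion

/-- An object of the product completion: a display map `map : dom ⟶ base` together with an
object of the fibre over its domain. -/
structure PiObj (F : MorphismProperty B) {E : Type u₂} [Category.{v₂} E] (q : E ⥤ B) where
  base : B
  dom : B
  map : dom ⟶ base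
  display : F map
  obj : q.Fiber dom

variable {F : MorphismProperty B} [IsDisplayMapClass F]
  {E : Type u₂} [Category.{v₂} E] {q : E ⥤ B} [q.IsFibered]

instance PiObj.hasPullback (y : PiObj F q) {I : B} (f : I ⟶ y.base) : HasPullback f y.map :=
  IsDisplayMapClass.hasPullback f y.map y.display

/-- A morphism `(X ⟶ I, α) ⟶ (Y ⟶ J, β)` of the product completion: a map `base : I ⟶ J`, a map
`dom : I ×_J Y ⟶ X` over `I`, and a vertical arrow `dom^* α ⟶ pr₂^* β` over `I ×_J Y`, where
`pr₂ : I ×_J Y ⟶ Y` is the projection. -/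
structure PiHom (x y : PiObj F q) where
  base : x.base ⟶ y.base
  dom : pullback base y.map ⟶ x.dom
  w : dom ≫ x.map = pullback.fst base y.map
  vert : (reindex q dom).obj x.obj ⟶ (reindex q (pullback.snd base y.map)).obj y.obj

namespace PiHom

variable {x y z : PiObj F q}

/-- The map `T ⟶ X` obtained from `φ.dom` at a point `(a, b) : T ⟶ I ×_J Y`. -/
def app (φ : PiHom x y) {T : B} (a : T ⟶ x.base) (b : T ⟶ y.dom)
    (h : a ≫ φ.base = b ≫ y.map) : T ⟶ x.dom :=
  pullback.lift a b h ≫ φ.dom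

lemma app_def (φ : PiHom x y) {T : B} (a : T ⟶ x.base) (b : T ⟶ y.dom)
    (h : a ≫ φ.base = b ≫ y.map) : φ.app a b h = pullback.lift a b h ≫ φ.dom := rfl

lemma app_map (φ : PiHom x y) {T : B} (a : T ⟶ x.base) (b : T ⟶ y.dom)
    (h : a ≫ φ.base = b ≫ y.map) : φ.app a b h ≫ x.map = a := by
  rw [app, Category.assoc, φ.w]
  exact pullback.lift_fst _ _ _

/-- The action of `φ` on arrows into `α`: an arrow `θ : c ⟶ α` over `φ.app a b` factors through
`dom^* α`, and composing with `φ.vert` and `pr₂^* β ⟶ β` gives an arrow `c ⟶ β` over `b`. -/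
def push (φ : PiHom x y) {T : B} (a : T ⟶ x.base) (b : T ⟶ y.dom)
    (h : a ≫ φ.base = b ≫ y.map) {c : E} (θ : c ⟶ tot x.obj)
    (hθ : q.IsHomLift (φ.app a b h) θ) : c ⟶ tot y.obj :=
  factor q (pullback.lift a b h) φ.dom (φ.app_def a b h) θ hθ ≫ totMap φ.vert ≫
    cart q (pullback.snd φ.base y.map) y.obj

lemma push_isHomLift (φ : PiHom x y) {T : B} (a : T ⟶ x.base) (b : T ⟶ y.dom)
    (h : a ≫ φ.base = b ≫ y.map) {c : E} (θ : c ⟶ tot x.obj)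
    (hθ : q.IsHomLift (φ.app a b h) θ) : q.IsHomLift b (φ.push a b h θ hθ) := by
  have h₁ := factor_isHomLift q (pullback.lift a b h) φ.dom (φ.app_def a b h) θ hθ
  have h₂ : q.IsHomLift (pullback.snd φ.base y.map)
      (totMap φ.vert ≫ cart q (pullback.snd φ.base y.map) y.obj) := inferInstance
  have h₃ : q.IsHomLift (pullback.lift a b h ≫ pullback.snd φ.base y.map)
    (φ.push a b h θ hθ) := IsHomLift.comp q _ _ _ _
  rwa [pullback.lift_snd] at h₃

lemma app_universal (φ : PiHom x y) :
    φ.app (pullback.fst φ.base y.map) (pullback.snd φ.base y.map) pullback.condition =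
      φ.dom := by
  have : pullback.lift (pullback.fst φ.base y.map) (pullback.snd φ.base y.map)
      pullback.condition = 𝟙 _ := by ext <;> simp
  rw [app, this, Category.id_comp]

lemma push_universal (φ : PiHom x y) (h₀ : q.IsHomLift (φ.app (pullback.fst φ.base y.map)
      (pullback.snd φ.base y.map) pullback.condition) (cart q φ.dom x.obj)) :
    φ.push (pullback.fst φ.base y.map) (pullback.snd φ.base y.map) pullback.condition
      (cart q φ.dom x.obj) h₀ =
      totMap φ.vert ≫ cart q (pullback.snd φ.base y.map) y.obj := by
  have e : pullback.lift (pullback.fst φ.base y.map) (pullback.snd φ.base y.map)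
      pullback.condition = 𝟙 _ := by ext <;> simp
  rw [push, ← eq_factor q _ φ.dom (φ.app_def _ _ _) (cart q φ.dom x.obj) h₀ (𝟙 _)
    (e ▸ IsHomLift.id (tot_proj _)) (Category.id_comp _), Category.id_comp]

/-- Two morphisms agree if they have the same base map and the same actions `app` and `push`. -/
lemma ext' {φ ψ : PiHom x y} (hb : φ.base = ψ.base)
    (ha : ∀ {T : B} (a : T ⟶ x.base) (b : T ⟶ y.dom) (h : a ≫ φ.base = b ≫ y.map)
      (h' : a ≫ ψ.base = b ≫ y.map), φ.app a b h = ψ.app a b h')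
    (hp : ∀ {T : B} (a : T ⟶ x.base) (b : T ⟶ y.dom) (h : a ≫ φ.base = b ≫ y.map)
      (h' : a ≫ ψ.base = b ≫ y.map) {c : E} (θ : c ⟶ tot x.obj)
      (hθ : q.IsHomLift (φ.app a b h) θ) (hθ' : q.IsHomLift (ψ.app a b h') θ),
      φ.push a b h θ hθ = ψ.push a b h' θ hθ') : φ = ψ := by
  have hφ₁ := φ.app_universal
  have hψ₁ := ψ.app_universal
  have hφ₂ := φ.push_universal
  have hψ₂ := ψ.push_universal
  obtain ⟨f, d, w, t⟩ := φ
  obtain ⟨f', d', w', t'⟩ := ψ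
  dsimp only at hb hφ₁ hψ₁ hφ₂ hψ₂
  subst hb
  obtain rfl : d = d' := hφ₁.symm.trans ((ha _ _ _ _).trans hψ₁)
  have h₀ : q.IsHomLift d (cart q d x.obj) := inferInstance
  obtain rfl : t = t' := reindex_hom_ext _
    ((hφ₂ (hφ₁.symm ▸ h₀)).symm.trans ((hp _ _ _ _ _ _ _).trans (hψ₂ (hψ₁.symm ▸ h₀))))
  rfl

lemma app_natural (φ : PiHom x y) {T T' : B} (r : T' ⟶ T) {a : T ⟶ x.base} {b : T ⟶ y.dom}
    (h : a ≫ φ.base = b ≫ y.map) {a' : T' ⟶ x.base} {b' : T' ⟶ y.dom}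
    (h' : a' ≫ φ.base = b' ≫ y.map) (ha : r ≫ a = a') (hb : r ≫ b = b') :
    r ≫ φ.app a b h = φ.app a' b' h' := by
  have : r ≫ pullback.lift a b h = pullback.lift a' b' h' := by
    apply pullback.hom_ext <;> simp [pullback.lift_fst, pullback.lift_snd, ha, hb]
  rw [app, app, ← this, Category.assoc]

lemma push_natural (φ : PiHom x y) {T T' : B} (r : T' ⟶ T) {a : T ⟶ x.base} {b : T ⟶ y.dom}
    (h : a ≫ φ.base = b ≫ y.map) {a' : T' ⟶ x.base} {b' : T' ⟶ y.dom}
    (h' : a' ≫ φ.base = b' ≫ y.map) (ha : r ≫ a = a') (hb : r ≫ b = b')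
    {c c' : E} (χ : c' ⟶ c) (hχ : q.IsHomLift r χ) (θ : c ⟶ tot x.obj)
    (hθ : q.IsHomLift (φ.app a b h) θ) (θ' : c' ⟶ tot x.obj)
    (hθ' : q.IsHomLift (φ.app a' b' h') θ') (e : χ ≫ θ = θ') :
    χ ≫ φ.push a b h θ hθ = φ.push a' b' h' θ' hθ' := by
  have e₁ : r ≫ pullback.lift a b h = pullback.lift a' b' h' := by
    apply pullback.hom_ext <;> simp [pullback.lift_fst, pullback.lift_snd, ha, hb]
  have h₁ := factor_isHomLift q (pullback.lift a b h) φ.dom (φ.app_def a b h) θ hθ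
  have h₂ : q.IsHomLift (pullback.lift a' b' h')
      (χ ≫ factor q (pullback.lift a b h) φ.dom (φ.app_def a b h) θ hθ) := by
    rw [← e₁]
    exact IsHomLift.comp q _ _ _ _
  rw [push, push, ← eq_factor q _ φ.dom (φ.app_def a' b' h') θ' hθ' _ h₂ (by simp [e]), Category.assoc]

lemma app_congr (φ : PiHom x y) {T : B} {a a' : T ⟶ x.base} {b b' : T ⟶ y.dom}
    (h : a ≫ φ.base = b ≫ y.map) (h' : a' ≫ φ.base = b' ≫ y.map) (ha : a = a') (hb : b = b') :
    φ.app a b h = φ.app a' b' h' := by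
  subst ha hb
  rfl

lemma push_congr (φ : PiHom x y) {T : B} {a a' : T ⟶ x.base} {b b' : T ⟶ y.dom}
    (h : a ≫ φ.base = b ≫ y.map) (h' : a' ≫ φ.base = b' ≫ y.map) (ha : a = a') (hb : b = b')
    {c : E} {θ θ' : c ⟶ tot x.obj} (hθ : q.IsHomLift (φ.app a b h) θ)
    (hθ' : q.IsHomLift (φ.app a' b' h') θ') (e : θ = θ') :
    φ.push a b h θ hθ = φ.push a' b' h' θ' hθ' := by
  subst ha hb e
  rfl

/-- Constructor from a base map, a map `d : I ×_J Y ⟶ X` over `I`, and an arrow `d^* α ⟶ β`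
over the projection `pr₂`. -/
def ofArrow (f : x.base ⟶ y.base) (d : pullback f y.map ⟶ x.dom)
    (w : d ≫ x.map = pullback.fst f y.map) (t : tot ((reindex q d).obj x.obj) ⟶ tot y.obj)
    (ht : q.IsHomLift (pullback.snd f y.map) t) : PiHom x y where
  base := f
  dom := d
  w := w
  vert := toReindex q (pullback.snd f y.map) t ht

lemma ofArrow_push (f : x.base ⟶ y.base) (d : pullback f y.map ⟶ x.dom)
    (w : d ≫ x.map = pullback.fst f y.map) (t : tot ((reindex q d).obj x.obj) ⟶ tot y.obj)
    (ht : q.IsHomLift (pullback.snd f y.map) t) {T : B} (a : T ⟶ x.base) (b : T ⟶ y.dom)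
    (h : a ≫ f = b ≫ y.map) {c : E} (θ : c ⟶ tot x.obj)
    (hθ : q.IsHomLift ((ofArrow f d w t ht).app a b h) θ) :
    (ofArrow f d w t ht).push a b h θ hθ =
      factor q (pullback.lift a b h) d ((ofArrow f d w t ht).app_def a b h) θ hθ ≫ t :=
  congrArg (factor q (pullback.lift a b h) d ((ofArrow f d w t ht).app_def a b h) θ hθ ≫ ·)
    (toReindex_cart q (pullback.snd f y.map) t ht)

/-- The identity morphism. -/
def id (x : PiObj F q) : PiHom x x :=
  ofArrow (𝟙 x.base) (pullback.snd (𝟙 x.base) x.map)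
    (by rw [← pullback.condition, Category.comp_id]) (cart q _ x.obj) inferInstance

lemma id_app (x : PiObj F q) {T : B} (a : T ⟶ x.base) (b : T ⟶ x.dom)
    (h : a ≫ 𝟙 x.base = b ≫ x.map) : (id x).app a b h = b :=
  pullback.lift_snd _ _ _

lemma id_push (x : PiObj F q) {T : B} (a : T ⟶ x.base) (b : T ⟶ x.dom)
    (h : a ≫ 𝟙 x.base = b ≫ x.map) {c : E} (θ : c ⟶ tot x.obj)
    (hθ : q.IsHomLift ((id x).app a b h) θ) : (id x).push a b h θ hθ = θ :=
  (ofArrow_push _ _ _ _ _ _ _ _ _ _).trans (factor_cart q _ _ _ _ _)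

section Comp

variable (φ : PiHom x y) (ψ : PiHom y z)

lemma comp_aux₁ {T : B} (a : T ⟶ x.base) (c : T ⟶ z.dom)
    (h : a ≫ φ.base ≫ ψ.base = c ≫ z.map) : (a ≫ φ.base) ≫ ψ.base = c ≫ z.map :=
  (Category.assoc _ _ _).trans h

lemma comp_aux₂ {T : B} (a : T ⟶ x.base) (c : T ⟶ z.dom)
    (h : a ≫ φ.base ≫ ψ.base = c ≫ z.map) :
    a ≫ φ.base = ψ.app (a ≫ φ.base) c (comp_aux₁ φ ψ a c h) ≫ y.map :=
  (ψ.app_map _ _ _).symm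

/-- The composite on points: `(a, c) ↦ φ.app a (ψ.app (a ≫ φ.base) c)`. -/
def compApp {T : B} (a : T ⟶ x.base) (c : T ⟶ z.dom)
    (h : a ≫ φ.base ≫ ψ.base = c ≫ z.map) : T ⟶ x.dom :=
  φ.app a (ψ.app (a ≫ φ.base) c (comp_aux₁ φ ψ a c h)) (comp_aux₂ φ ψ a c h)

/-- The composite on arrows: first the action of `φ`, then the action of `ψ`. -/
def compPush {T : B} (a : T ⟶ x.base) (c : T ⟶ z.dom)
    (h : a ≫ φ.base ≫ ψ.base = c ≫ z.map) {e : E} (θ : e ⟶ tot x.obj)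
    (hθ : q.IsHomLift (compApp φ ψ a c h) θ) : e ⟶ tot z.obj :=
  ψ.push (a ≫ φ.base) c (comp_aux₁ φ ψ a c h)
    (φ.push a (ψ.app (a ≫ φ.base) c (comp_aux₁ φ ψ a c h)) (comp_aux₂ φ ψ a c h) θ hθ)
    (φ.push_isHomLift _ _ _ _ _)

/-- The composite of two morphisms: its component `I ×_K Z ⟶ X` is the composite
`I ×_K Z ⟶ I ×_J (J ×_K Z) ⟶ I ×_J Y ⟶ X`, and its vertical component is
the composite of the reindexed vertical components. -/
def comp : PiHom x z :=
  ofArrow (φ.base ≫ ψ.base) (compApp φ ψ (pullback.fst _ _) (pullback.snd _ _) pullback.condition)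
    (φ.app_map _ _ _)
    (compPush φ ψ (pullback.fst _ _) (pullback.snd _ _) pullback.condition (cart q _ x.obj)
      inferInstance)
    (ψ.push_isHomLift _ _ _ _ _)

lemma comp_app {T : B} (a : T ⟶ x.base) (c : T ⟶ z.dom)
    (h : a ≫ φ.base ≫ ψ.base = c ≫ z.map) : (comp φ ψ).app a c h = compApp φ ψ a c h :=
  φ.app_natural _ _ _ (pullback.lift_fst _ _ _)
    (ψ.app_natural _ _ _ (pullback.lift_fst_assoc _ _ _ _) (pullback.lift_snd _ _ _))

lemma comp_push {T : B} (a : T ⟶ x.base) (c : T ⟶ z.dom)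
    (h : a ≫ φ.base ≫ ψ.base = c ≫ z.map) {e : E} (θ : e ⟶ tot x.obj)
    (hθ : q.IsHomLift ((comp φ ψ).app a c h) θ) :
    (comp φ ψ).push a c h θ hθ = compPush φ ψ a c h θ (comp_app φ ψ a c h ▸ hθ) := by
  refine (ofArrow_push _ _ _ _ _ _ _ _ _ _).trans ?_
  exact ψ.push_natural _ _ _ (pullback.lift_fst_assoc _ _ _ _) (pullback.lift_snd _ _ _) _
    (factor_isHomLift q _ _ _ _ _) _ _ _ _
    (φ.push_natural _ _ _ (pullback.lift_fst _ _ _)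
      (ψ.app_natural _ _ _ (pullback.lift_fst_assoc _ _ _ _) (pullback.lift_snd _ _ _)) _
      (factor_isHomLift q _ _ _ _ _) _ _ _ _ (factor_cart q _ _ _ _ _))

end Comp

end PiHom

/-- The total category `Π_F(E)` of the product completion of `q : E ⥤ B`. -/
instance : Category (PiObj F q) where
  Hom x y := PiHom x y
  id x := PiHom.id x
  comp φ ψ := PiHom.comp φ ψ
  id_comp {x y} φ := PiHom.ext' (Category.id_comp φ.base)
    (fun a b h h' => ((PiHom.id x).comp_app φ a b h).trans
      ((PiHom.id_app x _ _ _).trans (φ.app_congr _ _ (Category.comp_id _) rfl)))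
    (fun {T} a b h h' {c} θ hθ hθ' => ((PiHom.id x).comp_push φ a b h θ hθ).trans
      (φ.push_congr _ _ (Category.comp_id _) rfl _ _ (PiHom.id_push x _ _ _ _ _)))
  comp_id {x y} φ := PiHom.ext' (Category.comp_id φ.base)
    (fun a b h h' => (φ.comp_app (PiHom.id y) a b h).trans
      (φ.app_congr _ _ rfl (PiHom.id_app y _ _ _)))
    (fun {T} a b h h' {c} θ hθ hθ' => (φ.comp_push (PiHom.id y) a b h θ hθ).trans
      ((PiHom.id_push y _ _ _ _ _).trans
        (φ.push_congr _ _ rfl (PiHom.id_app y _ _ _) _ _ rfl)))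
  assoc φ ψ χ := PiHom.ext' (Category.assoc φ.base ψ.base χ.base)
    (fun a b h h' => ((φ.comp ψ).comp_app χ a b h).trans
      ((φ.comp_app ψ _ _ _).trans
        ((φ.app_congr _ _ rfl
          ((ψ.app_congr _ _ rfl (χ.app_congr _ _ (Category.assoc _ _ _).symm rfl)).trans
            (ψ.comp_app χ _ _ _).symm)).trans
          (φ.comp_app (ψ.comp χ) a b h').symm)))
    (fun {T} a b h h' {c} θ hθ hθ' => by
      refine ((φ.comp ψ).comp_push χ a b h θ hθ).trans
        (Eq.trans ?_ (φ.comp_push (ψ.comp χ) a b h' θ hθ').symm)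
      refine Eq.trans ?_ (ψ.comp_push χ (a ≫ φ.base) b _ _ _).symm
      refine χ.push_congr _ _ (Category.assoc _ _ _).symm rfl _ _ ?_
      refine (φ.comp_push ψ a _ _ θ _).trans ?_
      exact ψ.push_congr _ _ rfl (χ.app_congr _ _ (Category.assoc _ _ _).symm rfl) _ _
        (φ.push_congr _ _ rfl
          ((ψ.app_congr _ _ rfl (χ.app_congr _ _ (Category.assoc _ _ _).symm rfl)).trans
            (ψ.comp_app χ _ _ _).symm) _ _ rfl))

/-- The product completion `Π_F(q) : Π_F(E) ⥤ B`, sending `(X ⟶ I, α)` to `I`. -/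
def piCompletion (F : MorphismProperty B) [IsDisplayMapClass F] {E : Type u₂} [Category.{v₂} E]
    (q : E ⥤ B) [q.IsFibered] : PiObj F q ⥤ B where
  obj x := x.base
  map φ := PiHom.base φ

end Completion

/-! ### Fibred equivalence -/

/-- A fibred equivalence between functors `p : E ⥤ B` and `q : E' ⥤ B`: an equivalence of total
categories whose two functors commute with the projections to `B` and preserve cartesian arrows,
and whose unit and counit are vertical. -/
structure FibredEquivalence {E : Type u₂} [Category.{v₂} E] {E' : Type u₃} [Category.{v₃} E']
    (p : E ⥤ B) (q : E' ⥤ B) where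
  equiv : E ≌ E'
  functor_comp : equiv.functor ⋙ q = p
  inverse_comp : equiv.inverse ⋙ p = q
  functor_cartesian {I J : B} (u : I ⟶ J) {X Y : E} (φ : X ⟶ Y) :
    p.IsStronglyCartesian u φ → q.IsStronglyCartesian u (equiv.functor.map φ)
  inverse_cartesian {I J : B} (u : I ⟶ J) {X Y : E'} (φ : X ⟶ Y) :
    q.IsStronglyCartesian u φ → p.IsStronglyCartesian u (equiv.inverse.map φ)
  unit_vertical (X : E) : p.IsHomLift (𝟙 (p.obj X)) (equiv.unit.app X)
  counit_vertical (X : E') : q.IsHomLift (𝟙 (q.obj X)) (equiv.counit.app X)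

end FibredProducts

end

noncomputable section

/-! ### Products and splittings in terms of generalised elements -/

namespace FibredProducts

variable {B : Type u₁} [Category.{v₁} B]

section Evaluation

variable {E : Type u₂} [Category.{v₂} E] {p : E ⥤ B}

/-! From a product completion to enough quantifier-free objects. In `Π_F(q)` the object (v : X ↠ I,
α) is the product along v of the "unit" object (1_X, α). An arrow from a reindexing of (v, α) to a
unit object (1, β) is, by the very definition of arrows in the completion, a section d of the pulled
back display map together with an arrow out of d^*α. So unit objects split, uniquely, every arrow
out of a product of a unit object (`PiHom.piEvaluation_hasUniqueSplitting`). For an arbitrary ∏_u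
β', write β' = ∏_w γ with γ a unit object. Then ∏_u β' is the product of γ along the composite of w
and u, which lies in F because F is closed under composition, and unique splittings along the
composite and along w yield unique splittings along u (`Evaluation.HasUniqueSplitting.of_comp`).
Thus unit objects are quantifier-free and every object is a product of one. All this passes along a
fibred equivalence.

From enough quantifier-free objects to a product completion. Quantifier-free objects are closed
under reindexing, so they span a full subfibration q. An arrow ∏_g α → ∏_h β over f : I → J is, by
adjunction and Beck–Chevalley, an arrow pr₁^* ∏_g α → β over pr₂ : I ×_J Y → Y. If β is
quantifier-free, this splits uniquely into a map d : I ×_J Y → X over I and an arrow d^*α → β over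
pr₂, which is exactly an arrow (g, α) → (h, β) of `Π_F(q)`. Hence (g, α) ↦ ∏_g α is fully faithful,
and having enough quantifier-free objects says that it reaches every object up to vertical
isomorphism (`nonempty_fibredEquivalence_piCompletion`).

To keep coherence isomorphisms between chosen reindexings out of the argument, arrows are described
by their action on generalised elements. An `Evaluation` is an arrow v^*P → β in Yoneda form.
`IsProduct` is its universal property, tested on all pullback squares and all cartesian lifts, so
that it contains both the adjunction and Beck–Chevalley. `HasUniqueSplitting` is the splitting
condition relative to an arrow into any such product. -/

lemma isHomLift_unique {R S : B} {a b : E} {f f' : R ⟶ S} {φ : a ⟶ b}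
    (h : p.IsHomLift f φ) (h' : p.IsHomLift f' φ) : f = f' := by
  rw [IsHomLift.fac p f φ, IsHomLift.fac p f' φ]

lemma isHomLift_comp {R S T : B} {a b c : E} {f : R ⟶ S} {g : S ⟶ T} {k : R ⟶ T} {φ : a ⟶ b}
    {ψ : b ⟶ c} (hφ : p.IsHomLift f φ) (hψ : p.IsHomLift g ψ) (e : f ≫ g = k) :
    p.IsHomLift k (φ ≫ ψ) :=
  e ▸ IsHomLift.comp p f g φ ψ

/-- A strongly cartesian arrow factors arrows over composites. -/
lemma exists_factor {R S T : B} {g : S ⟶ T} {a b c : E} {φ : b ⟶ c}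
    (hφ : p.IsStronglyCartesian g φ) {f : R ⟶ S} {k : R ⟶ T} (hk : k = f ≫ g) {ψ : a ⟶ c}
    (hψ : p.IsHomLift k ψ) : ∃ χ : a ⟶ b, p.IsHomLift f χ ∧ χ ≫ φ = ψ :=
  ⟨Functor.IsStronglyCartesian.map p g φ hk ψ, inferInstance,
    Functor.IsStronglyCartesian.fac p g φ hk ψ⟩

lemma cartesian_hom_ext {R S T : B} {g : S ⟶ T} {a b c : E} {φ : b ⟶ c}
    (hφ : p.IsStronglyCartesian g φ) {f : R ⟶ S} {χ χ' : a ⟶ b} (h : p.IsHomLift f χ)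
    (h' : p.IsHomLift f χ') (e : χ ≫ φ = χ' ≫ φ) : χ = χ' :=
  Functor.IsStronglyCartesian.ext p g φ f e

/-- The vertical comparison isomorphism of two cartesian lifts. -/
lemma exists_cartesian_iso {R S : B} {g : R ⟶ S} {a a' b : E} {φ : a ⟶ b} {φ' : a' ⟶ b}
    (hφ : p.IsStronglyCartesian g φ) (hφ' : p.IsStronglyCartesian g φ') :
    ∃ i : a ≅ a', p.IsHomLift (𝟙 R) i.hom ∧ p.IsHomLift (𝟙 R) i.inv ∧ i.hom ≫ φ' = φ ∧
      i.inv ≫ φ = φ' := by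
  obtain ⟨χ, h, e⟩ := exists_factor hφ' (Category.id_comp g).symm hφ.toIsHomLift
  obtain ⟨χ', h', e'⟩ := exists_factor hφ (Category.id_comp g).symm hφ'.toIsHomLift
  refine ⟨⟨χ, χ', ?_, ?_⟩, h, h', e, e'⟩
  · exact cartesian_hom_ext hφ (isHomLift_comp h h' (Category.id_comp _))
      (IsHomLift.id (IsHomLift.domain_eq p g φ)) (by simp [e, e'])
  · exact cartesian_hom_ext hφ' (isHomLift_comp h' h (Category.id_comp _))
      (IsHomLift.id (IsHomLift.domain_eq p g φ')) (by simp [e, e'])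

lemma exists_cartesian (p : E ⥤ B) [p.IsFibered] {R S : B} (g : R ⟶ S) {b : E} (hb : p.obj b = S) :
    ∃ (a : E) (φ : a ⟶ b), p.IsStronglyCartesian g φ := by
  obtain ⟨a, φ, h⟩ := IsPreFibered.exists_isCartesian p hb g
  exact ⟨a, φ, inferInstance⟩

variable (p) in
/-- The action `ev` of an arrow `v^* P ⟶ β` on generalised elements: it sends an arrow `c ⟶ P`
over `b ≫ v` to an arrow `c ⟶ β` over `b`, naturally in `c`. -/
structure Evaluation {A J : B} (v : A ⟶ J) (P β : E) where
  ev {T : B} {c : E} (b : T ⟶ A) (θ : c ⟶ P) (h : p.IsHomLift (b ≫ v) θ) : c ⟶ β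
  isHomLift {T : B} {c : E} (b : T ⟶ A) (θ : c ⟶ P) (h : p.IsHomLift (b ≫ v) θ) :
    p.IsHomLift b (ev b θ h)
  comp_ev {T T' : B} {c c' : E} (r : T' ⟶ T) (b : T ⟶ A) {χ : c' ⟶ c} (hχ : p.IsHomLift r χ)
    (θ : c ⟶ P) (h : p.IsHomLift (b ≫ v) θ) (h' : p.IsHomLift ((r ≫ b) ≫ v) (χ ≫ θ)) :
    χ ≫ ev b θ h = ev (r ≫ b) (χ ≫ θ) h'

namespace Evaluation

variable {A J : B} {v : A ⟶ J} {P β : E}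

lemma ev_congr (e : Evaluation p v P β) {T : B} {c : E} {b b' : T ⟶ A} {θ θ' : c ⟶ P}
    (h : p.IsHomLift (b ≫ v) θ) (h' : p.IsHomLift (b' ≫ v) θ') (hb : b = b') (hθ : θ = θ') :
    e.ev b θ h = e.ev b' θ' h' := by
  subst hb hθ
  rfl

lemma comp_ev' (e : Evaluation p v P β) {T T' : B} {c c' : E} {r : T' ⟶ T} {b : T ⟶ A}
    {χ : c' ⟶ c} (hχ : p.IsHomLift r χ) {θ : c ⟶ P} (h : p.IsHomLift (b ≫ v) θ)
    {b' : T' ⟶ A} {θ' : c' ⟶ P} (h' : p.IsHomLift (b' ≫ v) θ') (hb : r ≫ b = b')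
    (hθ : χ ≫ θ = θ') : χ ≫ e.ev b θ h = e.ev b' θ' h' := by
  subst hb hθ
  exact e.comp_ev r b hχ θ h h'

/-- `P` is the product of `β` along `v`, stably under base change. -/
structure IsProduct (e : Evaluation p v P β) : Prop where
  existsUnique {I K : B} {u : K ⟶ I} {g : K ⟶ A} {f : I ⟶ J} (sq : IsPullback u g f v) {X U : E}
    {ξ : U ⟶ X} (hξ : p.IsStronglyCartesian u ξ) {t : U ⟶ β} (ht : p.IsHomLift g t) :
    ∃! θ : X ⟶ P, p.IsHomLift f θ ∧
      ∀ h : p.IsHomLift (g ≫ v) (ξ ≫ θ), e.ev g (ξ ≫ θ) h = t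

lemma isHomLift_sq {I K : B} {u : K ⟶ I} {g : K ⟶ A} {f : I ⟶ J} (w : u ≫ f = g ≫ v) {X U : E}
    {ξ : U ⟶ X} (hξ : p.IsStronglyCartesian u ξ) {θ : X ⟶ P} (hθ : p.IsHomLift f θ) :
    p.IsHomLift (g ≫ v) (ξ ≫ θ) :=
  isHomLift_comp hξ.toIsHomLift hθ w

lemma IsProduct.hom_ext {e : Evaluation p v P β} (he : e.IsProduct) {I K : B} {u : K ⟶ I}
    {g : K ⟶ A} {f : I ⟶ J} (sq : IsPullback u g f v) {X U : E} {ξ : U ⟶ X}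
    (hξ : p.IsStronglyCartesian u ξ) {θ θ' : X ⟶ P} (hθ : p.IsHomLift f θ)
    (hθ' : p.IsHomLift f θ') (h : e.ev g (ξ ≫ θ) (isHomLift_sq sq.w hξ hθ) =
      e.ev g (ξ ≫ θ') (isHomLift_sq sq.w hξ hθ')) : θ = θ' :=
  (he.existsUnique sq hξ (e.isHomLift _ _ (isHomLift_sq sq.w hξ hθ'))).unique
    ⟨hθ, fun _ => h⟩ ⟨hθ', fun _ => rfl⟩

/-- Two products of the same object are isomorphic, compatibly with the evaluations. -/
lemma IsProduct.exists_iso [p.IsFibered] {P' : E} {e : Evaluation p v P β} (he : e.IsProduct)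
    {e' : Evaluation p v P' β} (he' : e'.IsProduct) (hP : p.obj P = J) (hP' : p.obj P' = J) :
    ∃ i : P ≅ P', p.IsHomLift (𝟙 J) i.hom ∧ p.IsHomLift (𝟙 J) i.inv ∧
      ∀ {T : B} {c : E} (b : T ⟶ A) (θ : c ⟶ P) (h : p.IsHomLift (b ≫ v) θ)
        (h' : p.IsHomLift (b ≫ v) (θ ≫ i.hom)), e'.ev b (θ ≫ i.hom) h' = e.ev b θ h := by
  -- The generic element ξ : v^*P → P is evaluated by `e` to an arrow into β, whose transpose under
  -- `e'` (for the square with identity on J) is the comparison arrow. Every other element factors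
  -- through ξ, so naturality extends the compatibility from ξ to all elements.
  have key : ∀ {P P' : E} {e : Evaluation p v P β} {e' : Evaluation p v P' β}, e'.IsProduct →
      p.obj P = J → ∃ i : P ⟶ P', p.IsHomLift (𝟙 J) i ∧
        ∀ {T : B} {c : E} (b : T ⟶ A) (θ : c ⟶ P) (h : p.IsHomLift (b ≫ v) θ)
          (h' : p.IsHomLift (b ≫ v) (θ ≫ i)), e'.ev b (θ ≫ i) h' = e.ev b θ h := by
    intro P P' e e' he' hP
    obtain ⟨U, ξ, hξ⟩ := exists_cartesian p v hP
    have h₁ : p.IsHomLift (𝟙 A ≫ v) ξ := by rw [Category.id_comp]; exact hξ.toIsHomLift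
    obtain ⟨i, ⟨hi, hi'⟩, -⟩ := he'.existsUnique (IsPullback.of_vert_isIso ⟨by simp⟩ :
      IsPullback v (𝟙 A) (𝟙 J) v) hξ (e.isHomLift (𝟙 A) ξ h₁)
    refine ⟨i, hi, fun b θ h h' => ?_⟩
    obtain ⟨χ, hχ, rfl⟩ := exists_factor hξ rfl h
    have h₂ : p.IsHomLift (𝟙 A ≫ v) (ξ ≫ i) := isHomLift_comp hξ.toIsHomLift hi (by simp)
    rw [← e.comp_ev' hχ h₁ h (Category.comp_id _) rfl, ← hi' h₂,
      e'.comp_ev' hχ h₂ h' (Category.comp_id _) (by simp)]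
  obtain ⟨i, hi, hi'⟩ := key (e := e) he' hP
  obtain ⟨j, hj, hj'⟩ := key (e := e') he hP'
  -- `i ≫ j` and the identity evaluate alike on the generic element, so the universal property
  -- identifies them.
  have key₂ : ∀ {P P' : E} {e : Evaluation p v P β} {e' : Evaluation p v P' β}
      (_ : e.IsProduct) (_ : p.obj P = J) (i : P ⟶ P') (j : P' ⟶ P)
      (_ : p.IsHomLift (𝟙 J) i) (_ : p.IsHomLift (𝟙 J) j)
      (_ : ∀ {T : B} {c : E} (b : T ⟶ A) (θ : c ⟶ P) (h : p.IsHomLift (b ≫ v) θ)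
          (h' : p.IsHomLift (b ≫ v) (θ ≫ i)), e'.ev b (θ ≫ i) h' = e.ev b θ h)
      (_ : ∀ {T : B} {c : E} (b : T ⟶ A) (θ : c ⟶ P') (h : p.IsHomLift (b ≫ v) θ)
          (h' : p.IsHomLift (b ≫ v) (θ ≫ j)), e.ev b (θ ≫ j) h' = e'.ev b θ h), i ≫ j = 𝟙 P := by
    intro P P' e e' he hP i j hi hj hi' hj'
    obtain ⟨U, ξ, hξ⟩ := exists_cartesian p v hP
    have sq : IsPullback v (𝟙 A) (𝟙 J) v := IsPullback.of_vert_isIso ⟨by simp⟩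
    have hid : p.IsHomLift (𝟙 J) (𝟙 P) := IsHomLift.id hP
    have h₁ : p.IsHomLift (𝟙 A ≫ v) ξ := by rw [Category.id_comp]; exact hξ.toIsHomLift
    have h₂ : p.IsHomLift (𝟙 A ≫ v) (ξ ≫ i) := isHomLift_comp hξ.toIsHomLift hi (by simp)
    have h₃ : p.IsHomLift (𝟙 A ≫ v) ((ξ ≫ i) ≫ j) := isHomLift_comp h₂ hj (by simp)
    refine he.hom_ext sq hξ (isHomLift_comp hi hj (Category.id_comp _)) hid ?_
    refine (e.ev_congr _ h₃ rfl (Category.assoc _ _ _).symm).trans ((hj' _ _ h₂ h₃).trans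
      ((hi' _ _ h₁ h₂).trans (e.ev_congr _ _ rfl (Category.comp_id _).symm)))
  exact ⟨⟨i, j, key₂ he hP i j hi hj hi' hj', key₂ he' hP' j i hj hi hj' hi'⟩, hi, hj, hi'⟩

/-- The evaluation of a composite of products. -/
def comp {D : B} {k : D ⟶ A} {γ : E} (e : Evaluation p v P β) (e₁ : Evaluation p k β γ) :
    Evaluation p (k ≫ v) P γ where
  ev b θ h := e₁.ev b (e.ev (b ≫ k) θ (by rwa [Category.assoc])) (e.isHomLift _ _ _)
  isHomLift _ _ _ := e₁.isHomLift _ _ _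
  comp_ev r b χ hχ θ h h' :=
    e₁.comp_ev' hχ _ _ rfl (e.comp_ev' hχ _ _ (Category.assoc _ _ _).symm rfl)

/-- A pullback along `k ≫ v` splits into a pullback along v followed by one along k. An arrow into γ
is transposed first along k and then along v. -/
lemma IsProduct.comp [p.IsFibered] {D : B} {k : D ⟶ A} {γ : E} {e : Evaluation p v P β}
    {e₁ : Evaluation p k β γ} (he : e.IsProduct) (he₁ : e₁.IsProduct)
    (hv : ∀ {I : B} (f : I ⟶ J), HasPullback f v) : (e.comp e₁).IsProduct where
  existsUnique {I K u g f} sq {X U ξ} hξ {t} ht := by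
    have := hv f
    have sqv := IsPullback.of_hasPullback f v
    obtain ⟨m, hm₁, hm₂⟩ : ∃ m : K ⟶ pullback f v, m ≫ pullback.fst f v = u ∧
        m ≫ pullback.snd f v = g ≫ k :=
      ⟨pullback.lift u (g ≫ k) (by rw [sq.w, Category.assoc]), by simp [pullback.lift_fst],
        by simp [pullback.lift_snd]⟩
    have sqk : IsPullback m g (pullback.snd f v) k := by
      refine (IsPullback.of_bot ?_ hm₂.symm sqv.flip).flip
      rw [hm₁]
      exact sq.flip
    have hX : p.obj X = I := IsHomLift.codomain_eq p u ξ
    obtain ⟨U', ξ', hξ'⟩ := exists_cartesian p (pullback.fst f v) hX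
    obtain ⟨χ, hχ, rfl⟩ := exists_factor hξ' hm₁.symm hξ.toIsHomLift
    have hχc : p.IsStronglyCartesian m χ := by
      have h₀ : p.IsStronglyCartesian (m ≫ pullback.fst f v) (χ ≫ ξ') := hm₁ ▸ hξ
      exact Functor.IsStronglyCartesian.of_comp p (ψ := ξ') (g := pullback.fst f v)
    obtain ⟨s, ⟨hs, hs'⟩, hsu⟩ := he₁.existsUnique sqk hχc ht
    obtain ⟨θ, ⟨hθ, hθ'⟩, hθu⟩ := he.existsUnique sqv hξ' hs
    have aux : ∀ (θ : X ⟶ P) (hθ : p.IsHomLift f θ)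
        (h : p.IsHomLift (g ≫ k ≫ v) ((χ ≫ ξ') ≫ θ))
        (h₂ : p.IsHomLift (pullback.snd f v ≫ v) (ξ' ≫ θ))
        (h₃ : p.IsHomLift (g ≫ k) (χ ≫ e.ev (pullback.snd f v) (ξ' ≫ θ) h₂)),
        (e.comp e₁).ev g ((χ ≫ ξ') ≫ θ) h =
          e₁.ev g (χ ≫ e.ev (pullback.snd f v) (ξ' ≫ θ) h₂) h₃ := by
      intro θ hθ h h₂ h₃
      refine e₁.ev_congr _ _ rfl ?_
      exact (e.comp_ev' hχ _ _ hm₂ (Category.assoc _ _ _).symm).symm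
    refine ⟨θ, ⟨hθ, fun h => ?_⟩, ?_⟩
    · have h₂ := isHomLift_sq sqv.w hξ' hθ
      have h₄ : p.IsHomLift (g ≫ k) (χ ≫ s) := isHomLift_comp hχ hs hm₂
      have := hθ' h₂
      rw [aux θ hθ h h₂ (by rwa [this])]
      exact (e₁.ev_congr _ h₄ rfl (by rw [this])).trans (hs' _)
    · rintro θ' ⟨h₁, h₁'⟩
      have h₂ := isHomLift_sq sqv.w hξ' h₁
      refine hθu _ ⟨h₁, fun h₂ => hsu _ ⟨e.isHomLift _ _ _, fun h₃ => ?_⟩⟩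
      rw [← aux θ' h₁ (isHomLift_sq sq.w hξ h₁) h₂ h₃, h₁']

/-- The base change of an evaluation. -/
def baseChange (e : Evaluation p v P β) {K A' : B} {m : K ⟶ J} {u : A' ⟶ K} {g : A' ⟶ A}
    (w : u ≫ m = g ≫ v) {Q β' : E} {k : Q ⟶ P} (hk : p.IsHomLift m k)
    {l : β' ⟶ β} (hl : p.IsStronglyCartesian g l) : Evaluation p u Q β' :=
  have lift {T : B} {c : E} (b : T ⟶ A') (θ : c ⟶ Q) (h : p.IsHomLift (b ≫ u) θ) :
      p.IsHomLift ((b ≫ g) ≫ v) (θ ≫ k) := isHomLift_comp h hk (by simp [w])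
  have exists_ev {T : B} {c : E} (b : T ⟶ A') (θ : c ⟶ Q) (h : p.IsHomLift (b ≫ u) θ) :=
    exists_factor hl (Eq.refl (b ≫ g)) (e.isHomLift (b ≫ g) (θ ≫ k) (lift b θ h))
  { ev := fun b θ h => (exists_ev b θ h).choose
    isHomLift := fun b θ h => (exists_ev b θ h).choose_spec.1
    comp_ev := fun r b χ hχ θ h h' => by
      refine cartesian_hom_ext hl (isHomLift_comp hχ (exists_ev b θ h).choose_spec.1 rfl)
        (exists_ev _ _ h').choose_spec.1 ?_
      rw [Category.assoc, (exists_ev b θ h).choose_spec.2, (exists_ev _ _ h').choose_spec.2]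
      exact e.comp_ev' hχ _ _ (by simp) (by simp) }

/-- The values of `baseChange` are chosen lifts; as `l` is cartesian, this equation determines them.
-/
lemma baseChange_ev_comp (e : Evaluation p v P β) {K A' : B} {m : K ⟶ J} {u : A' ⟶ K} {g : A' ⟶ A}
    (w : u ≫ m = g ≫ v) {Q β' : E} {k : Q ⟶ P} (hk : p.IsHomLift m k)
    {l : β' ⟶ β} (hl : p.IsStronglyCartesian g l) {T : B} {c : E} (b : T ⟶ A') (θ : c ⟶ Q)
    (h : p.IsHomLift (b ≫ u) θ) (h' : p.IsHomLift ((b ≫ g) ≫ v) (θ ≫ k)) :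
    (e.baseChange w hk hl).ev b θ h ≫ l = e.ev (b ≫ g) (θ ≫ k) h' :=
  (exists_factor hl (Eq.refl (b ≫ g)) (e.isHomLift (b ≫ g) (θ ≫ k) h')).choose_spec.2

/-- A pullback square over u pastes with the given one to a pullback square over v. Arrows into Q
and β' are then recovered from arrows into P and β through the cartesian `k` and `l`. -/
lemma IsProduct.baseChange {e : Evaluation p v P β} (he : e.IsProduct) {K A' : B} {m : K ⟶ J}
    {u : A' ⟶ K} {g : A' ⟶ A} (sq : IsPullback u g m v) {Q β' : E} {k : Q ⟶ P}
    (hk : p.IsStronglyCartesian m k) {l : β' ⟶ β} (hl : p.IsStronglyCartesian g l) :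
    (e.baseChange sq.w hk.toIsHomLift hl).IsProduct where
  existsUnique {I K' w z f} sq' {X U ξ} hξ {t} ht := by
    have sq₂ : IsPullback w (z ≫ g) (f ≫ m) v := sq'.paste_vert sq
    have htl : p.IsHomLift (z ≫ g) (t ≫ l) := isHomLift_comp ht hl.toIsHomLift rfl
    obtain ⟨θ, ⟨hθ, hθ'⟩, hθu⟩ := he.existsUnique sq₂ hξ htl
    obtain ⟨θ', h₁, rfl⟩ := exists_factor hk rfl hθ
    refine ⟨θ', ⟨h₁, fun h => ?_⟩, ?_⟩
    · refine cartesian_hom_ext hl (Evaluation.isHomLift _ _ _ _) ht ?_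
      have h₂ : p.IsHomLift ((z ≫ g) ≫ v) ((ξ ≫ θ') ≫ k) := by
        rw [Category.assoc ξ]; exact isHomLift_sq sq₂.w hξ hθ
      rw [baseChange_ev_comp _ _ _ _ _ _ _ h₂, ← hθ' (by rwa [Category.assoc ξ] at h₂)]
      exact e.ev_congr _ _ rfl (Category.assoc _ _ _)
    · rintro θ'' ⟨h₂, h₂'⟩
      refine cartesian_hom_ext hk h₂ h₁ (hθu _ ⟨isHomLift_comp h₂ hk.toIsHomLift rfl, fun h => ?_⟩)
      rw [← h₂' (isHomLift_sq sq'.w hξ h₂), baseChange_ev_comp _ _ _ _ _ _ _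
        (by rwa [Category.assoc ξ])]
      exact e.ev_congr _ _ rfl (Category.assoc _ _ _).symm

/-- `ρ : Q ⟶ d^* β` is the vertical arrow induced by the evaluation of `k : Q ⟶ P` at `d`, where
`l` is a cartesian arrow `d^* β ⟶ β` over `d`. -/
structure IsRestriction (e : Evaluation p v P β) {K : B} {Q R : E} (k : Q ⟶ P) (d : K ⟶ A)
    (l : R ⟶ β) (ρ : Q ⟶ R) : Prop where
  isHomLift : p.IsHomLift (d ≫ v) k
  cartesian : p.IsStronglyCartesian d l
  vertical : p.IsHomLift (𝟙 K) ρ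
  fac : ρ ≫ l = e.ev d k isHomLift

lemma exists_isRestriction [p.IsFibered] (e : Evaluation p v P β) (hβ : p.obj β = A) {K : B} {Q : E}
    {k : Q ⟶ P} {d : K ⟶ A} (hk : p.IsHomLift (d ≫ v) k) :
    ∃ (R : E) (l : R ⟶ β) (ρ : Q ⟶ R), e.IsRestriction k d l ρ := by
  obtain ⟨R, l, hl⟩ := exists_cartesian p d hβ
  obtain ⟨ρ, hρ, h⟩ := exists_factor hl (Category.id_comp d).symm (e.isHomLift d k hk)
  exact ⟨R, l, ρ, hk, hl, hρ, h⟩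

lemma exists_isRestriction_of_cartesian (e : Evaluation p v P β) {K : B} {Q R : E} {k : Q ⟶ P}
    {d : K ⟶ A} (hk : p.IsHomLift (d ≫ v) k) {l : R ⟶ β} (hl : p.IsStronglyCartesian d l) :
    ∃ ρ : Q ⟶ R, e.IsRestriction k d l ρ := by
  obtain ⟨ρ, hρ, h⟩ := exists_factor hl (Category.id_comp d).symm (e.isHomLift d k hk)
  exact ⟨ρ, hk, hl, hρ, h⟩

lemma IsRestriction.exists_iso {e : Evaluation p v P β} {K : B} {Q R R' : E} {k : Q ⟶ P}
    {d : K ⟶ A} {l : R ⟶ β} {l' : R' ⟶ β} {ρ : Q ⟶ R} {ρ' : Q ⟶ R'}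
    (h : e.IsRestriction k d l ρ) (h' : e.IsRestriction k d l' ρ') :
    ∃ i : R ≅ R', p.IsHomLift (𝟙 K) i.hom ∧ p.IsHomLift (𝟙 K) i.inv ∧ i.hom ≫ l' = l ∧
      i.inv ≫ l = l' ∧ ρ ≫ i.hom = ρ' ∧ ρ' ≫ i.inv = ρ := by
  obtain ⟨i, h₁, h₂, h₃, h₄⟩ := exists_cartesian_iso h.cartesian h'.cartesian
  have : ρ ≫ i.hom = ρ' := cartesian_hom_ext h'.cartesian
    (isHomLift_comp h.vertical h₁ (Category.id_comp _)) h'.vertical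
    (by rw [Category.assoc, h₃, h.fac, h'.fac])
  exact ⟨i, h₁, h₂, h₃, h₄, this, by rw [← this]; simp⟩

/-- Every arrow `Q ⟶ α` factors uniquely through the evaluation of `k` at a unique `d`. -/
structure HasUniqueSplitting (e : Evaluation p v P β) (K : B) {Q : E} (k : Q ⟶ P) (α : E) :
    Prop where
  -- The arrows into α lie over an arbitrary n and need not be vertical, so the condition already
  -- covers all reindexings n^*α. Uniqueness of the pair is divided into the two fields below, which
  -- spares any equality between arrows with different domains.
  exists_fac {S : B} {n : K ⟶ S} {h : Q ⟶ α} (hh : p.IsHomLift n h) :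
    ∃ (d : K ⟶ A) (R : E) (l : R ⟶ β) (ρ : Q ⟶ R) (t : R ⟶ α), e.IsRestriction k d l ρ ∧
      p.IsHomLift n t ∧ ρ ≫ t = h
  section_unique {S : B} {n : K ⟶ S} {d d' : K ⟶ A} {R R' : E} {l : R ⟶ β} {l' : R' ⟶ β}
    {ρ : Q ⟶ R} {ρ' : Q ⟶ R'} (hρ : e.IsRestriction k d l ρ) (hρ' : e.IsRestriction k d' l' ρ')
    {t : R ⟶ α} {t' : R' ⟶ α} (ht : p.IsHomLift n t) (ht' : p.IsHomLift n t')
    (h : ρ ≫ t = ρ' ≫ t') : d = d'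
  hom_ext {S : B} {n : K ⟶ S} {d : K ⟶ A} {R : E} {l : R ⟶ β} {ρ : Q ⟶ R}
    (hρ : e.IsRestriction k d l ρ) {t t' : R ⟶ α} (ht : p.IsHomLift n t) (ht' : p.IsHomLift n t')
    (h : ρ ≫ t = ρ ≫ t') : t = t'

/-- Cartesian lifts of d are isomorphic compatibly with the induced arrows from Q, so a
factorisation does not depend on the choice of d^*β. -/
lemma IsRestriction.exists_transfer {e : Evaluation p v P β} {K : B} {Q R R' α : E} {k : Q ⟶ P}
    {d : K ⟶ A} {l : R ⟶ β} {l' : R' ⟶ β} {ρ : Q ⟶ R} {ρ' : Q ⟶ R'}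
    (hρ : e.IsRestriction k d l ρ) (hρ' : e.IsRestriction k d l' ρ') {S : B} {n : K ⟶ S}
    {t : R ⟶ α} (ht : p.IsHomLift n t) : ∃ t' : R' ⟶ α, p.IsHomLift n t' ∧ ρ' ≫ t' = ρ ≫ t := by
  obtain ⟨i, h₁, h₂, h₃, h₄, h₅, h₆⟩ := hρ.exists_iso hρ'
  exact ⟨i.inv ≫ t, isHomLift_comp h₂ ht (Category.id_comp _), by rw [← h₆]; simp⟩

/-- Splittings along the base change of an evaluation give splittings along the cartesian arrow. -/
lemma HasUniqueSplitting.of_baseChange (e : Evaluation p v P β) {K A' : B} {m : K ⟶ J}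
    {u : A' ⟶ K} {g : A' ⟶ A} (sq : IsPullback u g m v) {Q β' α : E} {k : Q ⟶ P}
    (hk : p.IsHomLift m k) {l : β' ⟶ β} (hl : p.IsStronglyCartesian g l)
    (H : (e.baseChange sq.w hk hl).HasUniqueSplitting K (𝟙 Q) α) :
    e.HasUniqueSplitting K k α := by
  have hQ : p.obj Q = K := IsHomLift.domain_eq p m k
  have hid : p.IsHomLift (𝟙 K) (𝟙 Q) := IsHomLift.id hQ
  -- Since k lies over m, any such d satisfies `d ≫ v = m`, so it corresponds to a section s of u.
  -- Restricting k at d is the same as restricting the identity of Q at s.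
  have key : ∀ {d : K ⟶ A} {R : E} {l₁ : R ⟶ β} {ρ : Q ⟶ R}, e.IsRestriction k d l₁ ρ →
      ∃ (s : K ⟶ A') (l₂ : R ⟶ β'), s ≫ g = d ∧
        (e.baseChange sq.w hk hl).IsRestriction (𝟙 Q) s l₂ ρ := by
    intro d R l₁ ρ hρ
    have hd : d ≫ v = m := isHomLift_unique hρ.isHomLift hk
    obtain ⟨s, hs₁, rfl⟩ : ∃ s : K ⟶ A', s ≫ u = 𝟙 K ∧ s ≫ g = d :=
      ⟨sq.lift (𝟙 K) d (by simp [hd]), sq.lift_fst _ _ _, sq.lift_snd _ _ _⟩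
    have hl₁ := hρ.cartesian
    obtain ⟨l₂, hl₂, rfl⟩ := exists_factor hl rfl hl₁.toIsHomLift
    have hid' : p.IsHomLift (s ≫ u) (𝟙 Q) := by rwa [hs₁]
    refine ⟨s, l₂, rfl, ⟨hid', Functor.IsStronglyCartesian.of_comp p (ψ := l) (g := g),
      hρ.vertical, ?_⟩⟩
    refine cartesian_hom_ext hl (isHomLift_comp hρ.vertical hl₂ (Category.id_comp _))
      (Evaluation.isHomLift _ _ _ _) ?_
    rw [Category.assoc, hρ.fac, baseChange_ev_comp _ _ _ _ _ _ _
      (by rw [Category.id_comp]; exact hρ.isHomLift)]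
    exact e.ev_congr _ _ rfl (Category.id_comp _).symm
  refine ⟨fun hh => ?_, fun hρ hρ' t t' ht ht' h => ?_, fun hρ t t' ht ht' h => ?_⟩
  · obtain ⟨s, R, l₂, ρ, t, hρ, ht, h⟩ := H.exists_fac hh
    have hs : s ≫ u = 𝟙 K := isHomLift_unique hρ.isHomLift hid
    have hk' : p.IsHomLift ((s ≫ g) ≫ v) k := by
      rw [Category.assoc, ← sq.w, ← Category.assoc, hs, Category.id_comp]; exact hk
    have := hρ.cartesian
    refine ⟨s ≫ g, R, l₂ ≫ l, ρ, t, ⟨hk', inferInstance, hρ.vertical, ?_⟩, ht, h⟩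
    rw [← Category.assoc, hρ.fac, baseChange_ev_comp _ _ _ _ _ _ _ (by rwa [Category.id_comp])]
    exact e.ev_congr _ _ rfl (Category.id_comp _)
  · obtain ⟨s, l₂, rfl, h₂⟩ := key hρ
    obtain ⟨s', l₂', rfl, h₂'⟩ := key hρ'
    rw [H.section_unique h₂ h₂' ht ht' h]
  · obtain ⟨s, l₂, rfl, h₂⟩ := key hρ
    exact H.hom_ext h₂ ht ht' h

/-- Unique splittings are invariant under isomorphism of evaluations. -/
lemma HasUniqueSplitting.of_iso {e : Evaluation p v P β} {P' : E} {e' : Evaluation p v P' β}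
    (i : P ≅ P') (hi : p.IsHomLift (𝟙 J) i.hom)
    (hi' : ∀ {T : B} {c : E} (b : T ⟶ A) (θ : c ⟶ P) (h : p.IsHomLift (b ≫ v) θ)
        (h' : p.IsHomLift (b ≫ v) (θ ≫ i.hom)), e'.ev b (θ ≫ i.hom) h' = e.ev b θ h)
    {K : B} {Q α : E} {k : Q ⟶ P}
    (H : e'.HasUniqueSplitting K (k ≫ i.hom) α) : e.HasUniqueSplitting K k α := by
  have hinv : p.IsHomLift (𝟙 J) i.inv := inferInstance
  have key : ∀ {d : K ⟶ A} {R : E} {l : R ⟶ β} {ρ : Q ⟶ R}, e.IsRestriction k d l ρ →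
      e'.IsRestriction (k ≫ i.hom) d l ρ := fun hρ =>
    have h' := isHomLift_comp hρ.isHomLift hi (Category.comp_id _)
    ⟨h', hρ.cartesian, hρ.vertical, by rw [hρ.fac, hi' _ _ hρ.isHomLift]⟩
  refine ⟨fun hh => ?_, fun hρ hρ' t t' ht ht' h => ?_, fun hρ t t' ht ht' h => ?_⟩
  · obtain ⟨d, R, l, ρ, t, hρ, ht, h⟩ := H.exists_fac hh
    have hk : p.IsHomLift (d ≫ v) k := by
      have := isHomLift_comp hρ.isHomLift hinv (Category.comp_id _)
      rwa [Category.assoc, i.hom_inv_id, Category.comp_id] at this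
    exact ⟨d, R, l, ρ, t, ⟨hk, hρ.cartesian, hρ.vertical, by rw [hρ.fac, hi' _ _ hk]⟩, ht, h⟩
  · exact H.section_unique (key hρ) (key hρ') ht ht' h
  · exact H.hom_ext (key hρ) ht ht' h

/-- Splittings may be precomposed with a vertical isomorphism. -/
lemma HasUniqueSplitting.of_iso_comp {e : Evaluation p v P β} {K : B} {Q Q' α : E} {k : Q ⟶ P}
    (i : Q ≅ Q') (hi : p.IsHomLift (𝟙 K) i.hom) {k' : Q' ⟶ P} (hk : i.hom ≫ k' = k)
    (H : e.HasUniqueSplitting K k' α) : e.HasUniqueSplitting K k α := by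
  have hinv : p.IsHomLift (𝟙 K) i.inv := inferInstance
  have key : ∀ {d : K ⟶ A} {R : E} {l : R ⟶ β} {ρ : Q ⟶ R}, e.IsRestriction k d l ρ →
      e.IsRestriction k' d l (i.inv ≫ ρ) := by
    intro d R l ρ hρ
    have h' : p.IsHomLift (d ≫ v) k' := by
      have := isHomLift_comp hinv hρ.isHomLift (Category.id_comp _)
      rwa [← hk, i.inv_hom_id_assoc] at this
    refine ⟨h', hρ.cartesian, isHomLift_comp hinv hρ.vertical (Category.id_comp _), ?_⟩
    rw [Category.assoc, hρ.fac]
    exact e.comp_ev' hinv _ _ (Category.id_comp _) (by rw [← hk]; simp)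
  refine ⟨fun {S n h} hh => ?_, fun hρ hρ' t t' ht ht' h => ?_, fun hρ t t' ht ht' h => ?_⟩
  · obtain ⟨d, R, l, ρ, t, hρ, ht, h⟩ := H.exists_fac (isHomLift_comp hinv hh (Category.id_comp _))
    have hk' : p.IsHomLift (d ≫ v) k := hk ▸ isHomLift_comp hi hρ.isHomLift (Category.id_comp _)
    refine ⟨d, R, l, i.hom ≫ ρ, t, ⟨hk', hρ.cartesian,
      isHomLift_comp hi hρ.vertical (Category.id_comp _), ?_⟩, ht, by rw [Category.assoc, h]; simp⟩
    rw [Category.assoc, hρ.fac]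
    exact e.comp_ev' hi _ _ (Category.id_comp _) hk
  · exact H.section_unique (key hρ) (key hρ') ht ht' (by simp [h])
  · exact H.hom_ext (key hρ) ht ht' (by simp [h])

end Evaluation

end Evaluation

end FibredProducts

/-! ### The chosen products and quantifier-free objects -/

namespace FibredProducts

variable {B : Type u₁} [Category.{v₁} B]

section Chosen

variable {E : Type u₂} [Category.{v₂} E] {F : MorphismProperty B} (p : E ⥤ B) [p.IsFibered]

lemma isStronglyCartesian_cart {I J : B} (u : I ⟶ J) (Y : p.Fiber J) :
    p.IsStronglyCartesian u (cart p u Y) :=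
  inferInstance

/-- The evaluation of the chosen product `∏_v β`. -/
def prodEvaluation [HasRightAdjoints F p] {A J : B} (v : A ⟶ J) (hv : F v) (β : p.Fiber A) :
    Evaluation p v (tot ((prod p v hv).obj β)) (tot β) where
  ev b θ h := factor p b v rfl θ h ≫ totMap ((prodAdj p v hv).counit.app β)
  isHomLift b θ h :=
    isHomLift_comp (factor_isHomLift p b v rfl θ h) inferInstance (Category.comp_id _)
  comp_ev r b χ hχ θ h h' := by
    rw [← Category.assoc, eq_factor p (r ≫ b) v rfl (χ ≫ θ) h' (χ ≫ factor p b v rfl θ h)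
      (isHomLift_comp hχ (factor_isHomLift p b v rfl θ h) rfl) (by simp)]

lemma map_beckChevalley_counit [HasRightAdjoints F p] {K I L J : B} {u : K ⟶ I} {g : K ⟶ L}
    {f : I ⟶ J} {v : L ⟶ J} (w : u ≫ f = g ≫ v) (hu : F u) (hv : F v) (β : p.Fiber L) :
    (reindex p u).map ((beckChevalley p w hu hv).app β) ≫
        (prodAdj p u hu).counit.app ((reindex p g).obj β) =
      squareApp p w ((prod p v hv).obj β) ≫ (reindex p g).map ((prodAdj p v hv).counit.app β) :=
  mateEquiv_counit (prodAdj p v hv) (prodAdj p u hu) (TwoSquare.mk _ _ _ _ (squareIso p w).hom) β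

/-- Evaluating an arrow X → f^*∏_v β over the square amounts to composing it with the Beck–Chevalley
map and transposing back along u^* ⊣ ∏_u. This is how invertibility of that map turns into the
universal property. -/
lemma prodEvaluation_cart_comp [HasRightAdjoints F p] {K I L J : B} {u : K ⟶ I} {g : K ⟶ L}
    {f : I ⟶ J} {v : L ⟶ J} (w : u ≫ f = g ≫ v) (hu : F u) (hv : F v) (β : p.Fiber L)
    {X : p.Fiber I} (θ : X ⟶ (reindex p f).obj ((prod p v hv).obj β))
    (h : p.IsHomLift (g ≫ v) (cart p u X ≫ totMap θ ≫ cart p f _)) :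
    (prodEvaluation p v hv β).ev g (cart p u X ≫ totMap θ ≫ cart p f _) h =
      totMap ((prodAdj p u hu).homEquiv X ((reindex p g).obj β) |>.symm
        (θ ≫ (beckChevalley p w hu hv).app β)) ≫ cart p g β := by
  have e : totMap ((reindex p u).map θ ≫ squareApp p w _) ≫ cart p g _ =
      factor p g v rfl (cart p u X ≫ totMap θ ≫ cart p f _) h :=
    eq_factor p g v rfl _ h _ inferInstance (by simp)
  rw [Adjunction.homEquiv_counit, Functor.map_comp, Category.assoc, map_beckChevalley_counit]
  change factor p g v rfl _ h ≫ _ = _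
  rw [← e]
  simp

/-- The bijection is Hom(u^*X, g^*β) ≅ Hom(X, ∏_u g^*β) ≅ Hom(X, f^*∏_v β): the adjunction, then the
inverse of the Beck–Chevalley map. An arbitrary cartesian ξ is first compared with the chosen lift.
-/
lemma prodEvaluation_isProduct [IsDisplayMapClass F] [HasFibredProducts F p] {A J : B} (v : A ⟶ J)
    (hv : F v) (β : p.Fiber A) : (prodEvaluation p v hv β).IsProduct where
  existsUnique {I K u g f} sq {X U ξ} hξ {t} ht := by
    have hu : F u := MorphismProperty.of_isPullback sq.flip hv
    have hbc : IsIso ((beckChevalley p sq.w hu hv).app β) :=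
      have := HasFibredProducts.isIso_beckChevalley (F := F) (p := p) sq hu hv
      inferInstance
    obtain ⟨X, rfl⟩ : ∃ X' : p.Fiber I, tot X' = X :=
      ⟨Functor.Fiber.mk (IsHomLift.codomain_eq p u ξ), rfl⟩
    obtain ⟨i, h₁, h₂, h₃, h₄⟩ := exists_cartesian_iso (isStronglyCartesian_cart p u X) hξ
    have hit : p.IsHomLift g (i.hom ≫ t) := isHomLift_comp h₁ ht (Category.id_comp _)
    have aux : ∀ (θ : X ⟶ (reindex p f).obj ((prod p v hv).obj β))
        (h : p.IsHomLift (g ≫ v) (ξ ≫ totMap θ ≫ cart p f _)),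
        (prodEvaluation p v hv β).ev g (ξ ≫ totMap θ ≫ cart p f _) h = i.inv ≫
          totMap ((prodAdj p u hu).homEquiv X ((reindex p g).obj β) |>.symm
            (θ ≫ (beckChevalley p sq.w hu hv).app β)) ≫ cart p g β := by
      intro θ h
      have h' : p.IsHomLift (g ≫ v) (cart p u X ≫ totMap θ ≫ cart p f _) := by
        rw [← h₃, Category.assoc]; exact isHomLift_comp h₁ h (Category.id_comp _)
      rw [← prodEvaluation_cart_comp p sq.w hu hv β θ h']
      exact (Evaluation.comp_ev' _ h₂ _ _ (Category.id_comp _) (by rw [← h₄, Category.assoc])).symm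
    refine ⟨totMap ((prodAdj p u hu).homEquiv X ((reindex p g).obj β) (toReindex p g _ hit) ≫
      inv ((beckChevalley p sq.w hu hv).app β)) ≫ cart p f _, ⟨inferInstance, fun h => ?_⟩, ?_⟩
    · rw [aux]
      simp
    · rintro θ ⟨hθ, hθ'⟩
      obtain ⟨θ, rfl⟩ : ∃ θ' : X ⟶ (reindex p f).obj ((prod p v hv).obj β),
          totMap θ' ≫ cart p f _ = θ := ⟨toReindex p f θ hθ, by simp⟩
      congr 2
      rw [← cancel_mono ((beckChevalley p sq.w hu hv).app β), Category.assoc, IsIso.inv_hom_id,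
        Category.comp_id, ← Equiv.symm_apply_eq]
      apply reindex_hom_ext
      rw [toReindex_cart, ← hθ' (Evaluation.isHomLift_sq sq.w hξ hθ), aux, i.hom_inv_id_assoc]

/-- The canonical restriction of the chosen product along a section. -/
lemma isRestriction_sectionIso [HasRightAdjoints F p] {C A : B} (u : C ⟶ A) (hu : F u)
    (β : p.Fiber C) (d : A ⟶ C) (hd : d ≫ u = 𝟙 A) :
    (prodEvaluation p u hu β).IsRestriction (𝟙 _) d (cart p d β)
      (totMap ((sectionIso p u d hd ((prod p u hu).obj β)).hom ≫
        (reindex p d).map ((prodAdj p u hu).counit.app β))) := by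
  have h : p.IsHomLift (d ≫ u) (𝟙 (tot ((prod p u hu).obj β))) :=
    hd ▸ IsHomLift.id (tot_proj _)
  refine ⟨h, inferInstance, inferInstance, ?_⟩
  have e : totMap (sectionIso p u d hd ((prod p u hu).obj β)).hom ≫ cart p d _ =
      factor p d u rfl (𝟙 _) h :=
    eq_factor p d u rfl _ h _ (isHomLift_comp (f := 𝟙 A) inferInstance
      (isStronglyCartesian_cart p d _).toIsHomLift (Category.id_comp _))
      (by rw [Category.assoc]; exact toReindex₂_cart p d u _ _)
  change _ = factor p d u rfl (𝟙 _) h ≫ _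
  rw [← e]
  simp

variable {p}

/-- An arrow into α over n is a vertical arrow into n^*α, and n^*α is quantifier splitting by
assumption. The definition speaks of the canonical restriction along a section; other restrictions
are reached by comparison isomorphisms. -/
lemma hasUniqueSplitting_prodEvaluation [HasFibredProducts F p] {S : B} {α : p.Fiber S}
    (hα : IsQuantifierFree F p α) {C A : B} (u : C ⟶ A) (hu : F u) (β : p.Fiber C) :
    (prodEvaluation p u hu β).HasUniqueSplitting A (𝟙 _) (tot α) := by
  have hid : p.IsHomLift (𝟙 A) (𝟙 (tot ((prod p u hu).obj β))) := IsHomLift.id (tot_proj _)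
  have hsec : ∀ {d : A ⟶ C} {R : E} {l : R ⟶ tot β} {ρ : tot ((prod p u hu).obj β) ⟶ R},
      (prodEvaluation p u hu β).IsRestriction (𝟙 _) d l ρ → d ≫ u = 𝟙 A :=
    fun hρ => isHomLift_unique hρ.isHomLift hid
  refine ⟨fun {S' n h} hh => ?_, fun {S' n d d' R R' l l' ρ ρ'} hρ hρ' {t t'} ht ht' h => ?_,
    fun {S' n d R l ρ} hρ {t t'} ht ht' h => ?_⟩
  · obtain rfl : S = S' := (tot_proj α).symm.trans (IsHomLift.codomain_eq p n h)
    obtain ⟨⟨⟨d, hd⟩, k⟩, hk, -⟩ := hα n u hu β (toReindex p n h hh)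
    refine ⟨d, _, _, _, totMap k ≫ cart p n α, isRestriction_sectionIso p u hu β d hd,
      inferInstance, ?_⟩
    have := congrArg (fun x => totMap x ≫ cart p n α) hk
    simp only [toReindex_cart] at this
    rw [this]
    simp
  · obtain rfl : S = S' := (tot_proj α).symm.trans (IsHomLift.codomain_eq p n t)
    have hd := hsec hρ
    have hd' := hsec hρ'
    obtain ⟨s, hs, hs'⟩ := hρ.exists_transfer (isRestriction_sectionIso p u hu β d hd) ht
    obtain ⟨s', hs₁, hs₁'⟩ := hρ'.exists_transfer (isRestriction_sectionIso p u hu β d' hd') ht'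
    have hh : p.IsHomLift n (ρ ≫ t) := isHomLift_comp hρ.vertical ht (Category.id_comp _)
    have := (hα n u hu β (toReindex p n (ρ ≫ t) hh)).unique
      (y₁ := ⟨⟨d, hd⟩, toReindex p n s hs⟩) (y₂ := ⟨⟨d', hd'⟩, toReindex p n s' hs₁⟩)
      (reindex_hom_ext _ (by rw [toReindex_cart, ← hs']; simp))
      (reindex_hom_ext _ (by rw [toReindex_cart, h, ← hs₁']; simp))
    exact congrArg (fun x => x.1.1) this
  · obtain rfl : S = S' := (tot_proj α).symm.trans (IsHomLift.codomain_eq p n t)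
    have hd := hsec hρ
    have hcan := isRestriction_sectionIso p u hu β d hd
    obtain ⟨i, h₁, h₂, h₃, h₄, h₅, h₆⟩ := hρ.exists_iso hcan
    have hs : ∀ t : R ⟶ tot α, p.IsHomLift n t → p.IsHomLift n (i.inv ≫ t) := fun t ht =>
      isHomLift_comp h₂ ht (Category.id_comp _)
    have hh : p.IsHomLift n (ρ ≫ t) := isHomLift_comp hρ.vertical ht (Category.id_comp _)
    have := (hα n u hu β (toReindex p n (ρ ≫ t) hh)).unique
      (y₁ := ⟨⟨d, hd⟩, toReindex p n _ (hs t ht)⟩) (y₂ := ⟨⟨d, hd⟩, toReindex p n _ (hs t' ht')⟩)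
      (reindex_hom_ext _ (by rw [toReindex_cart, ← h₆]; simp))
      (reindex_hom_ext _ (by rw [toReindex_cart, h, ← h₆]; simp))
    have := congrArg (fun x => totMap x ≫ cart p n α) (eq_of_heq (Sigma.mk.inj_iff.1 this).2)
    simpa using this

/-- A quantifier-free object has unique splittings along arbitrary products. -/
lemma IsQuantifierFree.hasUniqueSplitting [IsDisplayMapClass F] [HasFibredProducts F p] {S : B}
    {α : p.Fiber S} (hα : IsQuantifierFree F p α) {A J : B} {v : A ⟶ J} (hv : F v) {P β : E}
    {e : Evaluation p v P β} (he : e.IsProduct) (hβ : p.obj β = A) {K : B} {m : K ⟶ J} {Q : E}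
    {k : Q ⟶ P} (hk : p.IsStronglyCartesian m k) : e.HasUniqueSplitting K k (tot α) := by
  have := IsDisplayMapClass.hasPullback m v hv
  have sq := IsPullback.of_hasPullback m v
  have hu : F (pullback.fst m v) := MorphismProperty.of_isPullback sq.flip hv
  obtain ⟨β', rfl⟩ : ∃ β' : p.Fiber A, tot β' = β := ⟨Functor.Fiber.mk hβ, rfl⟩
  have hl := isStronglyCartesian_cart p (pullback.snd m v) β'
  have hQ : p.obj Q = K := IsHomLift.domain_eq p m k
  refine .of_baseChange e sq hk.toIsHomLift hl ?_
  -- The base change of the given product along m is again a product, hence isomorphic to the chosen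
  -- one. This reduces the claim to chosen products and to the identity in place of k.
  obtain ⟨i, h₁, h₂, h₃⟩ := (he.baseChange sq hk hl).exists_iso
    (prodEvaluation_isProduct p (pullback.fst m v) hu ((reindex p (pullback.snd m v)).obj β'))
    hQ (tot_proj _)
  refine .of_iso i h₁ h₃ (.of_iso_comp i h₁ (k' := 𝟙 _) (by simp) ?_)
  exact hasUniqueSplitting_prodEvaluation hα _ hu _

/-- Converse to `hasUniqueSplitting_prodEvaluation`: a vertical arrow into n^*α composed with the
cartesian arrow to α lies over n, where splittings are available. -/
lemma isQuantifierFree_of_hasUniqueSplitting [HasFibredProducts F p] {S : B} {α : p.Fiber S}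
    (H : ∀ {C A : B} (u : C ⟶ A) (hu : F u) (β : p.Fiber C),
      (prodEvaluation p u hu β).HasUniqueSplitting A (𝟙 _) (tot α)) : IsQuantifierFree F p α := by
  intro A n C u hu β h
  have hid : p.IsHomLift (𝟙 A) (𝟙 (tot ((prod p u hu).obj β))) := IsHomLift.id (tot_proj _)
  have hh : p.IsHomLift n (totMap h ≫ cart p n α) := inferInstance
  obtain ⟨d, R, l, ρ, t, hρ, ht, e⟩ := (H u hu β).exists_fac hh
  have hd : d ≫ u = 𝟙 A := isHomLift_unique hρ.isHomLift hid
  obtain ⟨s, hs, hs'⟩ := hρ.exists_transfer (isRestriction_sectionIso p u hu β d hd) ht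
  refine ⟨⟨⟨d, hd⟩, toReindex p n s hs⟩, ?_, ?_⟩
  · apply reindex_hom_ext
    rw [← e, ← hs']
    simp
  · rintro ⟨⟨d', hd'⟩, k⟩ hk
    have hc := isRestriction_sectionIso p u hu β d hd
    have hc' := isRestriction_sectionIso p u hu β d' hd'
    have hkn : p.IsHomLift n (totMap k ≫ cart p n α) := inferInstance
    have e' : totMap ((sectionIso p u d' hd' ((prod p u hu).obj β)).hom ≫
        (reindex p d').map ((prodAdj p u hu).counit.app β)) ≫ totMap k ≫ cart p n α =
        totMap ((sectionIso p u d hd ((prod p u hu).obj β)).hom ≫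
        (reindex p d).map ((prodAdj p u hu).counit.app β)) ≫ s := by
      rw [hs', e, hk]
      simp
    obtain rfl := (H u hu β).section_unique hc' hc hkn hs e'
    obtain rfl : k = toReindex p n s hs :=
      reindex_hom_ext _ (by rw [toReindex_cart]; exact (H u hu β).hom_ext hc hkn hs e')
    rfl

end Chosen

/-! ### Enough quantifier-free objects from a class of generating objects -/

namespace Evaluation

variable {E : Type u₂} [Category.{v₂} E] {p : E ⥤ B} {A J D : B} {v : A ⟶ J} {w : D ⟶ A}
  {P β γ : E} {e : Evaluation p v P β} {e₁ : Evaluation p w β γ}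

lemma IsRestriction.comp {K : B} {Q G R : E} {k : Q ⟶ P} {g : K ⟶ A} {l : G ⟶ β} {ρ : Q ⟶ G}
    (hρ : e.IsRestriction k g l ρ) {d : K ⟶ D} {l₁ : R ⟶ γ} {ρ₁ : G ⟶ R}
    (hρ₁ : e₁.IsRestriction l d l₁ ρ₁) : (e.comp e₁).IsRestriction k d l₁ (ρ ≫ ρ₁) := by
  have hg : d ≫ w = g := isHomLift_unique hρ₁.isHomLift hρ.cartesian.toIsHomLift
  refine ⟨by rw [← Category.assoc, hg]; exact hρ.isHomLift, hρ₁.cartesian,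
    isHomLift_comp hρ.vertical hρ₁.vertical (Category.id_comp _), ?_⟩
  rw [Category.assoc, hρ₁.fac]
  refine e₁.comp_ev' hρ.vertical _ _ (Category.id_comp _) ?_
  rw [hρ.fac]
  exact e.ev_congr _ _ hg.symm rfl

/-- Unique splittings along a composite product descend to the outer product. -/
lemma HasUniqueSplitting.of_comp [p.IsFibered] (hβ : p.obj β = A) {K : B} {Q α : E} {k : Q ⟶ P}
    (H : (e.comp e₁).HasUniqueSplitting K k α)
    (H₁ : ∀ {g : K ⟶ A} {G : E} {l : G ⟶ β}, p.IsStronglyCartesian g l →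
      e₁.HasUniqueSplitting K l α) : e.HasUniqueSplitting K k α := by
  refine ⟨fun {S n h} hh => ?_, fun {S n g g' G G' l l' ρ ρ'} hρ hρ' {t t'} ht ht' h => ?_,
    fun {S n g G l ρ} hρ {t t'} ht ht' h => ?_⟩
  · obtain ⟨d, R, l₁, ρ', t, hρ', ht, rfl⟩ := H.exists_fac hh
    -- The section for the outer product is `d ≫ w`. The restriction at d passes through the
    -- restriction at `d ≫ w` by a further restriction along w.
    have hk : p.IsHomLift ((d ≫ w) ≫ v) k := by rw [Category.assoc]; exact hρ'.isHomLift
    obtain ⟨G, l, ρ, hρ⟩ := e.exists_isRestriction hβ hk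
    obtain ⟨ρ₁, hρ₁⟩ := e₁.exists_isRestriction_of_cartesian hρ.cartesian.toIsHomLift hρ'.cartesian
    have hc := hρ.comp hρ₁
    refine ⟨_, G, l, ρ, ρ₁ ≫ t, hρ, isHomLift_comp hρ₁.vertical ht (Category.id_comp _), ?_⟩
    rw [← Category.assoc]
    congr 1
    exact cartesian_hom_ext hρ'.cartesian hc.vertical hρ'.vertical (hc.fac.trans hρ'.fac.symm)
  -- Splitting t and t' once more, along w, gives two splittings along the composite. Their sections
  -- into D agree, and g, g' are the images of these under w.
  · obtain ⟨d, R, l₁, ρ₁, s, hρ₁, hs, rfl⟩ := (H₁ hρ.cartesian).exists_fac ht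
    obtain ⟨d', R', l₁', ρ₁', s', hρ₁', hs', rfl⟩ := (H₁ hρ'.cartesian).exists_fac ht'
    obtain rfl := H.section_unique (hρ.comp hρ₁) (hρ'.comp hρ₁') hs hs' (by simpa using h)
    exact (isHomLift_unique hρ₁.isHomLift hρ.cartesian.toIsHomLift).symm.trans
      (isHomLift_unique hρ₁'.isHomLift hρ'.cartesian.toIsHomLift)
  · obtain ⟨d, R, l₁, ρ₁, s, hρ₁, hs, rfl⟩ := (H₁ hρ.cartesian).exists_fac ht
    obtain ⟨d', R', l₁', ρ₁', s', hρ₁', hs', rfl⟩ := (H₁ hρ.cartesian).exists_fac ht'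
    obtain rfl := H.section_unique (hρ.comp hρ₁) (hρ.comp hρ₁') hs hs' (by simpa using h)
    obtain ⟨s₂, hs₂, hs₂'⟩ := hρ₁'.exists_transfer hρ₁ hs'
    rw [← hs₂'] at h ⊢
    rw [H.hom_ext (hρ.comp hρ₁) hs hs₂ (by simpa using h)]

end Evaluation

variable {E : Type u₂} [Category.{v₂} E] {F : MorphismProperty B} {p : E ⥤ B} [p.IsFibered]

/-- If every object is a product of an object of `S`, and objects of `S` have unique splittings
along products of objects of `S`, then there are enough quantifier-free objects. -/
theorem hasEnoughQuantifierFree_of_class [IsDisplayMapClass F] [HasFibredProducts F p]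
    (hF : F.IsStableUnderComposition) (S : E → Prop)
    (hprod : ∀ X : E, ∃ (A J : B) (v : A ⟶ J) (β : E) (e : Evaluation p v X β), F v ∧ S β ∧
      p.obj X = J ∧ p.obj β = A ∧ e.IsProduct)
    (hsplit : ∀ {α β : E}, S α → S β → ∀ {A J : B} {v : A ⟶ J}, F v → p.obj β = A →
      ∀ {P : E} {e : Evaluation p v P β}, e.IsProduct → ∀ {K : B} {m : K ⟶ J} {Q : E} {k : Q ⟶ P},
      p.IsStronglyCartesian m k → e.HasUniqueSplitting K k α) :
    HasEnoughQuantifierFree F p := by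
  have hqf : ∀ {A : B} (α : p.Fiber A), S (tot α) → IsQuantifierFree F p α := by
    intro A α hα
    refine isQuantifierFree_of_hasUniqueSplitting fun {C I} u hu β => ?_
    obtain ⟨C, rfl⟩ := β
    -- An arbitrary object under ∏_u is itself a product along w of an object γ of the class, so ∏_u
    -- of it is a product of γ along `w ≫ u`, a display map by closure under composition.
    obtain ⟨D, _, w, γ, e₁, hw, hγ, rfl, hD, he₁⟩ := hprod C
    refine .of_comp rfl (e₁ := e₁) ?_ (hsplit hα hγ hw hD he₁)
    have hc := (prodEvaluation_isProduct p u hu ⟨C, rfl⟩).comp he₁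
      (fun f => IsDisplayMapClass.hasPullback f u hu)
    refine hsplit hα hγ (F.comp_mem w u hw hu) hD hc (m := 𝟙 I) ?_
    have : p.IsHomLift (𝟙 I) (𝟙 (tot ((prod p u hu).obj ⟨C, rfl⟩))) := IsHomLift.id (tot_proj _)
    infer_instance
  rintro I ⟨X, rfl⟩
  obtain ⟨_, _, v, β, e, hv, hβ, rfl, rfl, he⟩ := hprod X
  refine ⟨_, v, hv, ⟨β, rfl⟩, hqf _ hβ, ?_⟩
  obtain ⟨i, h₁, h₂, -⟩ := he.exists_iso (prodEvaluation_isProduct p v hv ⟨β, rfl⟩) rfl (tot_proj _)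
  exact ⟨⟨vertMk i.hom h₁, vertMk i.inv h₂, Functor.Fiber.hom_ext i.hom_inv_id,
    Functor.Fiber.hom_ext i.inv_hom_id⟩⟩

end FibredProducts

/-! ### Arrows of the product completion through their actions, and its cartesian arrows -/

namespace FibredProducts

variable {B : Type u₁} [Category.{v₁} B]

namespace Evaluation

/-- Unique splittings may be checked on one restriction for each section. -/
lemma HasUniqueSplitting.of_restrictions {E : Type u₂} [Category.{v₂} E] {p : E ⥤ B} {A J : B}
    {v : A ⟶ J} {P β : E} {e : Evaluation p v P β} {K : B} {Q α : E} {k : Q ⟶ P}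
    {R : (K ⟶ A) → E} {l : ∀ d, R d ⟶ β} {ρ : ∀ d, p.IsHomLift (d ≫ v) k → (Q ⟶ R d)}
    (hρ : ∀ d hd, e.IsRestriction k d (l d) (ρ d hd))
    (hfac : ∀ {S : B} {n : K ⟶ S} {h : Q ⟶ α}, p.IsHomLift n h →
      ∃ d hd t, p.IsHomLift n t ∧ ρ d hd ≫ t = h)
    (hsec : ∀ {S : B} {n : K ⟶ S} {d d' hd hd'} {t : R d ⟶ α} {t' : R d' ⟶ α}, p.IsHomLift n t →
      p.IsHomLift n t' → ρ d hd ≫ t = ρ d' hd' ≫ t' → d = d')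
    (hhom : ∀ {S : B} {n : K ⟶ S} {d hd} {t t' : R d ⟶ α}, p.IsHomLift n t →
      p.IsHomLift n t' → ρ d hd ≫ t = ρ d hd ≫ t' → t = t') : e.HasUniqueSplitting K k α := by
  refine ⟨fun hh => ?_, fun h₁ h₂ t t' ht ht' h => ?_, fun h₁ t t' ht ht' h => ?_⟩
  · obtain ⟨d, hd, t, ht, h⟩ := hfac hh
    exact ⟨d, _, _, _, t, hρ d hd, ht, h⟩
  · obtain ⟨s, hs, e₁⟩ := h₁.exists_transfer (hρ _ h₁.isHomLift) ht
    obtain ⟨s', hs', e₂⟩ := h₂.exists_transfer (hρ _ h₂.isHomLift) ht'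
    exact hsec hs hs' (by rw [e₁, e₂, h])
  · obtain ⟨i, j₁, j₂, -, -, -, j₃⟩ := h₁.exists_iso (hρ _ h₁.isHomLift)
    rw [← cancel_epi i.inv]
    exact hhom (isHomLift_comp j₂ ht (Category.id_comp _))
      (isHomLift_comp j₂ ht' (Category.id_comp _))
      (hd := h₁.isHomLift) (by rw [← Category.assoc, j₃, h, ← Category.assoc, j₃])

end Evaluation

variable {F : MorphismProperty B} {E : Type u₂} [Category.{v₂} E] {q : E ⥤ B}

/-- A morphism of the product completion over `f`, given by its actions on generalised elements. -/
structure PiHom.Family (x y : PiObj F q) (f : x.base ⟶ y.base) where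
  app {T : B} (a : T ⟶ x.base) (b : T ⟶ y.dom) (h : a ≫ f = b ≫ y.map) : T ⟶ x.dom
  app_map {T : B} (a : T ⟶ x.base) (b : T ⟶ y.dom) (h : a ≫ f = b ≫ y.map) :
    app a b h ≫ x.map = a
  comp_app {T T' : B} (r : T' ⟶ T) (a : T ⟶ x.base) (b : T ⟶ y.dom) (h : a ≫ f = b ≫ y.map)
    (h' : (r ≫ a) ≫ f = (r ≫ b) ≫ y.map) : r ≫ app a b h = app (r ≫ a) (r ≫ b) h'
  push {T : B} {c : E} (a : T ⟶ x.base) (b : T ⟶ y.dom) (h : a ≫ f = b ≫ y.map)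
    (θ : c ⟶ tot x.obj) (hθ : q.IsHomLift (app a b h) θ) : c ⟶ tot y.obj
  push_isHomLift {T : B} {c : E} (a : T ⟶ x.base) (b : T ⟶ y.dom) (h : a ≫ f = b ≫ y.map)
    (θ : c ⟶ tot x.obj) (hθ : q.IsHomLift (app a b h) θ) : q.IsHomLift b (push a b h θ hθ)
  comp_push {T T' : B} {c c' : E} (r : T' ⟶ T) (a : T ⟶ x.base) (b : T ⟶ y.dom)
    (h : a ≫ f = b ≫ y.map) (h' : (r ≫ a) ≫ f = (r ≫ b) ≫ y.map) (χ : c' ⟶ c) (hχ : q.IsHomLift r χ)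
    (θ : c ⟶ tot x.obj) (hθ : q.IsHomLift (app a b h) θ)
    (hθ' : q.IsHomLift (app (r ≫ a) (r ≫ b) h') (χ ≫ θ)) :
    χ ≫ push a b h θ hθ = push (r ≫ a) (r ≫ b) h' (χ ≫ θ) hθ'

namespace PiHom

section Family

variable {x y : PiObj F q} {f : x.base ⟶ y.base} (Φ : Family x y f)

lemma Family.app_congr {T : B} {a a' : T ⟶ x.base} {b b' : T ⟶ y.dom}
    (h : a ≫ f = b ≫ y.map) (h' : a' ≫ f = b' ≫ y.map) (ha : a = a') (hb : b = b') :
    Φ.app a b h = Φ.app a' b' h' := by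
  subst ha hb
  rfl

lemma Family.push_congr {T : B} {a a' : T ⟶ x.base} {b b' : T ⟶ y.dom}
    (h : a ≫ f = b ≫ y.map) (h' : a' ≫ f = b' ≫ y.map) (ha : a = a') (hb : b = b')
    {c : E} {θ θ' : c ⟶ tot x.obj} (hθ : q.IsHomLift (Φ.app a b h) θ)
    (hθ' : q.IsHomLift (Φ.app a' b' h') θ') (e : θ = θ') :
    Φ.push a b h θ hθ = Φ.push a' b' h' θ' hθ' := by
  subst ha hb e
  rfl

variable [IsDisplayMapClass F] [q.IsFibered]

/-- The morphism defined by a family. -/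
def Family.toHom : x ⟶ y :=
  ofArrow f (Φ.app (pullback.fst _ _) (pullback.snd _ _) pullback.condition) (Φ.app_map _ _ _)
    (Φ.push (pullback.fst _ _) (pullback.snd _ _) pullback.condition (cart q _ x.obj)
      inferInstance) (Φ.push_isHomLift _ _ _ _ _)

lemma Family.toHom_base : PiHom.base Φ.toHom = f := rfl

/-- `toHom` records only the value at the universal point (pr₁, pr₂) of I ×_J Y; naturality recovers
all other values. -/
lemma Family.toHom_app {T : B} (a : T ⟶ x.base) (b : T ⟶ y.dom) (h : a ≫ f = b ≫ y.map) :
    PiHom.app Φ.toHom a b h = Φ.app a b h :=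
  (Φ.comp_app (pullback.lift a b h) _ _ _
    (by simp only [pullback.lift_fst, pullback.lift_snd, h])).trans
    (Φ.app_congr _ _ (pullback.lift_fst _ _ _) (pullback.lift_snd _ _ _))

lemma Family.toHom_push {T : B} (a : T ⟶ x.base) (b : T ⟶ y.dom) (h : a ≫ f = b ≫ y.map) {c : E}
    (θ : c ⟶ tot x.obj) (hθ : q.IsHomLift (PiHom.app Φ.toHom a b h) θ)
    (hθ' : q.IsHomLift (Φ.app a b h) θ) :
    PiHom.push Φ.toHom a b h θ hθ = Φ.push a b h θ hθ' := by
  refine (ofArrow_push _ _ _ _ _ _ _ _ _ _).trans ?_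
  have h' : (pullback.lift a b h ≫ pullback.fst f y.map) ≫ f =
      (pullback.lift a b h ≫ pullback.snd f y.map) ≫ y.map := by
    simp only [pullback.lift_fst, pullback.lift_snd, h]
  have e := Φ.app_congr h' h (pullback.lift_fst _ _ _) (pullback.lift_snd _ _ _)
  refine (Φ.comp_push (pullback.lift a b h) _ _ _ h' _ (factor_isHomLift q _ _ _ _ _) _ _
    (by rw [e]; exact (factor_cart q _ _ _ _ hθ).symm ▸ hθ')).trans ?_
  exact Φ.push_congr _ _ (pullback.lift_fst _ _ _) (pullback.lift_snd _ _ _) _ _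
    (factor_cart q _ _ _ _ _)

end Family

section Relations

variable [IsDisplayMapClass F] [q.IsFibered]

variable {x y z : PiObj F q}

/-- `Acts φ a b d` says that the action of `φ` at the point `(a, b)` is `d`. -/
def Acts (φ : x ⟶ y) {T : B} (a : T ⟶ x.base) (b : T ⟶ y.dom) (d : T ⟶ x.dom) : Prop :=
  ∃ h : a ≫ PiHom.base φ = b ≫ y.map, PiHom.app φ a b h = d

/-- `Sends φ a b θ η` says that the action of `φ` at the point `(a, b)` sends `θ` to `η`. -/
def Sends (φ : x ⟶ y) {T : B} (a : T ⟶ x.base) (b : T ⟶ y.dom) {c : E} (θ : c ⟶ tot x.obj)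
    (η : c ⟶ tot y.obj) : Prop :=
  ∃ (h : a ≫ PiHom.base φ = b ≫ y.map) (hθ : q.IsHomLift (PiHom.app φ a b h) θ),
    PiHom.push φ a b h θ hθ = η

variable {φ ψ : x ⟶ y} {T : B} {a : T ⟶ x.base} {b : T ⟶ y.dom} {d d' : T ⟶ x.dom} {c : E}
  {θ : c ⟶ tot x.obj} {η η' : c ⟶ tot y.obj}

lemma acts_app (φ : x ⟶ y) (h : a ≫ PiHom.base φ = b ≫ y.map) :
    Acts φ a b (PiHom.app φ a b h) :=
  ⟨h, rfl⟩

lemma Acts.w (h : Acts φ a b d) : a ≫ PiHom.base φ = b ≫ y.map := h.1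

lemma Acts.map (h : Acts φ a b d) : d ≫ x.map = a := by
  obtain ⟨h, rfl⟩ := h
  exact PiHom.app_map φ a b h

lemma Acts.unique (h : Acts φ a b d) (h' : Acts φ a b d') : d = d' := by
  obtain ⟨h, rfl⟩ := h
  obtain ⟨h', rfl⟩ := h'
  rfl

lemma Acts.comp_left {T' : B} (h : Acts φ a b d) (r : T' ⟶ T) :
    Acts φ (r ≫ a) (r ≫ b) (r ≫ d) := by
  obtain ⟨h, rfl⟩ := h
  exact ⟨by simp [h], (PiHom.app_natural φ r h _ rfl rfl).symm⟩

lemma Acts.exists_sends (h : Acts φ a b d) (hθ : q.IsHomLift d θ) :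
    ∃ η : c ⟶ tot y.obj, q.IsHomLift b η ∧ Sends φ a b θ η := by
  obtain ⟨h, rfl⟩ := h
  exact ⟨_, PiHom.push_isHomLift φ a b h θ hθ, h, hθ, rfl⟩

lemma Sends.unique (h : Sends φ a b θ η) (h' : Sends φ a b θ η') : η = η' := by
  obtain ⟨h, hθ, rfl⟩ := h
  obtain ⟨h', hθ', rfl⟩ := h'
  rfl

/-- Composition is substitution: ψ carries the point b back to e, and φ carries e back to d. The
relational form, with f a variable, keeps the proofs on which `app` depends out of later rewriting.
-/
lemma Acts.comp {ψ : y ⟶ z} {b : T ⟶ z.dom} {e : T ⟶ y.dom} {f : T ⟶ y.base}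
    (h : Acts ψ f b e) (hf : a ≫ PiHom.base φ = f) (h' : Acts φ a e d) : Acts (φ ≫ ψ) a b d := by
  subst hf
  obtain ⟨h, rfl⟩ := h
  obtain ⟨h', rfl⟩ := h'
  have h₁ : a ≫ PiHom.base φ ≫ PiHom.base ψ = b ≫ z.map := by rw [← Category.assoc, h]
  exact ⟨h₁, PiHom.comp_app φ ψ a b h₁⟩

lemma Sends.comp {ψ : y ⟶ z} {b : T ⟶ z.dom} {e : T ⟶ y.dom} {f : T ⟶ y.base}
    {ζ : c ⟶ tot z.obj} (he : Acts ψ f b e) (hf : a ≫ PiHom.base φ = f) (h : Sends φ a e θ η)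
    (h' : Sends ψ f b η ζ) : Sends (φ ≫ ψ) a b θ ζ := by
  subst hf
  obtain ⟨_, rfl⟩ := he
  obtain ⟨h, hθ, rfl⟩ := h
  obtain ⟨h', hθ', rfl⟩ := h'
  have h₁ : a ≫ PiHom.base φ ≫ PiHom.base ψ = b ≫ z.map := by rw [← Category.assoc, h']
  have h₂ : q.IsHomLift (PiHom.app (φ ≫ ψ) a b h₁) θ :=
    (PiHom.comp_app φ ψ a b h₁).symm ▸ hθ
  exact ⟨h₁, h₂, PiHom.comp_push φ ψ a b h₁ θ h₂⟩

/-- As `Acts` and `Sends` are single-valued, exhibiting one common value at every point and element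
is enough. -/
lemma hom_ext_of_exists (hb : PiHom.base φ = PiHom.base ψ)
    (ha : ∀ {T : B} (a : T ⟶ x.base) (b : T ⟶ y.dom), a ≫ PiHom.base φ = b ≫ y.map →
      ∃ d, Acts φ a b d ∧ Acts ψ a b d)
    (hp : ∀ {T : B} (a : T ⟶ x.base) (b : T ⟶ y.dom) {d : T ⟶ x.dom} {c : E} (θ : c ⟶ tot x.obj),
      Acts φ a b d → Acts ψ a b d → q.IsHomLift d θ → ∃ η, Sends φ a b θ η ∧ Sends ψ a b θ η) :
    φ = ψ := by
  have ha' : ∀ {T : B} (a : T ⟶ x.base) (b : T ⟶ y.dom) (h : a ≫ PiHom.base φ = b ≫ y.map)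
      (h' : a ≫ PiHom.base ψ = b ≫ y.map), PiHom.app φ a b h = PiHom.app ψ a b h' := by
    intro T a b h h'
    obtain ⟨d, h₁, h₂⟩ := ha a b h
    exact ((acts_app φ h).unique h₁).trans (h₂.unique (acts_app ψ h'))
  refine PiHom.ext' hb ha' fun a b h h' c θ hθ hθ' => ?_
  obtain ⟨η, h₁, h₂⟩ := hp a b θ (acts_app φ h) ⟨h', (ha' a b h h').symm⟩ hθ
  exact Sends.unique (φ := φ) ⟨h, hθ, rfl⟩ h₁ |>.trans (h₂.unique ⟨h', hθ', rfl⟩)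

lemma Family.acts {f : x.base ⟶ y.base} (Φ : Family x y f) (h : a ≫ f = b ≫ y.map)
    (hd : Φ.app a b h = d) : Acts Φ.toHom a b d :=
  ⟨h, (Φ.toHom_app a b h).trans hd⟩

lemma Family.sends {f : x.base ⟶ y.base} (Φ : Family x y f) (h : a ≫ f = b ≫ y.map)
    (hθ : q.IsHomLift (Φ.app a b h) θ) (hη : Φ.push a b h θ hθ = η) : Sends Φ.toHom a b θ η :=
  have hθ' : q.IsHomLift (PiHom.app Φ.toHom a b h) θ := (Φ.toHom_app a b h).symm ▸ hθ
  ⟨h, hθ', (Φ.toHom_push a b h θ hθ' hθ).trans hη⟩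

lemma isHomLift_iff {f : x.base ⟶ y.base} {φ : x ⟶ y} :
    (piCompletion F q).IsHomLift f φ ↔ PiHom.base φ = f := by
  constructor
  · intro h
    exact isHomLift_unique (IsHomLift.map (piCompletion F q) φ) h
  · rintro rfl
    exact IsHomLift.map (piCompletion F q) φ

end Relations

section Cartesian

variable [IsDisplayMapClass F] [q.IsFibered]

variable {w x c : PiObj F q} {m : w.base ⟶ x.base} {g : w.dom ⟶ x.dom}
  (sq : IsPullback g w.map x.map m) {k : tot w.obj ⟶ tot x.obj} (hk : q.IsStronglyCartesian g k)

/-- The cartesian morphism given by a pullback square and a cartesian arrow over its upper side. -/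
def cartesianFamily : Family w x m where
  app a b h := sq.lift b a h.symm
  app_map a b h := sq.lift_snd _ _ _
  comp_app r a b h h' := by apply sq.hom_ext <;> simp
  push a b h θ hθ := θ ≫ k
  push_isHomLift a b h θ hθ := isHomLift_comp hθ hk.toIsHomLift (sq.lift_fst _ _ _)
  comp_push r a b h h' χ hχ θ hθ hθ' := (Category.assoc _ _ _).symm

lemma cartesianFamily_acts {T : B} {a : T ⟶ w.base} {b : T ⟶ x.dom} {d : T ⟶ w.dom}
    (ha : d ≫ w.map = a) (hb : d ≫ g = b) : Acts (cartesianFamily sq hk).toHom a b d :=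
  Family.acts _ (by rw [← ha, ← hb, Category.assoc, Category.assoc, sq.w])
    (sq.hom_ext ((sq.lift_fst _ _ _).trans hb.symm) ((sq.lift_snd _ _ _).trans ha.symm))

lemma cartesianFamily_sends {T : B} {a : T ⟶ w.base} {b : T ⟶ x.dom} {d : T ⟶ w.dom}
    (ha : d ≫ w.map = a) (hb : d ≫ g = b) {e : E} {θ : e ⟶ tot w.obj} (hθ : q.IsHomLift d θ) :
    Sends (cartesianFamily sq hk).toHom a b θ (θ ≫ k) := by
  have h : sq.lift b a (by rw [← ha, ← hb, Category.assoc, Category.assoc, sq.w]) = d :=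
    sq.hom_ext ((sq.lift_fst _ _ _).trans hb.symm) ((sq.lift_snd _ _ _).trans ha.symm)
  exact Family.sends _ (by rw [← ha, ← hb, Category.assoc, Category.assoc, sq.w]) (h.symm ▸ hθ) rfl

/-- The composite at the point `b ≫ g` acts as χ does at b, followed on arrows by the cartesian k.
So the action on points is recovered at once, and the action on arrows by cancelling k. -/
lemma cartesianFamily_hom_ext {χ χ' : c ⟶ w} (hb : PiHom.base χ = PiHom.base χ')
    (h : χ ≫ (cartesianFamily sq hk).toHom = χ' ≫ (cartesianFamily sq hk).toHom) : χ = χ' := by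
  refine hom_ext_of_exists hb (fun a b h₁ => ?_) fun a b d e θ h₁ h₂ hθ => ?_
  · have h₂ : a ≫ PiHom.base χ' = b ≫ w.map := hb ▸ h₁
    refine ⟨_, acts_app χ h₁, h₂, ?_⟩
    have e₁ := (cartesianFamily_acts sq hk h₁.symm rfl).comp rfl (acts_app χ h₁)
    rw [h] at e₁
    exact ((cartesianFamily_acts sq hk h₂.symm rfl).comp rfl (acts_app χ' h₂)).unique e₁
  · obtain ⟨η, hη, hs⟩ := h₁.exists_sends hθ
    obtain ⟨η', hη', hs'⟩ := h₂.exists_sends hθ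
    have e₁ := Sends.comp (cartesianFamily_acts sq hk h₁.w.symm rfl) rfl hs
      (cartesianFamily_sends sq hk h₁.w.symm rfl hη)
    have e₂ := Sends.comp (cartesianFamily_acts sq hk h₂.w.symm rfl) rfl hs'
      (cartesianFamily_sends sq hk h₂.w.symm rfl hη')
    rw [h] at e₁
    obtain rfl := cartesian_hom_ext hk hη hη' (e₁.unique e₂)
    exact ⟨η, hs, hs'⟩

/-- The factorisation of a morphism through a cartesian one. -/
def factorFamily {f : c.base ⟶ w.base} (φ : c ⟶ x) (hφ : PiHom.base φ = f ≫ m) : Family c w f :=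
  have cond {T : B} {a : T ⟶ c.base} {b : T ⟶ w.dom} (h : a ≫ f = b ≫ w.map) :
      a ≫ PiHom.base φ = (b ≫ g) ≫ x.map := by
    rw [hφ, ← Category.assoc, h, Category.assoc, ← sq.w, Category.assoc]
  have lift {T : B} {a : T ⟶ c.base} {b : T ⟶ w.dom} (h : a ≫ f = b ≫ w.map) {d : E}
      (θ : d ⟶ tot c.obj) (hθ : q.IsHomLift (PiHom.app φ a (b ≫ g) (cond h)) θ) :=
    exists_factor hk (Eq.refl (b ≫ g)) (PiHom.push_isHomLift φ a (b ≫ g) (cond h) θ hθ)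
  { app := fun a b h => PiHom.app φ a (b ≫ g) (cond h)
    app_map := fun a b h => PiHom.app_map φ _ _ _
    comp_app := fun r a b h h' => PiHom.app_natural φ r _ _ rfl (Category.assoc _ _ _).symm
    push := fun a b h θ hθ => (lift h θ hθ).choose
    push_isHomLift := fun a b h θ hθ => (lift h θ hθ).choose_spec.1
    comp_push := fun r a b h h' χ hχ θ hθ hθ' => by
      refine cartesian_hom_ext hk (isHomLift_comp hχ (lift h θ hθ).choose_spec.1 rfl)
        (lift h' _ hθ').choose_spec.1 ?_
      rw [Category.assoc, (lift h θ hθ).choose_spec.2, (lift h' _ hθ').choose_spec.2]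
      exact PiHom.push_natural φ r _ _ rfl (Category.assoc _ _ _).symm χ hχ _ _ _ _ rfl }

section Factor

variable {f : c.base ⟶ w.base} {φ : c ⟶ x} (hφ : PiHom.base φ = f ≫ m) {T : B} {a : T ⟶ c.base}
  {b : T ⟶ w.dom}

lemma factorFamily_acts (h : a ≫ f = b ≫ w.map) {d : T ⟶ c.dom} (hd : Acts φ a (b ≫ g) d) :
    Acts (factorFamily sq hk φ hφ).toHom a b d :=
  Family.acts _ h hd.2

lemma factorFamily_sends (h : a ≫ f = b ≫ w.map) {e : E} {θ : e ⟶ tot c.obj}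
    {η : e ⟶ tot w.obj} (hη : q.IsHomLift b η) (hs : Sends φ a (b ≫ g) θ (η ≫ k)) :
    Sends (factorFamily sq hk φ hφ).toHom a b θ η := by
  obtain ⟨h', hθ, e⟩ := hs
  refine Family.sends _ h hθ (cartesian_hom_ext hk (Family.push_isHomLift _ _ _ _ _ _) hη ?_)
  rw [← e]
  exact (exists_factor hk (Eq.refl (b ≫ g))
    (PiHom.push_isHomLift φ a (b ≫ g) h' θ hθ)).choose_spec.2

end Factor

lemma factorFamily_comp {f : c.base ⟶ w.base} (φ : c ⟶ x) (hφ : PiHom.base φ = f ≫ m) :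
    (factorFamily sq hk φ hφ).toHom ≫ (cartesianFamily sq hk).toHom = φ := by
  have key : ∀ {T : B} {a : T ⟶ c.base} {b : T ⟶ x.dom}, a ≫ PiHom.base φ = b ≫ x.map →
      ∃ b' : T ⟶ w.dom, b' ≫ g = b ∧ b' ≫ w.map = a ≫ f := fun {T a b} h =>
    have h' : b ≫ x.map = (a ≫ f) ≫ m := by rw [← h, hφ, Category.assoc]
    ⟨sq.lift b (a ≫ f) h', sq.lift_fst _ _ _, sq.lift_snd _ _ _⟩
  refine hom_ext_of_exists hφ.symm (fun a b h => ?_) fun a b d e θ _ h hθ => ?_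
  · replace h : a ≫ PiHom.base φ = b ≫ x.map := by rw [hφ]; exact h
    obtain ⟨b', rfl, hb⟩ := key h
    exact ⟨_, (cartesianFamily_acts sq hk hb rfl).comp rfl
      (factorFamily_acts sq hk hφ hb.symm (acts_app φ h)), acts_app φ h⟩
  · obtain ⟨b', rfl, hb⟩ := key h.w
    obtain ⟨ζ, hζ, hs⟩ := h.exists_sends hθ
    obtain ⟨η, hη, rfl⟩ := exists_factor hk rfl hζ
    exact ⟨_, Sends.comp (cartesianFamily_acts sq hk hb rfl) rfl
      (factorFamily_sends sq hk hφ hb.symm hη hs) (cartesianFamily_sends sq hk hb rfl hη), hs⟩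

lemma cartesianFamily_isStronglyCartesian :
    (piCompletion F q).IsStronglyCartesian m (cartesianFamily sq hk).toHom where
  toIsHomLift := isHomLift_iff.2 rfl
  universal_property' {c} f φ hφ := by
    have hφ' : PiHom.base φ = f ≫ m := isHomLift_iff.1 hφ
    refine ⟨(factorFamily sq hk φ hφ').toHom, ⟨isHomLift_iff.2 rfl,
      factorFamily_comp sq hk φ hφ'⟩, ?_⟩
    rintro χ ⟨h₁, h₂⟩
    exact cartesianFamily_hom_ext sq hk (isHomLift_iff.1 h₁)
      (h₂.trans (factorFamily_comp sq hk φ hφ').symm)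

end Cartesian

end PiHom

end FibredProducts

/-! ### Products and unique splittings in the product completion -/

namespace FibredProducts

variable {B : Type u₁} [Category.{v₁} B] {F : MorphismProperty B} {E : Type u₂} [Category.{v₂} E]
  {q : E ⥤ B}

/-- The object `(𝟙 A, α)` of the product completion. -/
abbrev PiObj.unit [F.ContainsIdentities] {A : B} (α : q.Fiber A) : PiObj F q :=
  ⟨A, A, 𝟙 A, F.id_mem A, α⟩

variable [IsDisplayMapClass F] [q.IsFibered]

/-- The reindexing of an object of the product completion. -/
abbrev PiObj.pull (x : PiObj F q) {K : B} (m : K ⟶ x.base) : PiObj F q :=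
  ⟨K, pullback m x.map, pullback.fst m x.map,
    MorphismProperty.of_isPullback (IsPullback.of_hasPullback m x.map).flip x.display,
    (reindex q (pullback.snd m x.map)).obj x.obj⟩

namespace PiHom

/-- The cartesian morphism from a reindexing. -/
def pullHom (x : PiObj F q) {K : B} (m : K ⟶ x.base) : x.pull m ⟶ x :=
  (cartesianFamily (w := x.pull m) (m := m) (IsPullback.of_hasPullback m x.map).flip
    (isStronglyCartesian_cart q _ _)).toHom

section Pull

variable (x : PiObj F q) {K : B} (m : K ⟶ x.base) {T : B} {a : T ⟶ K} {b : T ⟶ x.dom}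
  {d : T ⟶ pullback m x.map}

lemma pullHom_isStronglyCartesian :
    (piCompletion F q).IsStronglyCartesian m (pullHom x m) :=
  cartesianFamily_isStronglyCartesian _ _

lemma pullHom_acts (ha : d ≫ pullback.fst m x.map = a) (hb : d ≫ pullback.snd m x.map = b) :
    Acts (pullHom x m) a b d :=
  cartesianFamily_acts (w := x.pull m) (m := m) _ _ ha hb

lemma pullHom_sends (ha : d ≫ pullback.fst m x.map = a) (hb : d ≫ pullback.snd m x.map = b)
    {e : E} {θ : e ⟶ tot ((reindex q (pullback.snd m x.map)).obj x.obj)}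
    (hθ : q.IsHomLift d θ) : Sends (pullHom x m) a b θ (θ ≫ cart q _ x.obj) :=
  cartesianFamily_sends (w := x.pull m) (m := m) _ _ ha hb hθ

end Pull

/-- A lift of `b ≫ x.map` has a domain whose base equals T only propositionally. The `eqToHom` makes
b an arrow out of `c.base`, as `evalFamily` requires. -/
lemma base_eq_of_isHomLift {x c : PiObj F q} {φ : c ⟶ x} {T : B} {b : T ⟶ x.dom}
    (h : (piCompletion F q).IsHomLift (b ≫ x.map) φ) :
    PiHom.base φ =
      (eqToHom (show c.base = T from IsHomLift.domain_eq (piCompletion F q) (b ≫ x.map) φ) ≫ b) ≫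
        x.map := by
  obtain rfl : c.base = T := IsHomLift.domain_eq (piCompletion F q) (b ≫ x.map) φ
  rw [isHomLift_iff.1 h, eqToHom_refl, Category.id_comp]

variable [F.ContainsIdentities]

lemma Acts.unit {x : PiObj F q} {A : B} {α : q.Fiber A} {φ : x ⟶ PiObj.unit α} {T : B}
    {a : T ⟶ x.base} {b : T ⟶ A} {d : T ⟶ x.dom} (h : Acts φ a b d) : a ≫ PiHom.base φ = b :=
  h.w.trans (Category.comp_id _)

/-- The cartesian morphism `(𝟙, d^* α) ⟶ (𝟙, α)`. -/
def unitHom {K A : B} (d : K ⟶ A) (α : q.Fiber A) :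
    PiObj.unit (F := F) ((reindex q d).obj α) ⟶ PiObj.unit α :=
  (cartesianFamily (w := PiObj.unit ((reindex q d).obj α)) (x := PiObj.unit α) (m := d)
    (show IsPullback d (𝟙 K) (𝟙 A) d from IsPullback.of_vert_isIso ⟨by simp⟩)
    (isStronglyCartesian_cart q _ _)).toHom

section Unit

variable {K A : B} (d : K ⟶ A) (α : q.Fiber A) {T : B} {a : T ⟶ K}

lemma unitHom_isStronglyCartesian :
    (piCompletion F q).IsStronglyCartesian d (unitHom d α) :=
  cartesianFamily_isStronglyCartesian _ _

lemma unitHom_acts {b : T ⟶ A} (hb : a ≫ d = b) : Acts (unitHom (F := F) d α) a b a :=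
  cartesianFamily_acts (w := PiObj.unit ((reindex q d).obj α)) (x := PiObj.unit α) (m := d) _ _
    (Category.comp_id _) hb

lemma unitHom_sends {b : T ⟶ A} (hb : a ≫ d = b) {e : E} {θ : e ⟶ tot ((reindex q d).obj α)}
    (hθ : q.IsHomLift a θ) : Sends (unitHom (F := F) d α) a b θ (θ ≫ cart q d α) :=
  cartesianFamily_sends (w := PiObj.unit ((reindex q d).obj α)) (x := PiObj.unit α) (m := d) _ _
    (Category.comp_id _) hb hθ

end Unit

section Evaluation

variable {x c c' : PiObj F q}

/-- The evaluation of a morphism at a map to the domain of the codomain. -/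
def evalFamily (φ : c ⟶ x) {b : c.base ⟶ x.dom} (hb : PiHom.base φ = b ≫ x.map) :
    Family c (PiObj.unit x.obj) b :=
  have cond {T : B} {a : T ⟶ c.base} {b' : T ⟶ x.dom} (h : a ≫ b = b' ≫ 𝟙 _) :
      a ≫ PiHom.base φ = b' ≫ x.map := by
    rw [hb, ← Category.assoc, h, Category.comp_id]
  { app := fun a b h => PiHom.app φ a b (cond h)
    app_map := fun a b h => PiHom.app_map φ _ _ _
    comp_app := fun r a b h h' => PiHom.app_natural φ r _ _ rfl rfl
    push := fun a b h θ hθ => PiHom.push φ a b (cond h) θ hθ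
    push_isHomLift := fun a b h θ hθ => PiHom.push_isHomLift φ a b _ θ hθ
    comp_push := fun r a b h h' χ hχ θ hθ hθ' =>
      PiHom.push_natural φ r _ _ rfl rfl χ hχ _ _ _ _ rfl }

section

variable {φ : c ⟶ x} {b : c.base ⟶ x.dom} (hb : PiHom.base φ = b ≫ x.map) {T : B}
  {a : T ⟶ c.base} {b' : T ⟶ x.dom}

lemma evalFamily_acts (h : a ≫ b = b') {d : T ⟶ c.dom} (hd : Acts φ a b' d) :
    Acts (evalFamily φ hb).toHom a b' d :=
  Family.acts _ (h.trans (Category.comp_id _).symm) hd.2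

lemma evalFamily_sends (h : a ≫ b = b') {e : E} {θ : e ⟶ tot c.obj} {η : e ⟶ tot x.obj}
    (hs : Sends φ a b' θ η) :
    Sends (evalFamily φ hb).toHom a b' θ η := by
  obtain ⟨h', hθ, e⟩ := hs
  exact Family.sends _ (h.trans (Category.comp_id _).symm) hθ e

end

/-- Naturality of evaluation in the domain: on both sides the action at a point is that of φ
combined with that of χ. -/
lemma comp_evalFamily {φ : c ⟶ x} {b : c.base ⟶ x.dom} (hb : PiHom.base φ = b ≫ x.map)
    (χ : c' ⟶ c) (hb' : PiHom.base (χ ≫ φ) = (PiHom.base χ ≫ b) ≫ x.map) :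
    χ ≫ (evalFamily φ hb).toHom = (evalFamily (χ ≫ φ) hb').toHom := by
  have key : ∀ {T : B} {a : T ⟶ c'.base} {b' : T ⟶ x.dom},
      a ≫ PiHom.base (χ ≫ (evalFamily φ hb).toHom) = b' ≫ 𝟙 _ → (a ≫ PiHom.base χ) ≫ b = b' ∧
      (a ≫ PiHom.base χ) ≫ PiHom.base φ = b' ≫ x.map := by
    intro T a b' h
    have h₁ : (a ≫ PiHom.base χ) ≫ b = b' := by
      rw [Category.assoc]; exact h.trans (Category.comp_id _)
    exact ⟨h₁, by rw [hb, ← Category.assoc, h₁]⟩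
  refine hom_ext_of_exists rfl (fun a b' h => ?_) fun a b' d e θ h₁ h₂ hθ => ?_
  · obtain ⟨e₁, e₂⟩ := key h
    have h₁ := acts_app φ e₂
    have h₂ := acts_app χ h₁.map.symm
    exact ⟨_, (evalFamily_acts hb e₁ h₁).comp rfl h₂,
      evalFamily_acts hb' ((Category.assoc _ _ _).symm.trans e₁) (h₁.comp rfl h₂)⟩
  · obtain ⟨e₁, e₂⟩ := key h₁.w
    have h₃ := acts_app φ e₂
    have h₄ := acts_app χ h₃.map.symm
    obtain rfl := h₁.unique ((evalFamily_acts hb e₁ h₃).comp rfl h₄)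
    obtain ⟨η, hη, hs⟩ := h₄.exists_sends hθ
    obtain ⟨ζ, hζ, hs'⟩ := h₃.exists_sends hη
    exact ⟨ζ, Sends.comp (evalFamily_acts hb e₁ h₃) rfl hs (evalFamily_sends hb e₁ hs'),
      evalFamily_sends hb' ((Category.assoc _ _ _).symm.trans e₁) (Sends.comp h₃ rfl hs hs')⟩

lemma evalFamily_congr {φ : c ⟶ x} {b b' : c.base ⟶ x.dom} (hb : PiHom.base φ = b ≫ x.map)
    (hb' : PiHom.base φ = b' ≫ x.map) (h : b = b') :
    (evalFamily φ hb).toHom = (evalFamily φ hb').toHom := by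
  subst h
  rfl

variable (x) in
/-- The evaluation exhibiting `(X ⟶ I, α)` as the product of `(𝟙 X, α)`. -/
def piEvaluation : Evaluation (piCompletion F q) x.map x (PiObj.unit x.obj) where
  ev b φ h := (evalFamily φ (base_eq_of_isHomLift h)).toHom
  isHomLift {T c} b φ h := by
    obtain rfl : c.base = T := IsHomLift.domain_eq (piCompletion F q) (b ≫ x.map) φ
    exact isHomLift_iff.2 ((Family.toHom_base _).trans (Category.id_comp _))
  comp_ev {T T' c c'} r b χ hχ φ h h' := by
    obtain rfl : c.base = T := IsHomLift.domain_eq (piCompletion F q) (b ≫ x.map) φ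
    obtain rfl : c'.base = T' := IsHomLift.domain_eq (piCompletion F q) r χ
    obtain rfl := isHomLift_iff.1 hχ
    refine (comp_evalFamily _ _ ?_).trans ?_
    · change PiHom.base χ ≫ PiHom.base φ = _
      rw [isHomLift_iff.1 h, eqToHom_refl, Category.id_comp, Category.assoc]
    · exact evalFamily_congr _ _ (by simp)

lemma piEvaluation_ev {φ : c ⟶ x} {b : c.base ⟶ x.dom}
    (h : (piCompletion F q).IsHomLift (b ≫ x.map) φ) :
    (piEvaluation x).ev b φ h = (evalFamily φ (isHomLift_iff.1 h)).toHom :=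
  evalFamily_congr _ _ (Category.id_comp _)

lemma piEvaluation_acts {φ : c ⟶ x} {b : c.base ⟶ x.dom}
    (h : (piCompletion F q).IsHomLift (b ≫ x.map) φ) {T : B} {a : T ⟶ c.base} {b' : T ⟶ x.dom}
    (hb : a ≫ b = b') {d : T ⟶ c.dom} (hd : Acts φ a b' d) :
    Acts ((piEvaluation x).ev b φ h) a b' d := by
  rw [piEvaluation_ev]
  exact evalFamily_acts _ hb hd

lemma piEvaluation_sends {φ : c ⟶ x} {b : c.base ⟶ x.dom}
    (h : (piCompletion F q).IsHomLift (b ≫ x.map) φ) {T : B} {a : T ⟶ c.base} {b' : T ⟶ x.dom}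
    (hb : a ≫ b = b') {e : E} {θ : e ⟶ tot c.obj} {η : e ⟶ tot x.obj} (hs : Sends φ a b' θ η) :
    Sends ((piEvaluation x).ev b φ h) a b' θ η := by
  rw [piEvaluation_ev]
  exact evalFamily_sends _ hb hs

end Evaluation

section Product

variable {x z : PiObj F q} {f : z.base ⟶ x.base} {K : B} {u : K ⟶ z.base} {g : K ⟶ x.dom}
  (sq : IsPullback u g f x.map) (t : z.pull u ⟶ PiObj.unit x.obj) (ht : PiHom.base t = g)

/-- The transpose of a morphism from a reindexing. -/
def transposeFamily : Family z x f :=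
  have cond {T : B} {a : T ⟶ z.base} {b : T ⟶ x.dom} (h : a ≫ f = b ≫ x.map) :
      sq.lift a b h ≫ PiHom.base t = b ≫ 𝟙 _ := by
    rw [ht, sq.lift_snd, Category.comp_id]
  have lift {T : B} {a : T ⟶ z.base} {b : T ⟶ x.dom} (h : a ≫ f = b ≫ x.map) {c : E}
      (θ : c ⟶ tot z.obj)
      (hθ : q.IsHomLift (PiHom.app t (sq.lift a b h) b (cond h) ≫ pullback.snd u z.map) θ) :=
    exists_factor (isStronglyCartesian_cart q (pullback.snd u z.map) z.obj) rfl hθ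
  have nat {T T' : B} (r : T' ⟶ T) {a : T ⟶ z.base} {b : T ⟶ x.dom} (h : a ≫ f = b ≫ x.map)
      (h' : (r ≫ a) ≫ f = (r ≫ b) ≫ x.map) : r ≫ sq.lift a b h = sq.lift (r ≫ a) (r ≫ b) h' := by
    apply sq.hom_ext <;> simp
  -- A compatible pair (a, b) is a point of K. There t acts and yields a point of the domain of
  -- u^*z, which is projected to the domain of z.
  { app := fun a b h => PiHom.app t (sq.lift a b h) b (cond h) ≫ pullback.snd u z.map
    app_map := fun a b h => by
      have := PiHom.app_map t (sq.lift a b h) b (cond h)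
      rw [Category.assoc, ← pullback.condition, ← Category.assoc, this, sq.lift_fst]
    comp_app := fun r a b h h' => by
      rw [← Category.assoc, PiHom.app_natural t r (cond h) (cond h') (nat r h h') rfl]
    push := fun a b h θ hθ => PiHom.push t (sq.lift a b h) b (cond h) (lift h θ hθ).choose
      (lift h θ hθ).choose_spec.1
    push_isHomLift := fun a b h θ hθ => PiHom.push_isHomLift t _ b _ _ _
    comp_push := fun r a b h h' χ hχ θ hθ hθ' => by
      refine PiHom.push_natural t r _ _ (nat r h h') rfl χ hχ _ _ _ _ ?_
      refine cartesian_hom_ext (isStronglyCartesian_cart q (pullback.snd u z.map) z.obj)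
        (isHomLift_comp hχ (lift h θ hθ).choose_spec.1 rfl) ?_ ?_
      · rw [PiHom.app_natural t r (cond h) (cond h') (nat r h h') rfl]
        exact (lift h' _ hθ').choose_spec.1
      · rw [Category.assoc, (lift h θ hθ).choose_spec.2, (lift h' _ hθ').choose_spec.2] }

variable {T : B} {a : T ⟶ z.base} {b : T ⟶ x.dom} {s : T ⟶ K}

lemma transposeFamily_acts (ha : s ≫ u = a) (hb : s ≫ g = b) {d : T ⟶ pullback u z.map}
    (hd : Acts t s b d) : Acts (transposeFamily sq t ht).toHom a b (d ≫ pullback.snd u z.map) := by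
  have h : a ≫ f = b ≫ x.map := by rw [← ha, ← hb, Category.assoc, Category.assoc, sq.w]
  obtain rfl : sq.lift a b h = s :=
    sq.hom_ext ((sq.lift_fst _ _ _).trans ha.symm) ((sq.lift_snd _ _ _).trans hb.symm)
  obtain ⟨h', rfl⟩ := hd
  exact Family.acts _ h rfl

lemma transposeFamily_sends (ha : s ≫ u = a) (hb : s ≫ g = b) {c : E}
    {θ : c ⟶ tot ((reindex q (pullback.snd u z.map)).obj z.obj)} {η : c ⟶ tot x.obj}
    (hs : Sends t s b θ η) :
    Sends (transposeFamily sq t ht).toHom a b (θ ≫ cart q _ _) η := by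
  have h : a ≫ f = b ≫ x.map := by rw [← ha, ← hb, Category.assoc, Category.assoc, sq.w]
  obtain rfl : sq.lift a b h = s :=
    sq.hom_ext ((sq.lift_fst _ _ _).trans ha.symm) ((sq.lift_snd _ _ _).trans hb.symm)
  obtain ⟨h', hθ, rfl⟩ := hs
  have hθ' : q.IsHomLift (PiHom.app t (sq.lift a b h) b h' ≫ pullback.snd u z.map)
      (θ ≫ cart q (pullback.snd u z.map) z.obj) :=
    isHomLift_comp hθ (isStronglyCartesian_cart q _ _).toIsHomLift rfl
  refine Family.sends _ h hθ' (PiHom.push_congr t _ _ rfl rfl _ _ ?_)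
  have := exists_factor (isStronglyCartesian_cart q (pullback.snd u z.map) z.obj) rfl hθ'
  exact cartesian_hom_ext (isStronglyCartesian_cart q (pullback.snd u z.map) z.obj)
    this.choose_spec.1 hθ this.choose_spec.2

/-- At the pair (`s ≫ u`, `s ≫ g`) given by a point s of K, the transpose acts as t followed by the
projection to z. `pullHom` lifts the result back to the reindexing, where it agrees with t. -/
lemma piEvaluation_transpose (h : (piCompletion F q).IsHomLift (g ≫ x.map)
      (pullHom z u ≫ (transposeFamily sq t ht).toHom)) :
    (piEvaluation x).ev (c := z.pull u) g (pullHom z u ≫ (transposeFamily sq t ht).toHom) h =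
      t := by
  have hev := isHomLift_iff.1 ((piEvaluation x).isHomLift (c := z.pull u) g _ h)
  refine hom_ext_of_exists (hev.trans ht.symm) (fun {T} s b hs => ?_)
    fun {T} s b d c θ h₁ h₂ hθ => ?_
  · have hs' : s ≫ g = b := by rw [hev] at hs; exact hs.trans (Category.comp_id _)
    have h₁ : Acts t s b _ := acts_app t (by rw [ht, hs']; exact (Category.comp_id _).symm)
    refine ⟨_, piEvaluation_acts h hs' ?_, h₁⟩
    have h₁' := h₁.map
    have h₂ := transposeFamily_acts sq t ht rfl hs' h₁
    exact h₂.comp rfl (pullHom_acts z u h₁' rfl)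
  · have hs' : s ≫ g = b := by rw [← ht]; exact h₂.unit
    obtain ⟨η, hη, hs⟩ := h₂.exists_sends hθ
    refine ⟨η, piEvaluation_sends h hs' ?_, hs⟩
    have h₃ := transposeFamily_acts sq t ht rfl hs' h₂
    exact Sends.comp h₃ rfl (pullHom_sends z u h₂.map rfl hθ)
      (transposeFamily_sends sq t ht rfl hs' hs)

/-- Every compatible pair (a, b) comes from a point of K, so the evaluation at g sees the whole
action of θ. -/
lemma piEvaluation_hom_ext (sq : IsPullback u g f x.map) {θ θ' : z ⟶ x}
    (hθ : PiHom.base θ = f) (hθ' : PiHom.base θ' = f)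
    (h : (piCompletion F q).IsHomLift (g ≫ x.map) (pullHom z u ≫ θ))
    (h' : (piCompletion F q).IsHomLift (g ≫ x.map) (pullHom z u ≫ θ'))
    (e : (piEvaluation x).ev (c := z.pull u) g (pullHom z u ≫ θ) h =
      (piEvaluation x).ev (c := z.pull u) g (pullHom z u ≫ θ') h') : θ = θ' := by
  have key : ∀ {T : B} {a : T ⟶ z.base} {b : T ⟶ x.dom}, a ≫ f = b ≫ x.map →
      ∃ s : T ⟶ K, s ≫ u = a ∧ s ≫ g = b := fun h =>
    ⟨sq.lift _ _ h, sq.lift_fst _ _ _, sq.lift_snd _ _ _⟩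
  have acts : ∀ {θ : z ⟶ x} {T : B} {s : T ⟶ K} {b : T ⟶ x.dom} {d : T ⟶ z.dom} (_ : s ≫ g = b)
      (h : (piCompletion F q).IsHomLift (g ≫ x.map) (pullHom z u ≫ θ)) (h₁ : Acts θ (s ≫ u) b d),
      Acts ((piEvaluation x).ev (c := z.pull u) g (pullHom z u ≫ θ) h) s b
        (pullback.lift s d h₁.map.symm) := fun hs h h₁ =>
    piEvaluation_acts h hs (h₁.comp rfl
      (pullHom_acts z u (pullback.lift_fst _ _ _) (pullback.lift_snd _ _ _)))
  refine hom_ext_of_exists (hθ.trans hθ'.symm) (fun {T} a b h₀ => ?_)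
    fun {T} a b d c χ h₁ h₂ hχ => ?_
  · rw [hθ] at h₀
    obtain ⟨s, rfl, hs⟩ := key h₀
    have h₁ := acts_app θ (hθ.symm ▸ h₀)
    have h₂ := acts_app θ' (hθ'.symm ▸ h₀)
    have := acts hs h h₁
    rw [e] at this
    have := congrArg (· ≫ pullback.snd u z.map) (this.unique (acts hs h' h₂))
    simp only [pullback.lift_snd] at this
    exact ⟨_, h₁, this ▸ h₂⟩
  · obtain ⟨s, rfl, hs⟩ := key (hθ ▸ h₁.w)
    obtain ⟨χ', hχ', rfl⟩ := exists_factor (f := pullback.lift s d h₁.map.symm)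
      (isStronglyCartesian_cart q (pullback.snd u z.map) z.obj) (pullback.lift_snd _ _ _).symm hχ
    have hp := pullHom_sends z u (pullback.lift_fst s d h₁.map.symm)
      (pullback.lift_snd s d h₁.map.symm) hχ'
    obtain ⟨η, hη, hs₁⟩ := h₁.exists_sends hχ
    obtain ⟨η', hη', hs₂⟩ := h₂.exists_sends hχ
    have e₁ := piEvaluation_sends h hs (Sends.comp h₁ rfl hp hs₁)
    have e₂ := piEvaluation_sends h' hs (Sends.comp h₂ rfl hp hs₂)
    rw [e] at e₁
    obtain rfl := e₁.unique e₂
    exact ⟨η, hs₁, hs₂⟩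

end Product

lemma piEvaluation_isProduct (x : PiObj F q) : (piEvaluation x).IsProduct where
  existsUnique {I K u g f} sq {z U ξ} hξ {t} ht := by
    obtain rfl : z.base = I := IsHomLift.codomain_eq (piCompletion F q) u ξ
    obtain ⟨i, h₁, h₂, h₃, h₄⟩ := exists_cartesian_iso hξ (pullHom_isStronglyCartesian z u)
    have ht' : PiHom.base (i.inv ≫ t) = g :=
      isHomLift_iff.1 (isHomLift_comp h₂ ht (Category.id_comp _))
    have key : ∀ {θ : z ⟶ x} (h : (piCompletion F q).IsHomLift (g ≫ x.map) (ξ ≫ θ))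
        (h' : (piCompletion F q).IsHomLift (g ≫ x.map) (pullHom z u ≫ θ)),
        i.inv ≫ (piEvaluation x).ev g (ξ ≫ θ) h =
          (piEvaluation x).ev (c := z.pull u) g (pullHom z u ≫ θ) h' := fun h h' =>
      (piEvaluation x).comp_ev' h₂ h h' (Category.id_comp _) (by rw [← h₄, Category.assoc])
    have hl : ∀ {θ : z ⟶ x}, PiHom.base θ = f →
        (piCompletion F q).IsHomLift (g ≫ x.map) (pullHom z u ≫ θ) := fun hθ =>
      Evaluation.isHomLift_sq sq.w (pullHom_isStronglyCartesian z u) (isHomLift_iff.2 hθ)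
    refine ⟨(transposeFamily sq (i.inv ≫ t) ht').toHom, ⟨isHomLift_iff.2 rfl, fun h => ?_⟩, ?_⟩
    · rw [← cancel_epi i.inv, key h (hl rfl), piEvaluation_transpose]
    · rintro θ ⟨hθ, hθ'⟩
      have hb := isHomLift_iff.1 hθ
      refine piEvaluation_hom_ext sq hb rfl (hl hb) (hl rfl) ?_
      rw [piEvaluation_transpose, ← key (Evaluation.isHomLift_sq sq.w hξ hθ) (hl hb), hθ']

section Splitting

variable {x : PiObj F q} {K : B} {m : K ⟶ x.base} {d : K ⟶ x.dom}

lemma exists_pullHom_isRestriction (hd : d ≫ x.map = m) :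
    ∃ ρ : x.pull m ⟶ PiObj.unit ((reindex q d).obj x.obj),
      (piEvaluation x).IsRestriction (pullHom x m) d (unitHom d x.obj) ρ :=
  (piEvaluation x).exists_isRestriction_of_cartesian
    (by rw [hd]; exact (pullHom_isStronglyCartesian x m).toIsHomLift)
    (unitHom_isStronglyCartesian d x.obj)

section Restriction

variable {ρ : x.pull m ⟶ PiObj.unit ((reindex q d).obj x.obj)}
  (hρ : (piEvaluation x).IsRestriction (pullHom x m) d (unitHom d x.obj) ρ) {T : B} {a : T ⟶ K}

lemma restriction_base (hρ : (piEvaluation x).IsRestriction (pullHom x m) d (unitHom d x.obj) ρ) :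
    PiHom.base ρ = 𝟙 K :=
  isHomLift_iff.1 hρ.vertical

/-- ρ is known only through its composite with `unitHom`, which is an evaluation of `pullHom`.
Comparing the actions of the two shows that ρ acts at a as the section (1, d) does. -/
lemma restriction_acts (hρ : (piEvaluation x).IsRestriction (pullHom x m) d (unitHom d x.obj) ρ)
    {e : T ⟶ pullback m x.map} (he₁ : e ≫ pullback.fst m x.map = a)
    (he₂ : e ≫ pullback.snd m x.map = a ≫ d) : Acts ρ a a e := by
  have h : a ≫ PiHom.base ρ = a ≫ 𝟙 K := by rw [restriction_base hρ]
  have h₁ := acts_app ρ h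
  have h₂ := (unitHom_acts (F := F) d x.obj rfl).comp (h.trans (Category.comp_id _)) h₁
  rw [hρ.fac] at h₂
  rwa [h₂.unique (piEvaluation_acts hρ.isHomLift rfl (pullHom_acts x m he₁ he₂))] at h₁

lemma restriction_sends (hρ : (piEvaluation x).IsRestriction (pullHom x m) d (unitHom d x.obj) ρ)
    {e : T ⟶ pullback m x.map} (he₁ : e ≫ pullback.fst m x.map = a)
    (he₂ : e ≫ pullback.snd m x.map = a ≫ d) {c : E}
    {θ : c ⟶ tot ((reindex q (pullback.snd m x.map)).obj x.obj)} (hθ : q.IsHomLift e θ)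
    {η : c ⟶ tot ((reindex q d).obj x.obj)} (hη : q.IsHomLift a η)
    (h : θ ≫ cart q _ _ = η ≫ cart q _ _) : Sends ρ a a θ η := by
  have hb : a ≫ PiHom.base ρ = a := by rw [restriction_base hρ]; exact Category.comp_id _
  obtain ⟨η', hη', hs⟩ := (restriction_acts hρ he₁ he₂).exists_sends hθ
  have h₂ := Sends.comp (unitHom_acts (F := F) d x.obj rfl) hb hs
    (unitHom_sends (F := F) d x.obj rfl hη')
  rw [hρ.fac] at h₂
  have h₃ := h₂.unique (piEvaluation_sends hρ.isHomLift rfl (pullHom_sends x m he₁ he₂ hθ))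
  rwa [← cartesian_hom_ext (isStronglyCartesian_cart q d x.obj) hη' hη (h₃.trans h)]

end Restriction

section Descend

variable {A : B} {β : q.Fiber A} {n : K ⟶ A} (h : x.pull m ⟶ PiObj.unit β)
  (hh : PiHom.base h = n)

/-- The section determined by a morphism into an object `(𝟙, β)`. -/
def sectionOf : K ⟶ x.dom :=
  PiHom.app h (𝟙 K) n (by rw [hh]; exact (Category.id_comp _).trans (Category.comp_id _).symm) ≫
    pullback.snd m x.map

lemma sectionOf_map : sectionOf h hh ≫ x.map = m := by
  rw [sectionOf, Category.assoc, ← pullback.condition, ← Category.assoc]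
  exact (congrArg (· ≫ m) (PiHom.app_map h _ _ _)).trans (Category.id_comp _)

/-- With a unit object as codomain, a point (a, b) has b = `a ≫ n`. It is thus the restriction along
a of the generic point (1, n), whose action defines the section. -/
lemma Acts.comp_snd_eq {h : x.pull m ⟶ PiObj.unit β} (hh : PiHom.base h = n) {T : B} {a : T ⟶ K}
    {b : T ⟶ A} {e : T ⟶ pullback m x.map} (H : Acts h a b e) :
    e ≫ pullback.snd m x.map = a ≫ sectionOf h hh := by
  have hb : a ≫ n = b := hh ▸ H.unit
  have h₁ := (acts_app h (a := 𝟙 K) (b := n)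
    (by rw [hh]; exact (Category.id_comp _).trans (Category.comp_id _).symm)).comp_left a
  rw [sectionOf, ← Category.assoc]
  congr 1
  refine H.unique (d' := a ≫ _) ?_
  rw [← hb]
  rwa [Category.comp_id] at h₁

/-- The factorisation of `h` through the restriction along its section. -/
def descendFamily : Family (PiObj.unit (F := F) ((reindex q (sectionOf h hh)).obj x.obj))
    (PiObj.unit β) n :=
  have cond {T : B} {a : T ⟶ K} {b : T ⟶ A} (w : a ≫ n = b ≫ 𝟙 A) :
      a ≫ PiHom.base h = b ≫ 𝟙 A := by rw [hh, w]
  have lift {T : B} {a : T ⟶ K} {b : T ⟶ A} (w : a ≫ n = b ≫ 𝟙 A) {c : E}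
      (θ : c ⟶ tot ((reindex q (sectionOf h hh)).obj x.obj)) (hθ : q.IsHomLift a θ) :=
    exists_factor (isStronglyCartesian_cart q (pullback.snd m x.map) x.obj)
      ((acts_app h (cond w)).comp_snd_eq hh).symm
      (isHomLift_comp hθ (isStronglyCartesian_cart q (sectionOf h hh) x.obj).toIsHomLift rfl)
  { app := fun a b w => a
    app_map := fun a b w => Category.comp_id a
    comp_app := fun r a b w w' => rfl
    push := fun a b w θ hθ => PiHom.push h a b (cond w) (lift w θ hθ).choose
      (lift w θ hθ).choose_spec.1
    push_isHomLift := fun a b w θ hθ => PiHom.push_isHomLift h _ b _ _ _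
    comp_push := fun r a b w w' χ hχ θ hθ hθ' => by
      refine PiHom.push_natural h r _ _ rfl rfl χ hχ _ _ _ _ ?_
      refine cartesian_hom_ext (isStronglyCartesian_cart q (pullback.snd m x.map) x.obj)
        (isHomLift_comp hχ (lift w θ hθ).choose_spec.1 rfl) ?_ ?_
      · rw [PiHom.app_natural h r (cond w) (cond w') rfl rfl]
        exact (lift w' _ hθ').choose_spec.1
      · rw [Category.assoc, (lift w θ hθ).choose_spec.2, (lift w' _ hθ').choose_spec.2,
          Category.assoc] }

lemma descendFamily_acts {T : B} {a : T ⟶ K} {b : T ⟶ A} (w : a ≫ n = b) :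
    Acts (descendFamily h hh).toHom a b a :=
  Family.acts _ (w.trans (Category.comp_id _).symm) rfl

lemma descendFamily_sends {T : B} {a : T ⟶ K} {b : T ⟶ A} {c : E}
    {θ : c ⟶ tot ((reindex q (pullback.snd m x.map)).obj x.obj)}
    {ζ : c ⟶ tot ((reindex q (sectionOf h hh)).obj x.obj)} (hζ : q.IsHomLift a ζ)
    (e : θ ≫ cart q _ _ = ζ ≫ cart q _ _) {η : c ⟶ tot β} (hs : Sends h a b θ η) :
    Sends (descendFamily h hh).toHom a b ζ η := by
  obtain ⟨w, hθ, rfl⟩ := hs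
  have w' : a ≫ n = b ≫ 𝟙 A := by rw [← hh, w]
  refine Family.sends _ w' hζ (PiHom.push_congr h _ _ rfl rfl _ _ ?_)
  have := exists_factor (isStronglyCartesian_cart q (pullback.snd m x.map) x.obj)
    ((acts_app h w).comp_snd_eq hh).symm
    (isHomLift_comp hζ (isStronglyCartesian_cart q (sectionOf h hh) x.obj).toIsHomLift rfl)
  exact cartesian_hom_ext (isStronglyCartesian_cart q (pullback.snd m x.map) x.obj)
    this.choose_spec.1 hθ (this.choose_spec.2.trans e.symm)

/-- Existence of splittings: h only acts at points lying on its section, where ρ identifies elements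
of pr₂^*α with elements of the reindexing along the section. -/
lemma restriction_descend {ρ : x.pull m ⟶ PiObj.unit ((reindex q (sectionOf h hh)).obj x.obj)}
    (hρ : (piEvaluation x).IsRestriction (pullHom x m) (sectionOf h hh)
      (unitHom (sectionOf h hh) x.obj) ρ) : ρ ≫ (descendFamily h hh).toHom = h := by
  have hb : PiHom.base ρ = 𝟙 K := restriction_base hρ
  have hn : PiHom.base (ρ ≫ (descendFamily h hh).toHom) = n :=
    (congrArg (· ≫ n) hb).trans (Category.id_comp n)
  refine hom_ext_of_exists (hn.trans hh.symm) (fun {T} a b w => ?_)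
    fun {T} a b d c θ _ h₂ hθ => ?_
  · have w' : a ≫ n = b := by rw [hn] at w; exact w.trans (Category.comp_id _)
    have h₁ := acts_app h (a := a) (b := b) (by rw [hh]; exact w'.trans (Category.comp_id _).symm)
    refine ⟨_, (descendFamily_acts h hh w').comp ?_ (restriction_acts hρ h₁.map
      (h₁.comp_snd_eq hh)), h₁⟩
    rw [hb]
    exact Category.comp_id _
  · have w' : a ≫ n = b := hh ▸ h₂.unit
    obtain ⟨η, hη, hs⟩ := h₂.exists_sends hθ
    have h₃ : q.IsHomLift (a ≫ sectionOf h hh) (θ ≫ cart q (pullback.snd m x.map) x.obj) :=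
      isHomLift_comp hθ (isStronglyCartesian_cart q _ _).toIsHomLift (h₂.comp_snd_eq hh)
    obtain ⟨ζ, hζ, e⟩ := exists_factor (isStronglyCartesian_cart q (sectionOf h hh) x.obj) rfl h₃
    refine ⟨η, Sends.comp (descendFamily_acts h hh w') ?_ (restriction_sends hρ h₂.map
      (h₂.comp_snd_eq hh) hθ hζ e.symm) (descendFamily_sends h hh hζ e.symm hs), hs⟩
    rw [hb]
    exact Category.comp_id _

end Descend

/-- An arrow t between unit objects has no freedom on points, being over the base on identities. So
the action of `ρ ≫ t` at the generic point is that of ρ, namely (1, d), and the section is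
determined by the composite. -/
lemma sectionOf_restriction {A : B} {β : q.Fiber A} {n : K ⟶ A}
    {ρ : x.pull m ⟶ PiObj.unit ((reindex q d).obj x.obj)}
    (hρ : (piEvaluation x).IsRestriction (pullHom x m) d (unitHom d x.obj) ρ)
    {t : PiObj.unit (F := F) ((reindex q d).obj x.obj) ⟶ PiObj.unit β}
    (h : PiHom.base (ρ ≫ t) = n) (ht : PiHom.base t = n) : sectionOf (ρ ≫ t) h = d := by
  have hd : d ≫ x.map = m :=
    isHomLift_unique hρ.isHomLift (pullHom_isStronglyCartesian x m).toIsHomLift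
  have h₁ : Acts t (𝟙 K) n (𝟙 K) := by
    have h₁ := acts_app t (a := 𝟙 K) (b := n)
      (by rw [ht]; exact (Category.id_comp _).trans (Category.comp_id _).symm)
    rwa [show PiHom.app t (𝟙 K) n _ = 𝟙 K from (Category.comp_id _).symm.trans h₁.map] at h₁
  have w : 𝟙 K ≫ m = d ≫ x.map := by rw [hd, Category.id_comp]
  have h₂ := restriction_acts hρ (a := 𝟙 K) (e := pullback.lift (𝟙 K) d w) (pullback.lift_fst _ _ _)
    ((pullback.lift_snd _ _ _).trans (Category.id_comp _).symm)
  have h₃ := h₁.comp (φ := ρ) (a := 𝟙 K)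
    (by rw [restriction_base hρ]; exact Category.comp_id _) h₂
  have := h₃.comp_snd_eq h
  rw [pullback.lift_snd, Category.id_comp] at this
  exact this.symm

/-- Every element of d^*α over e comes, through ρ, from an element of pr₂^*α over (e, `e ≫ d`). So t
can be read off from `ρ ≫ t`. -/
lemma restriction_hom_ext {A : B} {β : q.Fiber A} {n : K ⟶ A}
    {ρ : x.pull m ⟶ PiObj.unit ((reindex q d).obj x.obj)}
    (hρ : (piEvaluation x).IsRestriction (pullHom x m) d (unitHom d x.obj) ρ)
    {t t' : PiObj.unit (F := F) ((reindex q d).obj x.obj) ⟶ PiObj.unit β}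
    (ht : PiHom.base t = n) (ht' : PiHom.base t' = n) (h : ρ ≫ t = ρ ≫ t') : t = t' := by
  have hd : d ≫ x.map = m :=
    isHomLift_unique hρ.isHomLift (pullHom_isStronglyCartesian x m).toIsHomLift
  have key : ∀ {t : PiObj.unit (F := F) ((reindex q d).obj x.obj) ⟶ PiObj.unit β} {T : B}
      {a : T ⟶ K} {b : T ⟶ A}, a ≫ PiHom.base t = b ≫ 𝟙 A → Acts t a b a := by
    intro t T a b w
    have h₁ := acts_app t w
    rwa [show PiHom.app t a b w = a from (Category.comp_id _).symm.trans h₁.map] at h₁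
  refine hom_ext_of_exists (ht.trans ht'.symm) (fun {T} a b w => ⟨a, key w, key ?_⟩)
    fun {T} a b e c ζ h₁ h₂ hζ => ?_
  · rw [ht', ← ht]; exact w
  · obtain rfl := h₁.unique (key h₁.w)
    have w : e ≫ m = (e ≫ d) ≫ x.map := by rw [Category.assoc, hd]
    have hζ' : q.IsHomLift (e ≫ d) (ζ ≫ cart q d x.obj) :=
      isHomLift_comp hζ (isStronglyCartesian_cart q _ _).toIsHomLift rfl
    obtain ⟨θ, hθ, e'⟩ := exists_factor (f := pullback.lift e (e ≫ d) w)
      (isStronglyCartesian_cart q (pullback.snd m x.map) x.obj) (pullback.lift_snd _ _ _).symm hζ'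
    have hs := restriction_sends hρ (pullback.lift_fst _ _ _) (pullback.lift_snd _ _ _) hθ hζ e'
    have hb : e ≫ PiHom.base ρ = e := by rw [restriction_base hρ]; exact Category.comp_id _
    obtain ⟨η, hη, hs₁⟩ := h₁.exists_sends hζ
    obtain ⟨η', hη', hs₂⟩ := h₂.exists_sends hζ
    have e₁ := Sends.comp h₁ hb hs hs₁
    have e₂ := Sends.comp h₂ hb hs hs₂
    rw [h] at e₁
    obtain rfl := e₁.unique e₂
    exact ⟨η, hs₁, hs₂⟩

/-- For a codomain (1_A, β) the pullback in the definition of an arrow is K itself, so an arrow from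
m^*x is a section of the pulled back display map and an arrow out of the reindexing of α along it.
This is the splitting, and nothing else enters. -/
lemma piEvaluation_hasUniqueSplitting {x Q : PiObj F q} {K : B} {m : K ⟶ x.base} {k : Q ⟶ x}
    (hk : (piCompletion F q).IsStronglyCartesian m k) {A : B} (β : q.Fiber A) :
    (piEvaluation x).HasUniqueSplitting K k (PiObj.unit β) := by
  obtain ⟨i, h₁, -, h₃, -⟩ := exists_cartesian_iso hk (pullHom_isStronglyCartesian x m)
  refine .of_iso_comp i h₁ h₃ ?_
  have hd : ∀ {d : K ⟶ x.dom}, (piCompletion F q).IsHomLift (d ≫ x.map) (pullHom x m) →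
      d ≫ x.map = m := fun h =>
    isHomLift_unique h (pullHom_isStronglyCartesian x m).toIsHomLift
  choose ρ hρ using fun (d : K ⟶ x.dom)
    (h : (piCompletion F q).IsHomLift (d ≫ x.map) (pullHom x m)) =>
      exists_pullHom_isRestriction (hd h)
  have hcod : ∀ {S : B} {n : K ⟶ S} {y : PiObj F q} {h : y ⟶ PiObj.unit β},
      (piCompletion F q).IsHomLift n h → A = S := fun {S n y h} _ =>
    IsHomLift.codomain_eq (piCompletion F q) n h
  refine .of_restrictions (ρ := ρ) hρ (fun {S n h} hh => ?_)
    (fun {S n d d' hd hd' t t'} ht ht' h => ?_) fun {S n d hd t t'} ht ht' h => ?_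
  · obtain rfl := hcod hh
    have hh' := isHomLift_iff.1 hh
    have hs : (piCompletion F q).IsHomLift (sectionOf h hh' ≫ x.map) (pullHom x m) := by
      rw [sectionOf_map]; exact (pullHom_isStronglyCartesian x m).toIsHomLift
    exact ⟨sectionOf h hh', hs, (descendFamily h hh').toHom, isHomLift_iff.2 rfl,
      restriction_descend h hh' (hρ _ hs)⟩
  · obtain rfl := hcod ht
    have hb := isHomLift_iff.1 (isHomLift_comp (hρ d hd).vertical ht (Category.id_comp _))
    have hb' := isHomLift_iff.1 (isHomLift_comp (hρ d' hd').vertical ht' (Category.id_comp _))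
    rw [← sectionOf_restriction (hρ d hd) hb (isHomLift_iff.1 ht),
      ← sectionOf_restriction (hρ d' hd') hb' (isHomLift_iff.1 ht')]
    simp only [h]
  · obtain rfl := hcod ht
    exact restriction_hom_ext (hρ d hd) (isHomLift_iff.1 ht) (isHomLift_iff.1 ht') h

end Splitting

end PiHom

end FibredProducts

/-! ### Transport along an equivalence, and enough quantifier-free objects -/

namespace FibredProducts

variable {B : Type u₁} [Category.{v₁} B]

section Transport

variable {E : Type u₂} [Category.{v₂} E] {D : Type u₃} [Category.{v₃} D] {p : E ⥤ B} {r : D ⥤ B}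
  {L : E ⥤ D}

lemma isHomLift_map_iff (hL : L ⋙ r = p) {R S : B} {f : R ⟶ S} {a b : E} {φ : a ⟶ b} :
    r.IsHomLift f (L.map φ) ↔ p.IsHomLift f φ := by
  subst hL
  constructor
  · intro h
    exact IsHomLift.of_fac (L ⋙ r) f φ (IsHomLift.domain_eq r f (L.map φ))
      (IsHomLift.codomain_eq r f (L.map φ)) (IsHomLift.fac r f (L.map φ))
  · rintro ⟨⟩
    exact IsHomLift.map r (L.map φ)

lemma isStronglyCartesian_comp_iso {R S : B} {f : R ⟶ S} {a b c : E} {φ : a ⟶ b}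
    (hφ : p.IsStronglyCartesian f φ) (i : b ≅ c) (hi : p.IsHomLift (𝟙 S) i.hom) :
    p.IsStronglyCartesian f (φ ≫ i.hom) := by
  have h : p.IsStronglyCartesian (f ≫ 𝟙 S) (φ ≫ i.hom) := inferInstance
  rwa [Category.comp_id] at h

namespace Evaluation

variable {A J : B} {v : A ⟶ J} {P' β' : D} (e : Evaluation r v P' β') {P β : E}

/-- The transport of an evaluation along a fully faithful functor over the base. -/
def transport [L.Full] [L.Faithful] (hL : L ⋙ r = p) (i : L.obj P ≅ P')
    (hi : r.IsHomLift (𝟙 J) i.hom) (j : L.obj β ≅ β') (hj : r.IsHomLift (𝟙 A) j.hom) :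
    Evaluation p v P β where
  ev b θ h := L.preimage (e.ev b (L.map θ ≫ i.hom)
    (isHomLift_comp ((isHomLift_map_iff hL).2 h) hi (Category.comp_id _)) ≫ j.inv)
  isHomLift b θ h := by
    have hj' : r.IsHomLift (𝟙 A) j.inv := inferInstance
    rw [← isHomLift_map_iff hL, L.map_preimage]
    exact isHomLift_comp (e.isHomLift _ _ _) hj' (Category.comp_id _)
  comp_ev s b χ hχ θ h h' := by
    apply L.map_injective
    rw [L.map_comp, L.map_preimage, L.map_preimage, ← Category.assoc]
    congr 1
    exact e.comp_ev' ((isHomLift_map_iff hL).2 hχ) _ _ rfl (by simp)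

variable {e} [L.Full] [L.Faithful] {hL : L ⋙ r = p} {i : L.obj P ≅ P'}
    {hi : r.IsHomLift (𝟙 J) i.hom} {j : L.obj β ≅ β'} {hj : r.IsHomLift (𝟙 A) j.hom}

lemma map_transport_ev {T : B} {c : E} {b : T ⟶ A} {θ : c ⟶ P} (h : p.IsHomLift (b ≫ v) θ)
    (h' : r.IsHomLift (b ≫ v) (L.map θ ≫ i.hom)) :
    L.map ((e.transport hL i hi j hj).ev b θ h) ≫ j.hom = e.ev b (L.map θ ≫ i.hom) h' := by
  change L.map (L.preimage _) ≫ _ = _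
  simp

lemma IsProduct.transport (hcart : ∀ {R S : B} {f : R ⟶ S} {a b : E} {φ : a ⟶ b},
    p.IsStronglyCartesian f φ → r.IsStronglyCartesian f (L.map φ))
    (he : e.IsProduct) : (e.transport hL i hi j hj).IsProduct where
  existsUnique {I K u g f} sq {X U ξ} hξ {t} ht := by
    have hi' : r.IsHomLift (𝟙 J) i.inv := inferInstance
    obtain ⟨θ, ⟨hθ, hθ'⟩, hu⟩ := he.existsUnique sq (hcart hξ)
      (isHomLift_comp ((isHomLift_map_iff hL).2 ht) hj (Category.comp_id _))
    have hp : p.IsHomLift f (L.preimage (θ ≫ i.inv)) := by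
      rw [← isHomLift_map_iff hL, L.map_preimage]
      exact isHomLift_comp hθ hi' (Category.comp_id _)
    have hl : ∀ {θ : X ⟶ P}, p.IsHomLift f θ →
        r.IsHomLift (g ≫ v) (L.map (ξ ≫ θ) ≫ i.hom) := fun h =>
      isHomLift_comp ((isHomLift_map_iff hL).2 (isHomLift_sq sq.w hξ h)) hi (Category.comp_id _)
    refine ⟨L.preimage (θ ≫ i.inv), ⟨hp, fun h => ?_⟩, ?_⟩
    · apply L.map_injective
      rw [← cancel_mono j.hom, map_transport_ev h (hl hp),
        ← hθ' (isHomLift_sq sq.w (hcart hξ) hθ)]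
      exact e.ev_congr _ _ rfl (by simp)
    · rintro θ' ⟨h, h'⟩
      apply L.map_injective
      rw [L.map_preimage, Iso.eq_comp_inv]
      refine hu _
        ⟨isHomLift_comp ((isHomLift_map_iff hL).2 h) hi (Category.comp_id _), fun h₁ => ?_⟩
      rw [← h' (isHomLift_sq sq.w hξ h), map_transport_ev _ (hl h)]
      exact e.ev_congr _ _ rfl (by simp)

lemma HasUniqueSplitting.transport [p.IsFibered]
    (hcart : ∀ {R S : B} {f : R ⟶ S} {a b : E} {φ : a ⟶ b},
    p.IsStronglyCartesian f φ → r.IsStronglyCartesian f (L.map φ))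
    (hβ : p.obj β = A) {K : B} {Q α : E} {k : Q ⟶ P}
    {S : B} {α' : D} (l : L.obj α ≅ α') (hl : r.IsHomLift (𝟙 S) l.hom)
    (H : e.HasUniqueSplitting K (L.map k ≫ i.hom) α') :
    (e.transport hL i hi j hj).HasUniqueSplitting K k α := by
  have hl' : r.IsHomLift (𝟙 S) l.inv := inferInstance
  have hi' : r.IsHomLift (𝟙 J) i.inv := inferInstance
  have key : ∀ {d : K ⟶ A} {R : E} {m : R ⟶ β} {ρ : Q ⟶ R},
      (e.transport hL i hi j hj).IsRestriction k d m ρ →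
      e.IsRestriction (L.map k ≫ i.hom) d (L.map m ≫ j.hom) (L.map ρ) := fun hρ =>
    have h := isHomLift_comp ((isHomLift_map_iff hL).2 hρ.isHomLift) hi (Category.comp_id _)
    ⟨h, isStronglyCartesian_comp_iso (hcart hρ.cartesian) j hj,
      (isHomLift_map_iff hL).2 hρ.vertical, by
        rw [← map_transport_ev hρ.isHomLift h, ← Category.assoc, ← L.map_comp, hρ.fac]⟩
  have hcod : ∀ {T S' : B} {n : T ⟶ S'} {c : E} {t : c ⟶ α}, p.IsHomLift n t → S = S' :=
    fun {T S' n c t} h => by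
      have h := (isHomLift_map_iff hL).2 h
      exact (IsHomLift.domain_eq r (𝟙 S) l.hom).symm.trans (IsHomLift.codomain_eq r n (L.map t))
  have hmap : ∀ {T : B} {n : T ⟶ S} {c : E} {t : c ⟶ α}, p.IsHomLift n t →
      r.IsHomLift n (L.map t ≫ l.hom) := fun h =>
    isHomLift_comp ((isHomLift_map_iff hL).2 h) hl (Category.comp_id _)
  refine ⟨fun {S' n h} hh => ?_, fun {S' n d d' R R' m m' ρ ρ'} hρ hρ' {t t'} ht ht' h => ?_,
    fun {S' n d R m ρ} hρ {t t'} ht ht' h => ?_⟩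
  · obtain rfl := hcod hh
    obtain ⟨d, R', m', ρ', t, hρ', ht, h⟩ := H.exists_fac (hmap hh)
    have hk : p.IsHomLift (d ≫ v) k := by
      have := isHomLift_comp hρ'.isHomLift hi' (Category.comp_id _)
      rw [Category.assoc, i.hom_inv_id, Category.comp_id] at this
      exact (isHomLift_map_iff hL).1 this
    -- The intermediate object R' need not be in the image of L; it is replaced by the image of a
    -- restriction taken in E, after which fullness applies.
    obtain ⟨R, m, ρ, hρ⟩ := (e.transport hL i hi j hj).exists_isRestriction hβ hk
    obtain ⟨s, hs, hs'⟩ := hρ'.exists_transfer (key hρ) ht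
    refine ⟨d, R, m, ρ, L.preimage (s ≫ l.inv), hρ, ?_, ?_⟩
    · rw [← isHomLift_map_iff hL, L.map_preimage]
      exact isHomLift_comp hs hl' (Category.comp_id _)
    · apply L.map_injective
      rw [L.map_comp, L.map_preimage, ← Category.assoc, hs', h]
      simp
  · obtain rfl := hcod ht
    exact H.section_unique (key hρ) (key hρ') (hmap ht) (hmap ht')
      (by rw [← Category.assoc, ← L.map_comp, h, L.map_comp, Category.assoc])
  · obtain rfl := hcod ht
    apply L.map_injective
    rw [← cancel_mono l.hom]
    exact H.hom_ext (key hρ) (hmap ht) (hmap ht')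
      (by rw [← Category.assoc, ← L.map_comp, h, L.map_comp, Category.assoc])

end Evaluation

end Transport

variable {E : Type u₂} [Category.{v₂} E] {E' : Type u₃} [Category.{v₃} E'] {F : MorphismProperty B}
  [IsDisplayMapClass F] [F.ContainsIdentities] {p : E ⥤ B} [p.IsFibered] {q : E' ⥤ B} [q.IsFibered]

/-- A fibration equivalent to a product completion has enough quantifier-free objects. -/
theorem FibredEquivalence.hasEnoughQuantifierFree [HasFibredProducts F p]
    (hF : F.IsStableUnderComposition) (eqv : FibredEquivalence p (piCompletion F q)) :
    HasEnoughQuantifierFree F p := by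
  let L := eqv.equiv.functor
  have hL : L ⋙ piCompletion F q = p := eqv.functor_comp
  have hcart : ∀ {R S : B} {f : R ⟶ S} {a b : E} {φ : a ⟶ b}, p.IsStronglyCartesian f φ →
      (piCompletion F q).IsStronglyCartesian f (L.map φ) := fun {R S f a b φ} h =>
    eqv.functor_cartesian f φ h
  have hsurj : ∀ (y : PiObj F q), ∃ (X : E) (i : L.obj X ≅ y),
      (piCompletion F q).IsHomLift (𝟙 y.base) i.hom ∧ p.obj X = y.base := fun y =>
    ⟨eqv.equiv.inverse.obj y, eqv.equiv.counitIso.app y, eqv.counit_vertical y,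
      Functor.congr_obj eqv.inverse_comp y⟩
  refine hasEnoughQuantifierFree_of_class hF
    (fun α => ∃ (A : B) (γ : q.Fiber A) (j : L.obj α ≅ PiObj.unit γ),
      (piCompletion F q).IsHomLift (𝟙 A) j.hom) (fun X => ?_) ?_
  · obtain ⟨β, j, hj, hβ⟩ := hsurj (PiObj.unit (L.obj X).obj)
    have hi : (piCompletion F q).IsHomLift (𝟙 (L.obj X).base) (Iso.refl (L.obj X)).hom :=
      PiHom.isHomLift_iff.2 rfl
    exact ⟨_, _, (L.obj X).map, β, (PiHom.piEvaluation (L.obj X)).transport hL (Iso.refl _) hi j hj,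
      (L.obj X).display, ⟨_, _, j, hj⟩, (Functor.congr_obj hL X).symm, hβ,
      .transport hcart (PiHom.piEvaluation_isProduct _)⟩
  · rintro α β ⟨S, γ, l, hl⟩ ⟨A₁, δ, j, hj⟩ A J v hv hβ P e he K m Q k hk
    obtain rfl : A₁ = A := by
      rw [← hβ, ← hL]
      exact (IsHomLift.domain_eq (piCompletion F q) (𝟙 A₁) j.hom).symm
    -- The given product of β along v is compared with the transport of (v, δ), the corresponding
    -- product in the completion. Uniqueness of products then carries the splittings over.
    let x : PiObj F q := ⟨J, A₁, v, hv, δ⟩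
    obtain ⟨X, i, hi, hX⟩ := hsurj x
    have he' : ((PiHom.piEvaluation x).transport hL i hi j hj).IsProduct :=
      .transport hcart (PiHom.piEvaluation_isProduct x)
    have hP : p.obj P = J := IsHomLift.codomain_eq p m k
    obtain ⟨a, h₁, -, h₃⟩ := he.exists_iso he' hP hX
    refine .of_iso a h₁ h₃ (.transport hcart hβ l hl ?_)
    refine PiHom.piEvaluation_hasUniqueSplitting (x := x) (m := m)
      (isStronglyCartesian_comp_iso (hcart ?_) i hi) γ
    exact isStronglyCartesian_comp_iso hk a h₁

end FibredProducts

/-! ### Fibred equivalences from fully faithful functors over the base -/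

namespace FibredProducts

variable {B : Type u₁} [Category.{v₁} B]

section FullyFaithful

variable {E : Type u₂} [Category.{v₂} E] {D : Type u₃} [Category.{v₃} D] {p : E ⥤ B} {r : D ⥤ B}
  {L : E ⥤ D}

lemma isStronglyCartesian_of_map [L.Full] [L.Faithful] (hL : L ⋙ r = p) {R S : B} {f : R ⟶ S}
    {a b : E} {φ : a ⟶ b} (hφ : r.IsStronglyCartesian f (L.map φ)) :
    p.IsStronglyCartesian f φ where
  toIsHomLift := (isHomLift_map_iff hL).1 hφ.toIsHomLift
  universal_property' {c} g ψ hψ := by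
    obtain ⟨χ, hχ, e⟩ := exists_factor hφ rfl ((isHomLift_map_iff hL).2 hψ)
    refine ⟨L.preimage χ, ⟨?_, L.map_injective (by simpa using e)⟩, ?_⟩
    · rwa [← isHomLift_map_iff hL, L.map_preimage]
    · rintro χ' ⟨h, e'⟩
      apply L.map_injective
      rw [L.map_preimage]
      exact cartesian_hom_ext hφ ((isHomLift_map_iff hL).2 h) hχ (by rw [e, ← e', L.map_comp])

lemma isStronglyCartesian_iso_comp {R S : B} {f : R ⟶ S} {a b c : E} {φ : b ⟶ c}
    (hφ : p.IsStronglyCartesian f φ) (i : a ≅ b) (hi : p.IsHomLift (𝟙 R) i.hom) :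
    p.IsStronglyCartesian f (i.hom ≫ φ) := by
  have h : p.IsStronglyCartesian (𝟙 R ≫ f) (i.hom ≫ φ) := inferInstance
  rwa [Category.id_comp] at h

lemma isStronglyCartesian_conj {R S : B} {f : R ⟶ S} {a b a' b' : E} {φ : a ⟶ b}
    (hφ : p.IsStronglyCartesian f φ) (i : a' ≅ a) (j : b' ≅ b)
    (hi : p.IsHomLift (𝟙 (p.obj a')) i.hom) (hj : p.IsHomLift (𝟙 (p.obj b')) j.hom) :
    p.IsStronglyCartesian f (i.hom ≫ φ ≫ j.inv) := by
  obtain rfl : p.obj a = R := IsHomLift.domain_eq p f φ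
  obtain rfl : p.obj b = S := IsHomLift.codomain_eq p f φ
  have ha : p.obj a = p.obj a' := IsHomLift.codomain_eq p (𝟙 _) i.hom
  have hb : p.obj b = p.obj b' := IsHomLift.codomain_eq p (𝟙 _) j.hom
  rw [← ha] at hi
  rw [← hb] at hj
  exact isStronglyCartesian_iso_comp (isStronglyCartesian_comp_iso hφ j.symm
    (inferInstanceAs (p.IsHomLift (𝟙 _) j.inv))) i hi

/-- A fully faithful functor over the base that is vertically essentially surjective is part of a
fibred equivalence. -/
theorem nonempty_fibredEquivalence (K : D ⥤ E) [K.Full] [K.Faithful] (hK : K ⋙ p = r)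
    (hsurj : ∀ X : E, ∃ (Y : D) (i : K.obj Y ≅ X), p.IsHomLift (𝟙 (p.obj X)) i.hom) :
    Nonempty (FibredEquivalence p r) := by
  choose Y i hi using hsurj
  have hi' : ∀ X, p.IsHomLift (𝟙 (p.obj X)) (i X).inv := fun X => inferInstance
  have hY : ∀ X, p.obj (K.obj (Y X)) = p.obj X := fun X =>
    IsHomLift.domain_eq p (𝟙 _) (i X).hom
  have hi₂ : ∀ X, p.IsHomLift (𝟙 (p.obj (K.obj (Y X)))) (i X).hom := fun X => by
    rw [hY]; exact hi X
  let N : E ⥤ D :=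
    { obj := Y
      map := fun {X X'} φ => K.preimage ((i X).hom ≫ φ ≫ (i X').inv)
      map_id := fun X => K.map_injective (by simp)
      map_comp := fun φ ψ => K.map_injective (by simp) }
  have hmap : ∀ {X X' : E} (φ : X ⟶ X'), K.map (N.map φ) = (i X).hom ≫ φ ≫ (i X').inv :=
    fun φ => K.map_preimage _
  let eqv : E ≌ D :=
    { functor := N
      inverse := K
      unitIso := NatIso.ofComponents (fun X => (i X).symm) (fun φ => by
        change φ ≫ (i _).inv = (i _).inv ≫ K.map (N.map φ)
        rw [hmap]; simp)
      counitIso := NatIso.ofComponents (fun X => K.preimageIso (i (K.obj X)))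
        (fun φ => K.map_injective (by
          change K.map (N.map (K.map φ) ≫ K.preimage _) = K.map (K.preimage _ ≫ φ)
          rw [K.map_comp, K.map_comp, hmap]
          simp))
      functor_unitIso_comp := fun X => K.map_injective (by
        change K.map (N.map (i X).inv ≫ K.preimage _) = K.map (𝟙 (Y X))
        rw [K.map_comp, hmap, K.map_preimage, K.map_id]
        simp [N]) }
  have hN : N ⋙ r = p := by
    subst hK
    refine CategoryTheory.Functor.ext (fun X => hY X) fun X X' φ => ?_
    change p.map (K.map (N.map φ)) = _
    rw [hmap]
    have _ := isHomLift_comp (hi X) (isHomLift_comp (IsHomLift.map p φ) (hi' X')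
      (Category.comp_id _)) (Category.id_comp _)
    exact IsHomLift.fac' p (p.map φ) _
  have : N.Full := eqv.full_functor
  have : N.Faithful := eqv.faithful_functor
  have hc : ∀ X : D, r.IsHomLift (𝟙 (r.obj X)) (K.preimage (i (K.obj X)).hom) := fun X => by
    rw [← isHomLift_map_iff hK, K.map_preimage]
    have := hi (K.obj X)
    subst hK
    exact this
  -- A fully faithful functor over B reflects cartesian arrows, and `K.map (N.map φ)` is φ
  -- conjugated by vertical isomorphisms. So N preserves them; exchanging the roles of K and N gives
  -- preservation by K.
  have hNcart : ∀ {I J : B} (u : I ⟶ J) {X X' : E} (φ : X ⟶ X'), p.IsStronglyCartesian u φ →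
      r.IsStronglyCartesian u (N.map φ) := fun u X X' φ h => by
    refine isStronglyCartesian_of_map hK ?_
    rw [hmap]
    exact isStronglyCartesian_conj h _ _ (hi₂ X) (hi₂ X')
  refine ⟨⟨eqv, hN, hK, hNcart, fun u X X' φ h => ?_, fun X => hi' X, fun X => hc X⟩⟩
  refine isStronglyCartesian_of_map (L := N) hN ?_
  have hr : ∀ X : D, r.obj (Y (K.obj X)) = r.obj X := fun X => by
    subst hK; exact hY (K.obj X)
  have hj : ∀ X : D, r.IsHomLift (𝟙 (r.obj (Y (K.obj X)))) (K.preimageIso (i (K.obj X))).hom :=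
    fun X => by rw [hr]; exact hc X
  convert isStronglyCartesian_conj h _ _ (hj X) (hj X') using 1
  apply K.map_injective
  rw [hmap]
  simp only [Functor.map_comp, Functor.preimageIso_hom, Functor.preimageIso_inv,
    Functor.map_preimage]
  rfl

end FullyFaithful

end FibredProducts

/-! ### Arrows of the product completion as arrows between products -/

namespace FibredProducts

variable {B : Type u₁} [Category.{v₁} B]

namespace PiHom

variable {F : MorphismProperty B} [IsDisplayMapClass F] {E : Type u₂} [Category.{v₂} E]
  {D : Type u₃} [Category.{v₃} D] {p : E ⥤ B} {q : D ⥤ B} [q.IsFibered] {x y z : PiObj F q}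

section Arrow

/-- The arrow `dom^* α ⟶ β` over `pr₂` given by the vertical component of `φ`. -/
def arrow (φ : x ⟶ y) : tot ((reindex q (PiHom.dom φ)).obj x.obj) ⟶ tot y.obj :=
  totMap (PiHom.vert φ) ≫ cart q (pullback.snd (PiHom.base φ) y.map) y.obj

lemma arrow_isHomLift (φ : x ⟶ y) : q.IsHomLift (pullback.snd (PiHom.base φ) y.map) (arrow φ) :=
  isHomLift_comp inferInstance (isStronglyCartesian_cart q _ _).toIsHomLift (Category.id_comp _)

lemma arrow_ofArrow (f : x.base ⟶ y.base) (d : pullback f y.map ⟶ x.dom)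
    (w : d ≫ x.map = pullback.fst f y.map) (t : tot ((reindex q d).obj x.obj) ⟶ tot y.obj)
    (ht : q.IsHomLift (pullback.snd f y.map) t) : arrow (x := x) (ofArrow f d w t ht) = t :=
  toReindex_cart q _ _ _

lemma ext_arrow {f : x.base ⟶ y.base} {d : pullback f y.map ⟶ x.dom}
    {w w' : d ≫ x.map = pullback.fst f y.map}
    {t t' : (reindex q d).obj x.obj ⟶ (reindex q (pullback.snd f y.map)).obj y.obj}
    (h : arrow (x := x) (PiHom.mk f d w t) = arrow (x := x) (PiHom.mk f d w' t')) :
    (PiHom.mk f d w t : PiHom x y) = PiHom.mk f d w' t' := by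
  obtain rfl : t = t' := reindex_hom_ext _ h
  rfl

end Arrow

section SendsAlong

variable (L : D ⥤ E)

/-- The extension of `Sends` along a functor `L` to generalised elements in the codomain of `L`:
the action of `φ` at `(a, b)` sends `θ : c ⟶ L α` to `η : c ⟶ L β`. -/
def SendsAlong (p : E ⥤ B) (φ : x ⟶ y) {T : B} (a : T ⟶ x.base) (b : T ⟶ y.dom) {c : E}
    (θ : c ⟶ L.obj (tot x.obj)) (η : c ⟶ L.obj (tot y.obj)) : Prop :=
  ∃ (h : a ≫ PiHom.base φ = b ≫ y.map) (ζ : c ⟶ L.obj (tot ((reindex q (PiHom.dom φ)).obj x.obj))),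
    p.IsHomLift (pullback.lift a b h) ζ ∧ ζ ≫ L.map (cart q (PiHom.dom φ) x.obj) = θ ∧
      ζ ≫ L.map (arrow φ) = η

variable {L} {φ : x ⟶ y} {T : B} {a : T ⟶ x.base} {b : T ⟶ y.dom} {c : E}
  {θ : c ⟶ L.obj (tot x.obj)} {η η' : c ⟶ L.obj (tot y.obj)}

lemma SendsAlong.comp_left (h : SendsAlong L p φ a b θ η) {T' : B} {r : T' ⟶ T} {c' : E}
    {χ : c' ⟶ c} (hχ : p.IsHomLift r χ) {a' : T' ⟶ x.base} {b' : T' ⟶ y.dom} (ha : r ≫ a = a')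
    (hb : r ≫ b = b') : SendsAlong L p φ a' b' (χ ≫ θ) (χ ≫ η) := by
  obtain ⟨h, ζ, hζ, rfl, rfl⟩ := h
  subst ha hb
  have h' : (r ≫ a) ≫ PiHom.base φ = (r ≫ b) ≫ y.map := by
    rw [Category.assoc, h, Category.assoc]
  refine ⟨h', χ ≫ ζ, isHomLift_comp hχ hζ ?_, Category.assoc _ _ _, Category.assoc _ _ _⟩
  apply pullback.hom_ext <;> simp [pullback.lift_fst, pullback.lift_snd]

lemma Sends.sendsAlong (hL : L ⋙ p = q) {c : D} {θ : c ⟶ tot x.obj} {η : c ⟶ tot y.obj}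
    (h : Sends φ a b θ η) : SendsAlong L p φ a b (L.map θ) (L.map η) := by
  obtain ⟨h, hθ, rfl⟩ := h
  refine ⟨h, L.map (factor q (pullback.lift a b h) (PiHom.dom φ) (PiHom.app_def φ a b h) θ hθ), ?_,
    ?_, ?_⟩
  · exact (isHomLift_map_iff hL).2 (factor_isHomLift q _ _ _ _ _)
  · rw [← L.map_comp, factor_cart]
  · rw [← L.map_comp]
    rfl

/-- The generic case is the identity of `x.obj` at the point (`x.map`, 1); any θ over b is obtained
from it by precomposition. -/
lemma sendsAlong_id (hL : L ⋙ p = q) {a : T ⟶ x.base} {b : T ⟶ x.dom} (h : b ≫ x.map = a)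
    {θ : c ⟶ L.obj (tot x.obj)} (hθ : p.IsHomLift b θ) : SendsAlong L p (𝟙 x) a b θ θ := by
  have h₀ : x.map ≫ 𝟙 x.base = 𝟙 x.dom ≫ x.map := by simp
  have hid : q.IsHomLift (PiHom.app (𝟙 x) x.map (𝟙 x.dom) h₀) (𝟙 (tot x.obj)) := by
    rw [show PiHom.app (𝟙 x) x.map (𝟙 x.dom) h₀ = 𝟙 x.dom from PiHom.id_app x _ _ _]
    exact IsHomLift.id (tot_proj _)
  have hs : Sends (𝟙 x) x.map (𝟙 x.dom) (𝟙 (tot x.obj)) (𝟙 _) :=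
    ⟨h₀, hid, PiHom.id_push x _ _ _ _ _⟩
  have := (hs.sendsAlong hL).comp_left hθ h (Category.comp_id b)
  simpa using this

lemma SendsAlong.unique (hcart : ∀ {R S : B} {f : R ⟶ S} {a b : D} {φ : a ⟶ b},
      q.IsStronglyCartesian f φ → p.IsStronglyCartesian f (L.map φ))
    (h : SendsAlong L p φ a b θ η) (h' : SendsAlong L p φ a b θ η') : η = η' := by
  obtain ⟨h, ζ, hζ, rfl, rfl⟩ := h
  obtain ⟨_, ζ', hζ', e, rfl⟩ := h'
  rw [cartesian_hom_ext (hcart (isStronglyCartesian_cart q (PiHom.dom φ) x.obj)) hζ hζ' e.symm]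

/-- An element θ over d factors through the image under L of the chosen cartesian lift of d. For
that lift the claim is `Sends.comp`, and `comp_left` carries it to θ. -/
lemma SendsAlong.comp (hL : L ⋙ p = q) (hcart : ∀ {R S : B} {f : R ⟶ S} {a b : D} {φ : a ⟶ b},
      q.IsStronglyCartesian f φ → p.IsStronglyCartesian f (L.map φ))
    {ψ : y ⟶ z} {b : T ⟶ z.dom} {e : T ⟶ y.dom} {f : T ⟶ y.base} {ζ : c ⟶ L.obj (tot z.obj)}
    (he : Acts ψ f b e) (hf : a ≫ PiHom.base φ = f) {d : T ⟶ x.dom} (hd : Acts φ a e d)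
    (hθ : p.IsHomLift d θ) (h : SendsAlong L p φ a e θ η)
    (h' : SendsAlong L p ψ f b η ζ) : SendsAlong L p (φ ≫ ψ) a b θ ζ := by
  obtain ⟨χ, hχ, rfl⟩ := exists_factor (hcart (isStronglyCartesian_cart q d x.obj))
    (Category.id_comp d).symm hθ
  obtain ⟨η₀, hη₀, hs⟩ := hd.exists_sends (isStronglyCartesian_cart q d x.obj).toIsHomLift
  obtain ⟨ζ₀, hζ₀, hs'⟩ := he.exists_sends hη₀
  obtain rfl := h.unique hcart
    ((hs.sendsAlong hL).comp_left hχ (Category.id_comp _) (Category.id_comp _))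
  obtain rfl := h'.unique hcart
    ((hs'.sendsAlong hL).comp_left hχ (Category.id_comp _) (Category.id_comp _))
  exact ((Sends.comp he hf hs hs').sendsAlong hL).comp_left hχ (Category.id_comp _)
    (Category.id_comp _)

end SendsAlong

section Realisation

variable {L : D ⥤ E} {P : PiObj F q → E}
  (e : ∀ x : PiObj F q, Evaluation p x.map (P x) (L.obj (tot x.obj)))

/-- `Realises e φ θ` says that `θ : P x ⟶ P y` lies over the base of `φ` and acts on evaluations
as `φ` does. -/
structure Realises (φ : x ⟶ y) (θ : P x ⟶ P y) : Prop where
  isHomLift : p.IsHomLift (PiHom.base φ) θ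
  sendsAlong {T : B} {c : E} {a : T ⟶ x.base} {b : T ⟶ y.dom} {d : T ⟶ x.dom} {χ : c ⟶ P x}
    (hd : Acts φ a b d) (h : p.IsHomLift (d ≫ x.map) χ) (h' : p.IsHomLift (b ≫ y.map) (χ ≫ θ)) :
    SendsAlong L p φ a b ((e x).ev d χ h) ((e y).ev b (χ ≫ θ) h')

variable {e}

lemma realises_id (hL : L ⋙ p = q) (hP : p.obj (P x) = x.base) : Realises e (𝟙 x) (𝟙 (P x)) where
  isHomLift := IsHomLift.id hP
  sendsAlong {T c a b d χ} hd h h' := by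
    obtain rfl : b = d := by
      obtain ⟨w, rfl⟩ := hd
      exact (PiHom.id_app x a b w).symm
    convert sendsAlong_id hL hd.map ((e x).isHomLift b χ h) using 1
    exact (e x).ev_congr _ _ rfl (Category.comp_id _)

lemma Realises.comp (hL : L ⋙ p = q) (hcart : ∀ {R S : B} {f : R ⟶ S} {a b : D} {φ : a ⟶ b},
      q.IsStronglyCartesian f φ → p.IsStronglyCartesian f (L.map φ))
    {φ : x ⟶ y} {ψ : y ⟶ z} {θ : P x ⟶ P y} {θ' : P y ⟶ P z} (h : Realises e φ θ)
    (h' : Realises e ψ θ') : Realises e (φ ≫ ψ) (θ ≫ θ') where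
  isHomLift := isHomLift_comp h.isHomLift h'.isHomLift rfl
  sendsAlong {T c a b d χ} hd h₁ h₂ := by
    have w : (a ≫ PiHom.base φ) ≫ PiHom.base ψ = b ≫ z.map := (Category.assoc _ _ _).trans hd.w
    have hs := acts_app ψ w
    have hs' := acts_app φ hs.map.symm
    obtain rfl := hd.unique (hs.comp rfl hs')
    have h₃ : p.IsHomLift (PiHom.app ψ _ b w ≫ y.map) (χ ≫ θ) :=
      isHomLift_comp h₁ h.isHomLift ((congrArg (· ≫ PiHom.base φ) hs'.map).trans hs.map.symm)
    have h₄ : p.IsHomLift (b ≫ z.map) ((χ ≫ θ) ≫ θ') := by rwa [Category.assoc]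
    rw [(e z).ev_congr h₂ h₄ rfl (Category.assoc _ _ _).symm]
    exact SendsAlong.comp hL hcart hs rfl hs' ((e x).isHomLift _ _ _) (h.sendsAlong hs' h₁ h₃)
      (h'.sendsAlong hs h₃ h₄)

lemma acts_dom (φ : x ⟶ y) : Acts φ (pullback.fst (PiHom.base φ) y.map)
    (pullback.snd (PiHom.base φ) y.map) (PiHom.dom φ) :=
  ⟨pullback.condition, PiHom.app_universal φ⟩

lemma lift_fst_snd (φ : x ⟶ y) : pullback.lift (pullback.fst (PiHom.base φ) y.map)
    (pullback.snd (PiHom.base φ) y.map) pullback.condition = 𝟙 _ := by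
  apply pullback.hom_ext <;> simp

section Universal

variable {φ : x ⟶ y} {U : E} {ξ : U ⟶ P x}

/-- Realisation may be checked at the universal element. -/
lemma realises_of_isRestriction
    (hξ : p.IsStronglyCartesian (pullback.fst (PiHom.base φ) y.map) ξ)
    {ρ : U ⟶ L.obj (tot ((reindex q (PiHom.dom φ)).obj x.obj))}
    (hρ : (e x).IsRestriction ξ (PiHom.dom φ) (L.map (cart q _ x.obj)) ρ) {θ : P x ⟶ P y}
    (hθ : p.IsHomLift (PiHom.base φ) θ)
    (hθ' : p.IsHomLift (pullback.snd (PiHom.base φ) y.map ≫ y.map) (ξ ≫ θ))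
    (h : ρ ≫ L.map (arrow φ) = (e y).ev (pullback.snd _ _) (ξ ≫ θ) hθ') : Realises e φ θ where
  isHomLift := hθ
  sendsAlong {T c a b d χ} hd h₁ h₂ := by
    have hs : SendsAlong L p φ _ _ _ _ :=
      ⟨pullback.condition, ρ, (lift_fst_snd φ).symm ▸ hρ.vertical, hρ.fac, h⟩
    have hm : p.IsHomLift a χ := hd.map ▸ h₁
    -- The pair (a, b) is a point of I ×_J Y, so the element factors through the universal ξ and the
    -- relation there restricts to it.
    obtain ⟨χ', hχ', rfl⟩ := exists_factor hξ (pullback.lift_fst a b hd.w).symm hm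
    have := hs.comp_left hχ' (pullback.lift_fst a b hd.w) (pullback.lift_snd a b hd.w)
    rw [(e x).comp_ev' hχ' hρ.isHomLift h₁ hd.2 rfl, (e y).comp_ev' hχ' hθ' h₂
      (pullback.lift_snd a b hd.w) (Category.assoc _ _ _).symm] at this
    exact this

/-- At the universal element, an arrow realising φ has an evaluation split by `PiHom.dom φ` and
`arrow φ`. Uniqueness of splittings can therefore recover φ from θ. -/
lemma Realises.exists_isRestriction {θ : P x ⟶ P y} (h : Realises e φ θ)
    (hcart : ∀ {R S : B} {f : R ⟶ S} {a b : D} {φ : a ⟶ b},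
      q.IsStronglyCartesian f φ → p.IsStronglyCartesian f (L.map φ))
    (hξ : p.IsStronglyCartesian (pullback.fst (PiHom.base φ) y.map) ξ)
    (hθ' : p.IsHomLift (pullback.snd (PiHom.base φ) y.map ≫ y.map) (ξ ≫ θ)) :
    ∃ ρ, (e x).IsRestriction ξ (PiHom.dom φ) (L.map (cart q _ x.obj)) ρ ∧
      ρ ≫ L.map (arrow φ) = (e y).ev (pullback.snd _ _) (ξ ≫ θ) hθ' := by
  have hξ' : p.IsHomLift (PiHom.dom φ ≫ x.map) ξ := by rw [PiHom.w φ]; exact hξ.toIsHomLift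
  obtain ⟨_, ρ, hρ, e₁, e₂⟩ := h.sendsAlong (acts_dom φ) hξ' hθ'
  rw [lift_fst_snd] at hρ
  exact ⟨ρ, ⟨hξ', hcart (isStronglyCartesian_cart q _ _), hρ, e₁⟩, e₂⟩

end Universal

/-- Over I ×_J Y, restrict the product `P x` along the `dom` component of φ, follow it by `arrow φ`,
and transpose under the product `P y`. -/
lemma exists_realises [p.IsFibered] (hL : L ⋙ p = q) (he : ∀ x, (e x).IsProduct)
    (hP : ∀ x, p.obj (P x) = x.base)
    (hcart : ∀ {R S : B} {f : R ⟶ S} {a b : D} {φ : a ⟶ b},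
      q.IsStronglyCartesian f φ → p.IsStronglyCartesian f (L.map φ)) (φ : x ⟶ y) :
    ∃ θ : P x ⟶ P y, Realises e φ θ := by
  obtain ⟨U, ξ, hξ⟩ := exists_cartesian p (pullback.fst (PiHom.base φ) y.map) (hP x)
  have hξ' : p.IsHomLift (PiHom.dom φ ≫ x.map) ξ := by rw [PiHom.w φ]; exact hξ.toIsHomLift
  obtain ⟨ρ, hρ⟩ := (e x).exists_isRestriction_of_cartesian hξ'
    (hcart (isStronglyCartesian_cart q (PiHom.dom φ) x.obj))
  have ht : p.IsHomLift (pullback.snd (PiHom.base φ) y.map) (ρ ≫ L.map (arrow φ)) :=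
    isHomLift_comp hρ.vertical ((isHomLift_map_iff hL).2 (arrow_isHomLift φ)) (Category.id_comp _)
  have sq := IsPullback.of_hasPullback (PiHom.base φ) y.map
  obtain ⟨θ, ⟨hθ, hθ'⟩, -⟩ := (he y).existsUnique sq hξ ht
  have h := Evaluation.isHomLift_sq sq.w hξ hθ
  exact ⟨θ, realises_of_isRestriction hξ hρ hθ h (hθ' h).symm⟩

lemma Realises.unique [p.IsFibered] (he : ∀ x, (e x).IsProduct)
    (hP : ∀ x, p.obj (P x) = x.base)
    (hcart : ∀ {R S : B} {f : R ⟶ S} {a b : D} {φ : a ⟶ b},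
      q.IsStronglyCartesian f φ → p.IsStronglyCartesian f (L.map φ)) {φ : x ⟶ y}
    {θ θ' : P x ⟶ P y} (h : Realises e φ θ) (h' : Realises e φ θ') : θ = θ' := by
  obtain ⟨U, ξ, hξ⟩ := exists_cartesian p (pullback.fst (PiHom.base φ) y.map) (hP x)
  have sq := IsPullback.of_hasPullback (PiHom.base φ) y.map
  have hξ' : p.IsHomLift (PiHom.dom φ ≫ x.map) ξ := by rw [PiHom.w φ]; exact hξ.toIsHomLift
  refine (he y).hom_ext sq hξ h.isHomLift h'.isHomLift ?_
  exact (h.sendsAlong (acts_dom φ) hξ' _).unique hcart (h'.sendsAlong (acts_dom φ) hξ' _)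

/-- Evaluating θ over I ×_J Y gives an arrow pr₁^* `P x` → β over pr₂. Its splitting supplies the
two components of φ: the section gives the map to X, and fullness of L pulls the remaining arrow
back to D. -/
lemma exists_realised [p.IsFibered] [L.Full] (hL : L ⋙ p = q) (hP : ∀ x, p.obj (P x) = x.base)
    (hcart : ∀ {R S : B} {f : R ⟶ S} {a b : D} {φ : a ⟶ b},
      q.IsStronglyCartesian f φ → p.IsStronglyCartesian f (L.map φ))
    (hsplit : ∀ (x y : PiObj F q) {K : B} {m : K ⟶ x.base} {Q : E} {k : Q ⟶ P x},
      p.IsStronglyCartesian m k → (e x).HasUniqueSplitting K k (L.obj (tot y.obj)))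
    (θ : P x ⟶ P y) : ∃ φ : x ⟶ y, Realises e φ θ := by
  obtain ⟨f, hθ⟩ : ∃ f : x.base ⟶ y.base, p.IsHomLift f θ := by
    rw [← hP x, ← hP y]
    exact ⟨_, IsHomLift.map p θ⟩
  obtain ⟨U, ξ, hξ⟩ := exists_cartesian p (pullback.fst f y.map) (hP x)
  have hθ' := Evaluation.isHomLift_sq pullback.condition hξ hθ
  obtain ⟨d, R, l, ρ, t, hρ, ht, h⟩ := (hsplit x y hξ).exists_fac
    ((e y).isHomLift (pullback.snd f y.map) (ξ ≫ θ) hθ')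
  have w : d ≫ x.map = pullback.fst f y.map := isHomLift_unique hρ.isHomLift hξ.toIsHomLift
  obtain ⟨ρ', hρ'⟩ := (e x).exists_isRestriction_of_cartesian hρ.isHomLift
    (hcart (isStronglyCartesian_cart q d x.obj))
  obtain ⟨t', ht', h'⟩ := hρ.exists_transfer hρ' ht
  obtain ⟨t', rfl⟩ := L.map_surjective t'
  rw [isHomLift_map_iff hL] at ht'
  refine ⟨ofArrow f d w t' ht', realises_of_isRestriction (φ := ofArrow f d w t' ht') hξ hρ' hθ
    hθ' ?_⟩
  rw [arrow_ofArrow]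
  exact h'.trans h

/-- Both arrows split the same evaluation of θ, so uniqueness gives first equal sections and then
equal arrow components, up to faithfulness of L. -/
lemma Realises.eq [p.IsFibered] [L.Faithful] (hL : L ⋙ p = q) (hP : ∀ x, p.obj (P x) = x.base)
    (hcart : ∀ {R S : B} {f : R ⟶ S} {a b : D} {φ : a ⟶ b},
      q.IsStronglyCartesian f φ → p.IsStronglyCartesian f (L.map φ))
    (hsplit : ∀ (x y : PiObj F q) {K : B} {m : K ⟶ x.base} {Q : E} {k : Q ⟶ P x},
      p.IsStronglyCartesian m k → (e x).HasUniqueSplitting K k (L.obj (tot y.obj)))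
    {φ ψ : x ⟶ y} {θ : P x ⟶ P y} (h : Realises e φ θ) (h' : Realises e ψ θ) : φ = ψ := by
  have hb : PiHom.base φ = PiHom.base ψ := isHomLift_unique h.isHomLift h'.isHomLift
  obtain ⟨U, ξ, hξ⟩ := exists_cartesian p (pullback.fst (PiHom.base φ) y.map) (hP x)
  have hθ := Evaluation.isHomLift_sq pullback.condition hξ h.isHomLift
  have h₁ := arrow_isHomLift φ
  have h₂ := arrow_isHomLift ψ
  obtain ⟨ρ, hρ, e₁⟩ := h.exists_isRestriction hcart hξ hθ
  obtain ⟨f, d, w, t⟩ := φ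
  obtain ⟨f', d', w', t'⟩ := ψ
  obtain rfl : f = f' := hb
  obtain ⟨ρ', hρ', e₂⟩ := h'.exists_isRestriction hcart hξ hθ
  rw [← isHomLift_map_iff hL] at h₁ h₂
  obtain rfl : d = d' := (hsplit x y hξ).section_unique hρ hρ' h₁ h₂ (e₁.trans e₂.symm)
  obtain rfl : ρ = ρ' := cartesian_hom_ext hρ.cartesian hρ.vertical hρ'.vertical
    (hρ.fac.trans hρ'.fac.symm)
  exact ext_arrow (L.map_injective ((hsplit x y hξ).hom_ext hρ h₁ h₂ (e₁.trans e₂.symm)))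

end Realisation

end PiHom

/-- A fibration is equivalent to a product completion if its objects are the products of a full
subfibration whose objects have unique splittings along such products. -/
theorem nonempty_fibredEquivalence_piCompletion {F : MorphismProperty B} [IsDisplayMapClass F]
    {E : Type u₂} [Category.{v₂} E] {D : Type u₃} [Category.{v₃} D] {p : E ⥤ B} [p.IsFibered]
    {q : D ⥤ B} [q.IsFibered] (L : D ⥤ E) [L.Full] [L.Faithful] (hL : L ⋙ p = q)
    (hcart : ∀ {R S : B} {f : R ⟶ S} {a b : D} {φ : a ⟶ b},
      q.IsStronglyCartesian f φ → p.IsStronglyCartesian f (L.map φ))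
    {P : PiObj F q → E} (e : ∀ x : PiObj F q, Evaluation p x.map (P x) (L.obj (tot x.obj)))
    (he : ∀ x, (e x).IsProduct) (hP : ∀ x, p.obj (P x) = x.base)
    (hsplit : ∀ (x y : PiObj F q) {K : B} {m : K ⟶ x.base} {Q : E} {k : Q ⟶ P x},
      p.IsStronglyCartesian m k → (e x).HasUniqueSplitting K k (L.obj (tot y.obj)))
    (hsurj : ∀ X : E, ∃ (x : PiObj F q) (i : P x ≅ X), p.IsHomLift (𝟙 (p.obj X)) i.hom) :
    Nonempty (FibredEquivalence p (piCompletion F q)) := by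
  choose map hmap using fun (x y : PiObj F q) (φ : x ⟶ y) =>
    PiHom.exists_realises (e := e) hL he hP hcart φ
  -- Functoriality costs nothing beyond uniqueness of realisations.
  let K : PiObj F q ⥤ E :=
    { obj := P
      map := fun {x y} φ => map x y φ
      map_id := fun x => (hmap x x (𝟙 x)).unique he hP hcart (PiHom.realises_id hL (hP x))
      map_comp := fun {x y z} φ ψ => (hmap x z (φ ≫ ψ)).unique he hP hcart
        ((hmap x y φ).comp hL hcart (hmap y z ψ)) }
  have hfull : K.Full := ⟨fun {x y} θ => by
    obtain ⟨φ, hφ⟩ := PiHom.exists_realised (e := e) hL hP hcart hsplit θ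
    exact ⟨φ, (hmap x y φ).unique he hP hcart hφ⟩⟩
  have hfaithful : K.Faithful := ⟨fun {x y φ ψ} h =>
    (hmap x y φ).eq hL hP hcart hsplit
      ((show map x y φ = map x y ψ from h) ▸ hmap x y ψ)⟩
  refine nonempty_fibredEquivalence K ?_ hsurj
  refine CategoryTheory.Functor.ext hP fun x y φ => ?_
  have := (hmap x y φ).isHomLift
  exact IsHomLift.fac' p (PiHom.base φ) (map x y φ)

end FibredProducts

/-! ### The subfibration of quantifier-free objects and the theorem -/

namespace FibredProducts

variable {B : Type u₁} [Category.{v₁} B]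

/-- Unique splittings of arrows into an object pass to its reindexings. -/
lemma Evaluation.HasUniqueSplitting.of_cartesian {E : Type u₂} [Category.{v₂} E] {p : E ⥤ B}
    {A J : B} {v : A ⟶ J} {P β : E} {e : Evaluation p v P β} {K : B} {Q X Y : E} {k : Q ⟶ P}
    {R S : B} {f : R ⟶ S} {φ : X ⟶ Y} (hφ : p.IsStronglyCartesian f φ)
    (H : e.HasUniqueSplitting K k Y) : e.HasUniqueSplitting K k X := by
  have hcod : ∀ {T S' : B} {n : T ⟶ S'} {c : E} {t : c ⟶ X}, p.IsHomLift n t → R = S' :=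
    fun {T S' n c t} h =>
      (IsHomLift.domain_eq p f φ).symm.trans (IsHomLift.codomain_eq p n t)
  have hcomp : ∀ {T : B} {n : T ⟶ R} {c : E} {t : c ⟶ X}, p.IsHomLift n t →
      p.IsHomLift (n ≫ f) (t ≫ φ) := fun h => isHomLift_comp h hφ.toIsHomLift rfl
  refine ⟨fun {S' n h} hh => ?_, fun {S' n d d' R R' m m' ρ ρ'} hρ hρ' {t t'} ht ht' h => ?_,
    fun {S' n d R m ρ} hρ {t t'} ht ht' h => ?_⟩
  · obtain rfl := hcod hh
    obtain ⟨d, R, l, ρ, t, hρ, ht, h'⟩ := H.exists_fac (hcomp hh)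
    obtain ⟨t', ht', rfl⟩ := exists_factor hφ rfl ht
    refine ⟨d, R, l, ρ, t', hρ, ht', cartesian_hom_ext hφ
      (isHomLift_comp hρ.vertical ht' (Category.id_comp _)) hh ?_⟩
    rw [Category.assoc, h']
  · obtain rfl := hcod ht
    exact H.section_unique hρ hρ' (hcomp ht) (hcomp ht') (by simp only [← Category.assoc, h])
  · obtain rfl := hcod ht
    exact cartesian_hom_ext hφ ht ht'
      (H.hom_ext hρ (hcomp ht) (hcomp ht') (by simp only [← Category.assoc, h]))

variable {F : MorphismProperty B} {E : Type u₂} [Category.{v₂} E] {p : E ⥤ B} [p.IsFibered]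
  [HasFibredProducts F p]

variable (F p) in
/-- The quantifier-free objects of the total category. -/
def quantifierFree : ObjectProperty E := fun X =>
  IsQuantifierFree F p (⟨X, rfl⟩ : p.Fiber (p.obj X))

/-- Closure under reindexing, for arbitrary cartesian arrows and not just the chosen ones: the full
subcategory is thereby a subfibration. -/
lemma quantifierFree.of_cartesian {R S : B} {f : R ⟶ S} {X Y : E} {φ : X ⟶ Y}
    (hφ : p.IsStronglyCartesian f φ) (hY : quantifierFree F p Y) : quantifierFree F p X :=
  isQuantifierFree_of_hasUniqueSplitting fun u hu β =>
    (hasUniqueSplitting_prodEvaluation hY u hu β).of_cartesian hφ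

lemma quantifierFree.exists_cartesian {Y : (quantifierFree F p).FullSubcategory} {R : B}
    (f : R ⟶ p.obj Y.obj) : ∃ (X : (quantifierFree F p).FullSubcategory) (φ : X ⟶ Y),
      p.IsStronglyCartesian f ((quantifierFree F p).ι.map φ) := by
  obtain ⟨X, φ, hφ⟩ := FibredProducts.exists_cartesian p f rfl
  exact ⟨⟨X, .of_cartesian hφ Y.property⟩, ObjectProperty.homMk φ, hφ⟩

instance : ((quantifierFree F p).ι ⋙ p).IsFibered :=
  .of_exists_isStronglyCartesian fun Y _ f => by
    obtain ⟨X, φ, hφ⟩ := quantifierFree.exists_cartesian (Y := Y) f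
    exact ⟨X, φ, isStronglyCartesian_of_map rfl hφ⟩

/-- The ambient cartesian lift of f already lies in the subcategory and is cartesian there, so a
cartesian arrow of the subcategory differs from it by a vertical isomorphism. -/
lemma quantifierFree.isStronglyCartesian_map {R S : B} {f : R ⟶ S}
    {X Y : (quantifierFree F p).FullSubcategory} {φ : X ⟶ Y}
    (hφ : ((quantifierFree F p).ι ⋙ p).IsStronglyCartesian f φ) :
    p.IsStronglyCartesian f ((quantifierFree F p).ι.map φ) := by
  obtain rfl : p.obj Y.obj = S :=
    IsHomLift.codomain_eq ((quantifierFree F p).ι ⋙ p) f φ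
  obtain ⟨Z, ψ, hψ⟩ := quantifierFree.exists_cartesian (Y := Y) f
  obtain ⟨i, hi, -, h, -⟩ := exists_cartesian_iso hφ (isStronglyCartesian_of_map rfl hψ)
  rw [← h, Functor.map_comp]
  exact isStronglyCartesian_iso_comp hψ ((quantifierFree F p).ι.mapIso i)
    ((isHomLift_map_iff rfl).2 hi)

/-- A fibration with enough quantifier-free objects is equivalent to the product completion of its
subfibration of quantifier-free objects. -/
theorem HasEnoughQuantifierFree.nonempty_fibredEquivalence [IsDisplayMapClass F]
    (H : HasEnoughQuantifierFree F p) :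
    Nonempty (FibredEquivalence p (piCompletion F ((quantifierFree F p).ι ⋙ p))) := by
  let β (x : PiObj F ((quantifierFree F p).ι ⋙ p)) : p.Fiber x.dom :=
    ⟨(quantifierFree F p).ι.obj (tot x.obj), tot_proj x.obj⟩
  refine nonempty_fibredEquivalence_piCompletion (quantifierFree F p).ι rfl
    quantifierFree.isStronglyCartesian_map
    (P := fun x => tot ((prod p x.map x.display).obj (β x)))
    (fun x => prodEvaluation p x.map x.display (β x))
    (fun x => prodEvaluation_isProduct p x.map x.display (β x)) (fun x => tot_proj _)
    (fun x y {K m Q k} hk => ?_) fun X => ?_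
  · exact IsQuantifierFree.hasUniqueSplitting (tot y.obj).property x.display
      (prodEvaluation_isProduct p x.map x.display (β x)) (tot_proj (β x)) hk
  · obtain ⟨A, f, hf, ⟨Y, rfl⟩, hY, ⟨i⟩⟩ := H (⟨X, rfl⟩ : p.Fiber (p.obj X))
    let Y' : (quantifierFree F p).FullSubcategory := ⟨Y, hY⟩
    refine ⟨⟨p.obj X, p.obj Y, f, hf, ⟨Y', rfl⟩⟩, ?_⟩
    exact ⟨(Functor.Fiber.fiberInclusion.mapIso i).symm, i.inv.2⟩

end FibredProducts

end

theorem mainTheorem3 {B : Type u₁} [Category.{v₁} B] (F : MorphismProperty B)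
    [FibredProducts.IsDisplayMapClass F] (hunits : FibredProducts.HasUnits F)
    (hcomp : F.IsStableUnderComposition)
    {E : Type u₂} [Category.{v₂} E] (p : E ⥤ B) [p.IsFibered]
    [FibredProducts.HasFibredProducts F p] :
    (∃ (E' : Type u₂) (_ : Category.{v₂} E') (q : E' ⥤ B) (_ : q.IsFibered),
      Nonempty (FibredProducts.FibredEquivalence p (FibredProducts.piCompletion F q))) ↔
    FibredProducts.HasEnoughQuantifierFree F p := by
  -- Identities are display maps because isomorphisms are; this makes the unit objects (1_A, α)
  -- available.
  have : F.ContainsIdentities :=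
    ⟨fun X => hunits _ (MorphismProperty.isomorphisms.infer_property _)⟩
  refine ⟨?_, fun H => ⟨_, inferInstance, _, inferInstance, H.nonempty_fibredEquivalence⟩⟩
  rintro ⟨E', _, q, _, ⟨eqv⟩⟩
  exact eqv.hasEnoughQuantifierFree hcomp
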